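/- Let $\lambda\in[2/3,1]$ and let $k\in\mathbb N$ with $3\mid k$ be constants. The $k$-hyperclique problem asks, given a $3$-uniform hypergraph with vertex set $V$, whether there is a set $C\subseteq V$ with $|C|=k$ all of whose $3$-element subsets are hyperedges. The Translated Orthant Problem in $\mathbb R^3$ asks, given a finite set $\mathcal Z$ of shapes, each of them a finite union of closed axis-parallel orthants, and a finite set $\mathcal S$ of objects, each of them a translate of some shape in $\mathcal Z$ (given by a translation vector and a pointer to the shape), whether $\bigcap_{S\in\mathcal S}S\neq\emptyset$. The $k$-hyperclique problem on $3$-uniform hypergraphs with $|V|\ge 1$ vertices reduces to the Translated Orthant Problem in $\mathbb R^3$: there is an algorithm that, given a $3$-uniform hypergraph $H$ on $|V|$ vertices, outputs an instance $(\mathcal Z,\mathcal S)$ with $\bigcap_{S\in\mathcal S}S\neq\emptyset$ if and only if $H$ has a $k$-hyperclique. The instance has $$|\mathcal S|=\Theta\big(|V|^{2\lambda k/3+4}\big)$$ translation objects and a total, over all shapes in $\mathcal Z$, of $$\Theta\big(|V|^{2(1-\lambda)k/3+4}\big)$$ orthants, and the algorithm runs in time $O\big(|V|^{2\lambda k/3+4}\big)$.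 The implied constants depend only on $\lambda$ and $k$. Running time is counted on a real RAM (unit-cost exact real arithmetic and comparisons, and words of $w$ bits for every $w\ge c(\lfloor\log_2|V|\rfloor+1)$, with a constant $c$ depending only on $\lambda$ and $k$); the real number $\lambda$ is available to the program as a constant. -/

import Mathlib

/-! ### Hypercliques in 3-uniform hypergraphs -/

/-- Every hyperedge has exactly three vertices. -/
def IsThreeUniform {V : Type*} (H : Hypergraph V) : Prop :=
  ∀ e ∈ H.edgeSet, e.ncard = 3

/-- There is a `k`-element set of vertices all of whose 3-element subsets are hyperedges. -/
def HasHyperclique {V : Type*} (H : Hypergraph V) (k : ℕ) : Prop :=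
  ∃ C : Set V, C ⊆ H.vertexSet ∧ C.Finite ∧ C.ncard = k ∧
    ∀ e : Set V, e ⊆ C → e.ncard = 3 → e ∈ H.edgeSet

/-! ### The Translated Orthant Problem -/

/-- A closed axis-parallel orthant of `ℝ^d`: its corner, and for every coordinate the direction
(`true` for `[a, ∞)`, `false` for `(-∞, a]`) of the ray that it spans there. -/
@[ext]
structure Orthant (d : ℕ) where
  up : Fin d → Bool
  corner : Fin d → ℝ

/-- The set of points of an orthant. -/
def Orthant.toSet {d : ℕ} (Q : Orthant d) : Set (Fin d → ℝ) :=
  {x | ∀ i, if Q.up i then Q.corner i ≤ x i else x i ≤ Q.corner i}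

/-- The shape that a finite set of orthants describes: their union. -/
def shapeSet {d : ℕ} (Z : Finset (Orthant d)) : Set (Fin d → ℝ) :=
  ⋃ Q ∈ Z, Q.toSet

/-- An instance of the Translated Orthant Problem in `ℝ^d`: a finite set of shapes, each given by
a finite set of orthants, and a finite set of translation objects `(τ, Z)`, where `τ` is a
translation vector and `Z` is one of the shapes. -/
structure TOInstance (d : ℕ) where
  shapes : Finset (Finset (Orthant d))
  objects : Finset ((Fin d → ℝ) × Finset (Orthant d))
  shape_mem : ∀ o ∈ objects, o.2 ∈ shapes

namespace TOInstance

variable {d : ℕ}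

/-- The number of translation objects. -/
def numTranslates (I : TOInstance d) : ℕ := I.objects.card

/-- The total number of orthants over all shapes. -/
def numOrthants (I : TOInstance d) : ℕ := ∑ Z ∈ I.shapes, Z.card

/-- The yes-instances: the translated shapes have a common point. -/
def IsYes (I : TOInstance d) : Prop :=
  (⋂ o ∈ I.objects, (fun x => x + o.1) '' shapeSet o.2).Nonempty

end TOInstance

/-! ### A real RAM

The machine works on two sorts of data. Words are natural numbers below `2 ^ w`, with arithmetic
modulo `2 ^ w` (subtraction is cut off at `0`); `w` is the word size. Reals are exact. For each sort
there are registers and a memory; both memories are addressed by words. A word can be converted into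
a real; reals influence words only through comparisons. Programs are structured (sequence,
conditional, loop), the only constants in a program are natural numbers, and every elementary
operation costs one time unit. Results are appended to an output tape. -/

namespace RealRAM

/-- Word-valued expressions; `load a` reads the word memory at address `a`. -/
inductive WExp where
  | const (n : ℕ)
  | reg (i : ℕ)
  | load (a : WExp)
  | add (a b : WExp)
  | sub (a b : WExp)
  | mul (a b : WExp)
  | div (a b : WExp)
  | mod (a b : WExp)

/-- Real-valued expressions; `load a` reads the real memory at address `a`. -/
inductive RExp where
  | reg (i : ℕ)
  | load (a : WExp)
  | ofWord (a : WExp)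
  | add (x y : RExp)
  | sub (x y : RExp)
  | mul (x y : RExp)
  | div (x y : RExp)

/-- Comparisons of words and of reals. -/
inductive Test where
  | wordEq (a b : WExp)
  | wordLt (a b : WExp)
  | realLe (x y : RExp)
  | realLt (x y : RExp)

/-- Programs. -/
inductive Prog where
  | skip
  | setWord (i : ℕ) (e : WExp)
  | setReal (i : ℕ) (e : RExp)
  | storeWord (a e : WExp)
  | storeReal (a : WExp) (e : RExp)
  | writeWord (e : WExp)
  | writeReal (e : RExp)
  | seq (p q : Prog)
  | ite (b : Test) (p q : Prog)
  | loop (b : Test) (p : Prog)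

/-- An entry of the output tape: a word or a real. -/
abbrev Token := ℕ ⊕ ℝ

/-- Machine states. -/
structure State where
  wreg : ℕ → ℕ
  rreg : ℕ → ℝ
  wmem : ℕ → ℕ
  rmem : ℕ → ℝ
  out : List Token

/-- The value of a word expression for word size `w`. -/
def WExp.eval (w : ℕ) (s : State) : WExp → ℕ
  | .const n => n % 2 ^ w
  | .reg i => s.wreg i
  | .load a => s.wmem (a.eval w s)
  | .add a b => (a.eval w s + b.eval w s) % 2 ^ w
  | .sub a b => a.eval w s - b.eval w s
  | .mul a b => (a.eval w s * b.eval w s) % 2 ^ w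
  | .div a b => a.eval w s / b.eval w s
  | .mod a b => a.eval w s % b.eval w s

/-- The number of operations in a word expression. -/
def WExp.cost : WExp → ℕ
  | .const _ => 1
  | .reg _ => 1
  | .load a => a.cost + 1
  | .add a b => a.cost + b.cost + 1
  | .sub a b => a.cost + b.cost + 1
  | .mul a b => a.cost + b.cost + 1
  | .div a b => a.cost + b.cost + 1
  | .mod a b => a.cost + b.cost + 1

/-- The value of a real expression. -/
noncomputable def RExp.eval (w : ℕ) (s : State) : RExp → ℝ
  | .reg i => s.rreg i
  | .load a => s.rmem (a.eval w s)
  | .ofWord a => (a.eval w s : ℝ)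
  | .add x y => x.eval w s + y.eval w s
  | .sub x y => x.eval w s - y.eval w s
  | .mul x y => x.eval w s * y.eval w s
  | .div x y => x.eval w s / y.eval w s

/-- The number of operations in a real expression. -/
def RExp.cost : RExp → ℕ
  | .reg _ => 1
  | .load a => a.cost + 1
  | .ofWord a => a.cost + 1
  | .add x y => x.cost + y.cost + 1
  | .sub x y => x.cost + y.cost + 1
  | .mul x y => x.cost + y.cost + 1
  | .div x y => x.cost + y.cost + 1

/-- The outcome of a comparison. -/
def Test.Holds (w : ℕ) (s : State) : Test → Prop
  | .wordEq a b => a.eval w s = b.eval w s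
  | .wordLt a b => a.eval w s < b.eval w s
  | .realLe x y => x.eval w s ≤ y.eval w s
  | .realLt x y => x.eval w s < y.eval w s

/-- The number of operations in a comparison. -/
def Test.cost : Test → ℕ
  | .wordEq a b => a.cost + b.cost + 1
  | .wordLt a b => a.cost + b.cost + 1
  | .realLe x y => x.cost + y.cost + 1
  | .realLt x y => x.cost + y.cost + 1

/-- `Exec w p s s' t`: with word size `w`, the program `p` started in the state `s` halts in the
state `s'` after exactly `t` time units. -/
inductive Exec (w : ℕ) : Prog → State → State → ℕ → Prop
  | skip (s : State) : Exec w .skip s s 1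
  | setWord (i : ℕ) (e : WExp) (s : State) :
      Exec w (.setWord i e) s
        { s with wreg := Function.update s.wreg i (e.eval w s) } (e.cost + 1)
  | setReal (i : ℕ) (e : RExp) (s : State) :
      Exec w (.setReal i e) s
        { s with rreg := Function.update s.rreg i (e.eval w s) } (e.cost + 1)
  | storeWord (a e : WExp) (s : State) :
      Exec w (.storeWord a e) s
        { s with wmem := Function.update s.wmem (a.eval w s) (e.eval w s) } (a.cost + e.cost + 1)
  | storeReal (a : WExp) (e : RExp) (s : State) :
      Exec w (.storeReal a e) s
        { s with rmem := Function.update s.rmem (a.eval w s) (e.eval w s) } (a.cost + e.cost + 1)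
  | writeWord (e : WExp) (s : State) :
      Exec w (.writeWord e) s { s with out := s.out ++ [Sum.inl (e.eval w s)] } (e.cost + 1)
  | writeReal (e : RExp) (s : State) :
      Exec w (.writeReal e) s { s with out := s.out ++ [Sum.inr (e.eval w s)] } (e.cost + 1)
  | seq {p q : Prog} {s s' s'' : State} {t t' : ℕ} :
      Exec w p s s' t → Exec w q s' s'' t' → Exec w (.seq p q) s s'' (t + t')
  | iteTrue {b : Test} {p q : Prog} {s s' : State} {t : ℕ} :
      b.Holds w s → Exec w p s s' t → Exec w (.ite b p q) s s' (b.cost + t)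
  | iteFalse {b : Test} {p q : Prog} {s s' : State} {t : ℕ} :
      ¬ b.Holds w s → Exec w q s s' t → Exec w (.ite b p q) s s' (b.cost + t)
  | loopTrue {b : Test} {p : Prog} {s s' s'' : State} {t t' : ℕ} :
      b.Holds w s → Exec w p s s' t → Exec w (.loop b p) s' s'' t' →
        Exec w (.loop b p) s s'' (b.cost + t + t')
  | loopFalse {b : Test} {p : Prog} {s : State} :
      ¬ b.Holds w s → Exec w (.loop b p) s s b.cost

open Classical in
/-- The input state for a hypergraph `H` on the vertices `0, …, N - 1`: word register `0` holds `N`,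
real register `0` holds the real constant `lam`, and the word memory holds at address
`(a * N + b) * N + c` the bit that tells whether `{a, b, c}` is a hyperedge. Everything else
is `0` and the output tape is empty. -/
noncomputable def inputState (lam : ℝ) {N : ℕ} (H : Hypergraph (Fin N)) : State where
  wreg := fun i => if i = 0 then N else 0
  rreg := fun i => if i = 0 then lam else 0
  wmem := fun i =>
    if ∃ a b c : Fin N, i = ((a : ℕ) * N + b) * N + c ∧ {a, b, c} ∈ H.edgeSet then 1 else 0
  rmem := fun _ => 0
  out := []

/-! The output format. A shape is written as the word `1`, then each of its orthants preceded by
the word `1`, then the word `0`; an object as the word `1`, the index of its shape, and its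
translation vector. The list of shapes and the list of objects each end with the word `0`. -/

/-- An orthant is written coordinate by coordinate as direction bit and corner coordinate. -/
def encodeOrthant {d : ℕ} (Q : Orthant d) : List Token :=
  (List.finRange d).flatMap fun i => [Sum.inl (if Q.up i then 1 else 0), Sum.inr (Q.corner i)]

def encodeShape {d : ℕ} (Z : List (Orthant d)) : List Token :=
  [Sum.inl 1] ++ Z.flatMap (fun Q => [Sum.inl 1] ++ encodeOrthant Q) ++ [Sum.inl 0]

def encodeObject {d : ℕ} (j : ℕ) (τ : Fin d → ℝ) : List Token :=
  [Sum.inl 1, Sum.inl j] ++ List.ofFn fun i => Sum.inr (τ i)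

open Classical in
/-- The output tape `out` describes the instance `I`: it lists every shape, every orthant of every
shape, and every translation object of `I` exactly once. -/
def Describes {d : ℕ} (out : List Token) (I : TOInstance d) : Prop :=
  ∃ (Zs : List (List (Orthant d))) (os : List (Fin Zs.length × (Fin d → ℝ))),
    out = Zs.flatMap encodeShape ++ [Sum.inl 0] ++
      os.flatMap (fun o => encodeObject (o.1 : ℕ) o.2) ++ [Sum.inl 0] ∧
    (∀ Z ∈ Zs, Z.Nodup) ∧
    (Zs.map List.toFinset).Nodup ∧
    os.Nodup ∧
    I.shapes = (Zs.map List.toFinset).toFinset ∧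
    I.objects = (os.map fun o => (o.2, (Zs.get o.1).toFinset)).toFinset

end RealRAM

/-! Write `k = 3 * g` and `B = 3 * N`, and let `D` be the ceiling of `2 * g * (1 - lam)`. The
vertices of a clique are split into three groups of `g`. A lattice point of the cube of side `B ^ (2
* g)` is a guess of all of them: in base `B`, coordinate `d` carries group `d` in its upper `g`
digits and group `d + 1`, in reversed order, in its lower `g` digits. Each vertex thus has two
copies. A guess is a clique if no triple of vertices violates the hyperedge condition and the copies
that are used agree. A violation is a union of boxes, each of which fixes the leading digits of
every coordinate.

Two things keep the instance small. The first is the layout of the digits: any condition that is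
needed can be read from at most `2 * g + 2` leading digits in total (`exists_valid_eq`,
`exists_valid_two_groups`, `exists_valid_early`, `exists_valid_late`). This is where `lam ≥ 2 / 3`
enters, through `3 * D ≤ 2 * g + 2`. The second is that the complement of an antidiagonal chain of
boxes is a union of two orthants per gap, plus two for the third coordinate (`exists_quadrant_iff`,
`Family.Valid.inShape_iff`). One shape with `O(B ^ D)` orthants therefore forbids all values of
almost `D` digits simultaneously, and only about `2 * g - D` digits, up to an additive constant,
remain to be enumerated by translations.

Along the chain, one coordinate increases while another decreases. In the decreasing one, the
position of the box plus the chain offset is what the translation fixes, so the digits read there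
may be off by a carry. This is the reason for the factor `3` in the base: the vertex `u` is
represented by the digit `3 * u + 1`, digits divisible by `3` are forbidden in the translation, and
a carry of at most one then cannot change the vertex (`dig_of_hit`, `holds_of_forall`,
`not_hit_of_holds`). All corners are integers, so rounding down shows that integer points suffice.

For the lower bounds on the sizes, redundant orthants and translates are added. Their numbers
approximate real powers of `N` and are computed by repeated doubling with a real accumulator for the
exponent (`exec_padProg`). The families do not depend on `N` and are built into the program, which
enumerates orthants and translations with constant work for each. -/

namespace RealRAM

/-! ### Arithmetic without overflow, output and counting loops -/

theorem WExp.eval_add_of_lt {w : ℕ} {s : State} {a b : WExp} {x y : ℕ} (ha : a.eval w s = x)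
    (hb : b.eval w s = y) (h : x + y < 2 ^ w) : (WExp.add a b).eval w s = x + y := by
  simp only [WExp.eval, ha, hb, Nat.mod_eq_of_lt h]

theorem WExp.eval_mul_of_lt {w : ℕ} {s : State} {a b : WExp} {x y : ℕ} (ha : a.eval w s = x)
    (hb : b.eval w s = y) (h : x * y < 2 ^ w) : (WExp.mul a b).eval w s = x * y := by
  simp only [WExp.eval, ha, hb, Nat.mod_eq_of_lt h]

theorem WExp.eval_const_of_lt {w : ℕ} {s : State} {n : ℕ} (h : n < 2 ^ w) :
    (WExp.const n).eval w s = n := by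
  simp only [WExp.eval, Nat.mod_eq_of_lt h]

/-- The state `s` with word register `1` and the output tape replaced. -/
def State.upd (s : State) (i : ℕ) (o : List Token) : State :=
  { s with wreg := Function.update s.wreg 1 i, out := o }

/-- Write the values of a list of expressions. -/
def emit : List (WExp ⊕ RExp) → Prog
  | [] => .skip
  | .inl e :: l => .seq (.writeWord e) (emit l)
  | .inr e :: l => .seq (.writeReal e) (emit l)

def emitCost : List (WExp ⊕ RExp) → ℕ
  | [] => 1
  | .inl e :: l => (e.cost + 1) + emitCost l
  | .inr e :: l => (e.cost + 1) + emitCost l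

/-- The value of an expression, as a token. -/
noncomputable def evalToken (w : ℕ) (s : State) : WExp ⊕ RExp → Token
  | .inl e => .inl (e.eval w s)
  | .inr e => .inr (e.eval w s)

/-- Expressions never read the output tape. -/
theorem WExp.eval_upd_out (w : ℕ) (s : State) (i : ℕ) (o o' : List Token) (e : WExp) :
    e.eval w (s.upd i o) = e.eval w (s.upd i o') := by
  induction e <;> simp_all [WExp.eval, State.upd]

theorem RExp.eval_upd_out (w : ℕ) (s : State) (i : ℕ) (o o' : List Token) (e : RExp) :
    e.eval w (s.upd i o) = e.eval w (s.upd i o') := by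
  induction e with
  | reg j => rfl
  | load a => exact congrArg s.rmem (WExp.eval_upd_out w s i o o' a)
  | ofWord a => exact congrArg Nat.cast (WExp.eval_upd_out w s i o o' a)
  | add x y hx hy => simp only [RExp.eval, hx, hy]
  | sub x y hx hy => simp only [RExp.eval, hx, hy]
  | mul x y hx hy => simp only [RExp.eval, hx, hy]
  | div x y hx hy => simp only [RExp.eval, hx, hy]

theorem evalToken_upd_out (w : ℕ) (s : State) (i : ℕ) (o o' : List Token) (e : WExp ⊕ RExp) :
    evalToken w (s.upd i o) e = evalToken w (s.upd i o') e := by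
  cases e with
  | inl e => exact congrArg _ (WExp.eval_upd_out w s i o o' e)
  | inr e => exact congrArg _ (RExp.eval_upd_out w s i o o' e)

/-- Writing leaves the registers and memories alone, so all tokens can be evaluated in advance, with
the tape taken to be empty. -/
theorem exec_emit (w : ℕ) (s : State) (i : ℕ) (l : List (WExp ⊕ RExp)) (o : List Token) :
    Exec w (emit l) (s.upd i o) (s.upd i (o ++ l.map (evalToken w (s.upd i [])))) (emitCost l) := by
  induction l generalizing o with
  | nil => simpa [emit, emitCost] using Exec.skip (w := w) (s.upd i o)
  | cons e l ih =>
    rw [List.map_cons, evalToken_upd_out w s i [] o e]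
    cases e with
    | inl e =>
      have h := Exec.writeWord (w := w) e (s.upd i o)
      have h2 := ih (o ++ [Sum.inl (e.eval w (s.upd i o))])
      have := Exec.seq h h2
      simpa [emit, emitCost, evalToken] using this
    | inr e =>
      have h := Exec.writeReal (w := w) e (s.upd i o)
      have h2 := ih (o ++ [Sum.inr (e.eval w (s.upd i o))])
      have := Exec.seq h h2
      simpa [emit, emitCost, evalToken] using this

/-- Run `body` with word register `1` ranging over the numbers below the value of `bound`. -/
def forLoop (bound : WExp) (body : Prog) : Prog :=
  .seq (.setWord 1 (.const 0))
    (.loop (.wordLt (.reg 1) bound) (.seq body (.setWord 1 (.add (.reg 1) (.const 1)))))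

/-- The body has to leave the counter as it found it. A round costs the body, `bound.cost + 2` for
the test and `4` for the increment; the initialisation and the last, failing test account for the
additive term. -/
theorem exec_forLoop {w : ℕ} {s : State} {bound : WExp} {body : Prog} {n C : ℕ}
    {f : ℕ → List Token} (hn : n < 2 ^ w) (hbound : ∀ i o, bound.eval w (s.upd i o) = n)
    (hbody : ∀ i < n, ∀ o, ∃ t ≤ C, Exec w body (s.upd i o) (s.upd i (o ++ f i)) t)
    (i : ℕ) (o : List Token) :
    ∃ t ≤ n * (C + bound.cost + 6) + (bound.cost + 4),
      Exec w (forLoop bound body) (s.upd i o)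
        (s.upd n (o ++ (List.range n).flatMap f)) t := by
  have key : ∀ d i, i + d = n → ∀ o, ∃ t ≤ d * (C + bound.cost + 6) + (bound.cost + 2),
      Exec w (.loop (.wordLt (.reg 1) bound) (.seq body (.setWord 1 (.add (.reg 1) (.const 1)))))
        (s.upd i o) (s.upd n (o ++ (List.range' i d).flatMap f)) t := by
    intro d
    induction d with
    | zero =>
      intro i hi o
      obtain rfl : i = n := by omega
      refine ⟨(Test.wordLt (.reg 1) bound).cost, ?_, ?_⟩
      rotate_left
      · rw [List.range'_zero, List.flatMap_nil, List.append_nil]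
        apply Exec.loopFalse
        simp only [Test.Holds, hbound, WExp.eval]
        simp [State.upd]
      · simp [Test.cost, WExp.cost]; omega
    | succ d ih =>
      intro i hi o
      obtain ⟨t, ht, hex⟩ := hbody i (by omega) o
      obtain ⟨t', ht', hex'⟩ := ih (i + 1) (by omega) (o ++ f i)
      refine ⟨(Test.wordLt (.reg 1) bound).cost +
        (t + ((WExp.add (.reg 1) (.const 1)).cost + 1)) + t', ?_, ?_⟩
      rotate_left
      · refine Exec.loopTrue (s' := s.upd (i + 1) (o ++ f i)) ?_ (Exec.seq hex ?_) ?_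
        rotate_left
        · have h := Exec.setWord (w := w) 1 (.add (.reg 1) (.const 1)) (s.upd i (o ++ f i))
          have h1 : (1 : ℕ) % 2 ^ w = 1 := Nat.mod_eq_of_lt (by omega)
          have h2 : (i + 1) % 2 ^ w = i + 1 := Nat.mod_eq_of_lt (by omega)
          simpa [State.upd, WExp.eval, h1, h2] using h
        · rw [List.range'_succ, List.flatMap_cons, ← List.append_assoc]
          exact hex'
        · simp only [Test.Holds, hbound, WExp.eval]
          simp [State.upd]; omega
      · simp only [Test.cost, WExp.cost, Nat.succ_mul]; omega
  obtain ⟨t, ht, hex⟩ := key n 0 (by omega) o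
  have h0 := Exec.setWord (w := w) 1 (.const 0) (s.upd i o)
  have h0' : Exec w (.setWord 1 (.const 0)) (s.upd i o) (s.upd 0 o) 2 := by
    simpa [State.upd, WExp.eval, WExp.cost] using h0
  refine ⟨2 + t, by omega, ?_⟩
  have := Exec.seq h0' hex
  rwa [← List.range_eq_range'] at this

end RealRAM

/-! ### Digits -/

/-- The digit of `n` at the exponent `e` in base `B`. -/
def dig (B e n : ℕ) : ℕ := n / B ^ e % B

theorem dig_lt {B : ℕ} (hB : 0 < B) (e n : ℕ) : dig B e n < B := Nat.mod_lt _ hB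

/-- Induction that strips the lowest digit: the rest of the sum is `B` times a sum of the same form,
with shifted digits. -/
theorem dig_sum_range {B : ℕ} (d : ℕ → ℕ) (hd : ∀ e, d e < B) (L e : ℕ) :
    dig B e (∑ i ∈ Finset.range L, d i * B ^ i) = if e < L then d e else 0 := by
  induction L generalizing d e with
  | zero => simp [dig]
  | succ L ih =>
    have hB : 0 < B := (Nat.zero_le _).trans_lt (hd 0)
    have h : ∑ i ∈ Finset.range (L + 1), d i * B ^ i
        = d 0 + B * ∑ i ∈ Finset.range L, d (i + 1) * B ^ i := by
      rw [Finset.sum_range_succ', Finset.mul_sum, add_comm]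
      congr 1
      · simp
      · exact Finset.sum_congr rfl fun i _ => by ring
    rw [h]
    cases e with
    | zero => simp [dig, Nat.mod_eq_of_lt (hd 0)]
    | succ e =>
      have h2 : dig B (e + 1) (d 0 + B * ∑ i ∈ Finset.range L, d (i + 1) * B ^ i)
          = dig B e (∑ i ∈ Finset.range L, d (i + 1) * B ^ i) := by
        unfold dig
        rw [pow_succ', ← Nat.div_div_eq_div_mul, Nat.add_mul_div_left _ _ hB,
          Nat.div_eq_of_lt (hd 0), zero_add]
      rw [h2, ih (fun i => d (i + 1)) fun i => hd (i + 1)]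
      simp

theorem sum_dig_range (B x q : ℕ) :
    ∑ i ∈ Finset.range q, dig B i x * B ^ i = x % B ^ q := by
  induction q with
  | zero => simp [Nat.mod_one]
  | succ q ih => rw [Finset.sum_range_succ, ih, Nat.mod_pow_succ, dig, mul_comm (B ^ q)]

/-- The digits from `q` on describe the lower end of the cell of side `B ^ q` that contains `x`. -/
theorem sum_dig_Ico {B x q L : ℕ} (hq : q ≤ L) (hx : x < B ^ L) :
    ∑ i ∈ Finset.Ico q L, dig B i x * B ^ i = x / B ^ q * B ^ q := by
  have h := Finset.sum_range_add_sum_Ico (fun i => dig B i x * B ^ i) hq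
  rw [sum_dig_range, sum_dig_range, Nat.mod_eq_of_lt hx] at h
  have := Nat.mod_add_div' x (B ^ q)
  omega

theorem sum_digits_lt {B : ℕ} (d : ℕ → ℕ) (hd : ∀ e, d e < B) (L : ℕ) :
    ∑ i ∈ Finset.range L, d i * B ^ i < B ^ L := by
  induction L with
  | zero => simp
  | succ L ih =>
    rw [Finset.sum_range_succ, pow_succ]
    have : (d L + 1) * B ^ L ≤ B * B ^ L := Nat.mul_le_mul_right _ (hd L)
    nlinarith

theorem sum_subset_eq_sum_range {B L : ℕ} {S : Finset ℕ} (hS : ∀ e ∈ S, e < L) (d : ℕ → ℕ) :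
    ∑ e ∈ S, d e * B ^ e = ∑ e ∈ Finset.range L, (if e ∈ S then d e else 0) * B ^ e := by
  simp only [ite_mul, zero_mul, ← Finset.sum_filter]
  congr 1
  ext e
  simp only [Finset.mem_filter, Finset.mem_range]
  exact ⟨fun h => ⟨hS e h, h⟩, fun h => h.2⟩

theorem dig_sum {B L : ℕ} {S : Finset ℕ} (hS : ∀ e ∈ S, e < L) (d : ℕ → ℕ)
    (hd : ∀ e, d e < B) (e : ℕ) :
    dig B e (∑ e ∈ S, d e * B ^ e) = if e ∈ S then d e else 0 := by
  have hB : 0 < B := (Nat.zero_le _).trans_lt (hd 0)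
  rw [sum_subset_eq_sum_range hS, dig_sum_range _ fun e => ?_]
  · by_cases h : e ∈ S
    · simp [h, hS e h]
    · simp [h]
  · show (if e ∈ S then d e else 0) < B
    split_ifs
    exacts [hd e, hB]

theorem sum_lt_pow {B L : ℕ} {S : Finset ℕ} (hS : ∀ e ∈ S, e < L) (d : ℕ → ℕ)
    (hd : ∀ e, d e < B) : ∑ e ∈ S, d e * B ^ e < B ^ L := by
  have hB : 0 < B := (Nat.zero_le _).trans_lt (hd 0)
  rw [sum_subset_eq_sum_range hS]
  refine sum_digits_lt _ (fun e => ?_) L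
  split_ifs
  exacts [hd e, hB]

/-- Adding a number with digit `0` at `e` changes the digit at `e` by at most a carry. -/
theorem exists_carry {B : ℕ} (hB : 0 < B) {e x : ℕ} (hx : dig B e x = 0) (y : ℕ) :
    ∃ c ≤ 1, dig B e (y + x) = (dig B e y + c) % B := by
  have hp : 0 < B ^ e := pow_pos hB e
  unfold dig at *
  refine ⟨(y % B ^ e + x % B ^ e) / B ^ e, ?_, ?_⟩
  · have h1 := Nat.mod_lt y hp
    have h2 := Nat.mod_lt x hp
    exact Nat.lt_succ_iff.1 ((Nat.div_lt_iff_lt_mul hp).2 (by omega))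
  · have h : (y + x) / B ^ e = (y % B ^ e + x % B ^ e) / B ^ e + (y / B ^ e + x / B ^ e) := by
      conv_lhs => rw [← Nat.mod_add_div y (B ^ e), ← Nat.mod_add_div x (B ^ e)]
      rw [show y % B ^ e + B ^ e * (y / B ^ e) + (x % B ^ e + B ^ e * (x / B ^ e))
        = (y % B ^ e + x % B ^ e) + B ^ e * (y / B ^ e + x / B ^ e) by ring,
        Nat.add_mul_div_left _ _ hp]
    rw [h, Nat.add_mod, Nat.add_mod (y / B ^ e), hx]
    simp [Nat.add_mod, add_comm]

/-- Numbers in the same cell of side `B ^ q` have the same digits from the exponent `q` on. -/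
theorem div_pow_eq_of_le {B q e x y : ℕ} (hq : q ≤ e) (h : x / B ^ q = y / B ^ q) :
    x / B ^ e = y / B ^ e := by
  rw [← Nat.add_sub_of_le hq, pow_add, ← Nat.div_div_eq_div_mul, ← Nat.div_div_eq_div_mul, h]

/-! ### Spreading the digits of a number -/

/-- Put the base-`B` digits of `n` at the exponents in `es`, and what remains at the exponent `E`. -/
def spread (B E : ℕ) : List ℕ → ℕ → ℕ
  | [], n => n * B ^ E
  | e :: es, n => n % B * B ^ e + spread B E es (n / B)

/-- Spreading keeps the order of significance of the digits, and all of them go to exponents at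
least `e₀`. If the quotients by `B` differ, the induction hypothesis gains `B ^ (e + 1)`, while the
lowest digit loses at most `(B - 1) * B ^ e`; otherwise only the lowest digits matter. -/
theorem spread_gap {B E e₀ : ℕ} (hB : 0 < B) {es : List ℕ} (hs : es.Pairwise (· < ·))
    (hes : ∀ e ∈ es, e₀ ≤ e ∧ e < E) (hE : e₀ ≤ E) {n n' : ℕ} (h : n < n') :
    spread B E es n + B ^ e₀ ≤ spread B E es n' := by
  induction es generalizing e₀ n n' with
  | nil =>
    simp only [spread]
    have h1 : B ^ e₀ ≤ B ^ E := Nat.pow_le_pow_right hB hE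
    have h2 : (n + 1) * B ^ E ≤ n' * B ^ E := Nat.mul_le_mul_right _ h
    nlinarith
  | cons e es ih =>
    simp only [spread]
    rw [List.pairwise_cons] at hs
    have he := hes e List.mem_cons_self
    have h1 : B ^ e₀ ≤ B ^ e := Nat.pow_le_pow_right hB he.1
    have h2 : (n % B + 1) * B ^ e ≤ B * B ^ e := Nat.mul_le_mul_right _ (Nat.mod_lt n hB)
    rcases (Nat.div_le_div_right (c := B) h.le).lt_or_eq with hlt | heq
    · have h3 := ih (e₀ := e + 1) hs.2
        (fun e' he' => ⟨hs.1 e' he', (hes e' (List.mem_cons_of_mem _ he')).2⟩) he.2 hlt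
      have h4 := Nat.zero_le (n' % B * B ^ e)
      rw [pow_succ, mul_comm _ B] at h3
      rw [add_mul, one_mul] at h2
      linarith
    · have h4 : n % B < n' % B := by
        have := Nat.div_add_mod n B
        have := Nat.div_add_mod n' B
        rw [heq] at *
        omega
      have h5 : (n % B + 1) * B ^ e ≤ n' % B * B ^ e := Nat.mul_le_mul_right _ h4
      rw [heq]
      nlinarith

theorem spread_strictMono {B E : ℕ} (hB : 0 < B) {es : List ℕ} (hs : es.Pairwise (· < ·))
    (hes : ∀ e ∈ es, e < E) : StrictMono (spread B E es) := by
  intro n n' h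
  have h1 := spread_gap (e₀ := 0) hB hs (fun e he => ⟨Nat.zero_le e, hes e he⟩) (Nat.zero_le _) h
  rw [pow_zero] at h1
  omega

/-- What exceeds the available digits is moved to the distant exponent `E`. This provides the chain
with its two sentinels far away from the actual boxes. -/
theorem spread_add {B E : ℕ} (hB : 0 < B) (es : List ℕ) (n c : ℕ) :
    spread B E es (n + B ^ es.length * c) = spread B E es n + c * B ^ E := by
  induction es generalizing n with
  | nil => simp [spread, add_mul]
  | cons e es ih =>
    simp only [spread, List.length_cons, pow_succ', mul_assoc]
    rw [Nat.add_mul_mod_self_left, Nat.add_mul_div_left _ _ hB, ih, add_assoc]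

theorem spread_zero (B E : ℕ) (es : List ℕ) : spread B E es 0 = 0 := by
  induction es with
  | nil => simp [spread]
  | cons e es ih => simp [spread, ih]

theorem spread_eq_listSum {B E : ℕ} (hB : 0 < B) {es : List ℕ} (hs : es.Nodup) {n : ℕ}
    (hn : n < B ^ es.length) :
    ∃ d : ℕ → ℕ, (∀ e, d e < B) ∧ spread B E es n = (es.map fun e => d e * B ^ e).sum := by
  induction es generalizing n with
  | nil =>
    refine ⟨fun _ => 0, fun _ => hB, ?_⟩
    have : n = 0 := by simpa using hn
    simp [spread, this]
  | cons e es ih =>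
    rw [List.nodup_cons] at hs
    rw [List.length_cons, pow_succ] at hn
    obtain ⟨d, hd, h⟩ := ih hs.2 (Nat.div_lt_of_lt_mul (by rwa [mul_comm] at hn))
    refine ⟨Function.update d e (n % B), fun e' => ?_, ?_⟩
    · rcases eq_or_ne e' e with rfl | he
      · simpa using Nat.mod_lt n hB
      · simpa [he] using hd e'
    · rw [spread, h, List.map_cons, List.sum_cons, Function.update_self]
      congr 2
      refine List.map_congr_left fun e' he' => ?_
      rw [Function.update_of_ne]
      rintro rfl
      exact hs.1 he'

theorem exists_spread_eq_listSum {B E : ℕ} (hB : 0 < B) (es : List ℕ) {d : ℕ → ℕ}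
    (hd : ∀ e, d e < B) :
    ∃ n < B ^ es.length, spread B E es n = (es.map fun e => d e * B ^ e).sum := by
  induction es with
  | nil => exact ⟨0, by simp, by simp [spread]⟩
  | cons e es ih =>
    obtain ⟨n, hn, h⟩ := ih
    refine ⟨d e + B * n, ?_, ?_⟩
    · rw [List.length_cons, pow_succ']
      have h1 : B * (n + 1) ≤ B * B ^ es.length := Nat.mul_le_mul_left _ hn
      have := hd e
      nlinarith
    · rw [spread, Nat.add_mul_mod_self_left, Nat.mod_eq_of_lt (hd e), Nat.add_mul_div_left _ _ hB,
        Nat.div_eq_of_lt (hd e), zero_add, h, List.map_cons, List.sum_cons]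

/-- The elements of `S` in increasing order. -/
abbrev exps (S : Finset ℕ) : List ℕ := S.sort (· ≤ ·)

theorem listSum_exps (S : Finset ℕ) (f : ℕ → ℕ) : ((exps S).map f).sum = ∑ e ∈ S, f e := by
  rw [← List.sum_toFinset f (S.sort_nodup _), Finset.sort_toFinset]

theorem exps_pairwise (S : Finset ℕ) : (exps S).Pairwise (· < ·) := by
  exact (Finset.sortedLT_sort S).pairwise

/-- Together with `exists_spread_exps`: below `B ^ S.card`, spreading runs exactly through the
numbers whose digits are supported on `S`. -/
theorem spread_exps {B E : ℕ} (hB : 0 < B) {S : Finset ℕ} {n : ℕ} (hn : n < B ^ S.card) :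
    ∃ d : ℕ → ℕ, (∀ e, d e < B) ∧ spread B E (exps S) n = ∑ e ∈ S, d e * B ^ e := by
  obtain ⟨d, hd, h⟩ := spread_eq_listSum (E := E) hB (S.sort_nodup (· ≤ ·))
    (n := n) (by simpa using hn)
  exact ⟨d, hd, h.trans (listSum_exps S _)⟩

theorem exists_spread_exps {B E : ℕ} (hB : 0 < B) (S : Finset ℕ) {d : ℕ → ℕ}
    (hd : ∀ e, d e < B) :
    ∃ n < B ^ S.card, spread B E (exps S) n = ∑ e ∈ S, d e * B ^ e := by
  obtain ⟨n, hn, h⟩ := exists_spread_eq_listSum (E := E) hB (exps S) hd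
  exact ⟨n, by simpa using hn, h.trans (listSum_exps S _)⟩

theorem spread_exps_lt {B E L : ℕ} (hB : 0 < B) {S : Finset ℕ} (hS : ∀ e ∈ S, e < L) {n : ℕ}
    (hn : n < B ^ S.card) : spread B E (exps S) n < B ^ L := by
  obtain ⟨d, hd, h⟩ := spread_exps (E := E) hB hn
  rw [h]
  exact sum_lt_pow hS d hd

/-! ### Orthants with integer corners -/

/-- The orthant with directions `u` and the integer corner `c`. -/
def intOrthant (u : Fin 3 → Bool) (c : Fin 3 → ℤ) : Orthant 3 where
  up := u
  corner := fun i => (c i : ℝ)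

/-- The integer points of an orthant. -/
def InOrthant (u : Fin 3 → Bool) (c x : Fin 3 → ℤ) : Prop :=
  ∀ i, if u i then c i ≤ x i else x i ≤ c i

theorem mem_intOrthant_cast {u : Fin 3 → Bool} {c x t : Fin 3 → ℤ} :
    ((fun i => (x i : ℝ)) - fun i => (t i : ℝ)) ∈ (intOrthant u c).toSet ↔
      InOrthant u c (x - t) := by
  refine forall_congr' fun i => ?_
  by_cases hu : u i = true
  · simp only [intOrthant, hu, if_true, Pi.sub_apply]
    norm_cast
  · simp only [intOrthant, hu, Pi.sub_apply]
    norm_cast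

/-- An integer below `x` is below `⌊x⌋`, and an integer above `x` is above `⌊x⌋`. Rounding down
therefore respects closed rays with integer endpoints in both directions. -/
theorem InOrthant.floor {u : Fin 3 → Bool} {c t : Fin 3 → ℤ} {x : Fin 3 → ℝ}
    (h : (x - fun i => (t i : ℝ)) ∈ (intOrthant u c).toSet) :
    InOrthant u c ((fun i => ⌊x i⌋) - t) := by
  intro i
  by_cases hu : u i = true
  · have hi : (c i : ℝ) ≤ x i - t i := by simpa [intOrthant, hu] using h i
    rw [if_pos hu, Pi.sub_apply]
    have : c i + t i ≤ ⌊x i⌋ := Int.le_floor.2 (by push_cast; linarith)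
    linarith
  · have hi : x i - t i ≤ (c i : ℝ) := by simpa [intOrthant, hu] using h i
    rw [if_neg hu, Pi.sub_apply]
    have : ((⌊x i⌋ : ℤ) : ℝ) ≤ x i := Int.floor_le _
    have : ((⌊x i⌋ : ℤ) : ℝ) ≤ (c i + t i : ℤ) := by push_cast; linarith
    have := Int.cast_le.1 this
    linarith

theorem intOrthant_inj {u u' : Fin 3 → Bool} {c c' : Fin 3 → ℤ} :
    intOrthant u c = intOrthant u' c' ↔ u = u' ∧ c = c' := by
  constructor
  · intro h
    refine ⟨congrArg Orthant.up h, funext fun i => ?_⟩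
    have := congrFun (congrArg Orthant.corner h) i
    exact Int.cast_injective this
  · rintro ⟨rfl, rfl⟩
    rfl

/-! ### Antidiagonal chains of rectangles -/

/-- Outside an antidiagonal chain of rectangles, every point is in a quadrant between two consecutive
rectangles. -/
theorem exists_quadrant_iff {Y : ℕ → ℤ} {la lb : ℤ} (hla : 0 < la)
    (hga : ∀ i j, i < j → Y i + la ≤ Y j) (hgb : ∀ i j, i < j → Y i + lb ≤ Y j) (n : ℕ) {a b : ℤ}
    (ha0 : Y 0 + la ≤ a) (han : a < Y (n + 1)) (hb0 : b < -Y 0) :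
    (∃ i ≤ n, (a ≤ Y (i + 1) - 1 ∧ b ≤ -Y i - 1) ∨ (Y i + la ≤ a ∧ -Y (i + 1) + lb ≤ b)) ↔
      ¬ ∃ i, (1 ≤ i ∧ i ≤ n) ∧ (Y i ≤ a ∧ a < Y i + la) ∧ -Y i ≤ b ∧ b < -Y i + lb := by
  have hmono : ∀ i j, i ≤ j → Y i ≤ Y j := by
    intro i j h
    rcases h.lt_or_eq with h | rfl
    · linarith [hga i j h]
    · rfl
  constructor
  · rintro ⟨i, hi, h⟩ ⟨j, hj, ⟨h1, h2⟩, h3, h4⟩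
    -- A lower quadrant lies below the boxes up to `i` in the second direction and before the later
    -- ones in the first; an upper quadrant lies after the boxes up to `i` in the first direction
    -- and above the later ones in the second.
    rcases h with ⟨h5, h6⟩ | ⟨h5, h6⟩
    · rcases le_or_gt j i with h | h
      · linarith [hmono j i h]
      · linarith [hmono (i + 1) j h]
    · rcases le_or_gt j i with h | h
      · linarith [hmono j i h]
      · linarith [hmono (i + 1) j h]
  · intro h
    -- Locate the last box that starts at or before `a`.
    obtain ⟨i, hin, hi1, hi2⟩ : ∃ i ≤ n, Y i ≤ a ∧ a < Y (i + 1) := by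
      clear h
      induction n with
      | zero => exact ⟨0, le_rfl, by linarith, han⟩
      | succ n ih =>
        rcases lt_or_ge a (Y (n + 1)) with h | h
        · obtain ⟨i, hi, h⟩ := ih h
          exact ⟨i, by omega, h⟩
        · exact ⟨n + 1, le_rfl, h, han⟩
    -- Below the `i`-th box the point is in the lower quadrant of gap `i`. Otherwise `hb0` gives `i
    -- ≠ 0`; to the right of the box the point is in the upper quadrant of gap `i`, and above it in
    -- the upper quadrant of gap `i - 1`.
    rcases lt_or_ge b (-Y i) with hb | hb
    · exact ⟨i, hin, Or.inl ⟨by linarith, by linarith⟩⟩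
    · obtain ⟨i, rfl⟩ : ∃ i', i = i' + 1 := by
        refine ⟨i - 1, ?_⟩
        have : i ≠ 0 := by
          rintro rfl
          linarith
        omega
      rcases le_or_gt (Y (i + 1) + la) a with ha | ha
      · exact ⟨i + 1, hin, Or.inr ⟨ha, by linarith [hgb (i + 1) (i + 1 + 1) (by omega)]⟩⟩
      · refine ⟨i, by omega, Or.inr ⟨by linarith [hga i (i + 1) (by omega)], ?_⟩⟩
        by_contra hlt
        exact h ⟨i + 1, ⟨by omega, hin⟩, ⟨hi1, ha⟩, hb, by linarith⟩

/-! ### Families of forbidden boxes -/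

/-- A condition on the digits of a point: the vertices in three places form a hyperedge, or the
vertices in two places are equal. A place is a coordinate and an exponent. -/
inductive Cond where
  | edge (r₁ r₂ r₃ : Fin 3 × ℕ)
  | eq (r₁ r₂ : Fin 3 × ℕ)

def Cond.places : Cond → List (Fin 3 × ℕ)
  | .edge r₁ r₂ r₃ => [r₁, r₂, r₃]
  | .eq r₁ r₂ => [r₁, r₂]

/-- The condition for the vertices `u`, where hyperedges are given as a table for `N` vertices. -/
def Cond.Holds (N : ℕ) (bit : ℕ → ℕ) (u : Fin 3 × ℕ → ℕ) : Cond → Prop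
  | .edge r₁ r₂ r₃ => bit ((u r₁ * N + u r₂) * N + u r₃) ≠ 0
  | .eq r₁ r₂ => u r₁ = u r₂

/-- The data of a family of forbidden boxes: in the coordinate `i`, the boxes restrict the digits at
the exponents from `q i` on. The digits at the exponents in `S` of the coordinates `a` and `b` are
handled by an antidiagonal chain. -/
structure Family where
  (a b c : Fin 3)
  q : Fin 3 → ℕ
  S : Finset ℕ
  cond : Cond

/-- The member of the `3 g` vertices of a hyperclique that a place stands for: with `i < g`, the
coordinate `d` has the `i`-th vertex of group `d` at the exponent `2 g - 1 - i` and the `i`-th vertex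
of group `d + 1` at the exponent `i`. -/
def label (g : ℕ) (r : Fin 3 × ℕ) : Fin 3 × ℕ :=
  if r.2 < g then (r.1 + 1, r.2) else (r.1, 2 * g - 1 - r.2)

/-- The places of both copies of a vertex agree. -/
def Cond.Respects (g : ℕ) : Cond → Prop
  | .edge r₁ r₂ r₃ => label g r₁ ≠ label g r₂ ∧ label g r₁ ≠ label g r₃ ∧ label g r₂ ≠ label g r₃
  | .eq r₁ r₂ => label g r₁ = label g r₂

/-- `mem_S` makes the chain offsets multiples of the side lengths in both chain coordinates, so that
the boxes of a chain do not overlap. `places` requires that the condition reads only digits that the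
boxes restrict and, in the chain coordinates, none that the chain varies: the whole chain is
forbidden or none of it is. `card_S` bounds the number of orthants of the shape. `count` bounds the
number of translations, the digits in `S` being enumerated by the chain and hence saved; its slack
of `4` pays for the exponents that have to be taken out of `S` and for rounding. -/
structure Family.Valid (g D : ℕ) (F : Family) : Prop where
  hab : F.a ≠ F.b
  hac : F.a ≠ F.c
  hbc : F.b ≠ F.c
  q_le : ∀ i, F.q i ≤ 2 * g
  mem_S : ∀ e ∈ F.S, F.q F.a ≤ e ∧ F.q F.b ≤ e ∧ e < 2 * g
  places : ∀ r ∈ F.cond.places, F.q r.1 ≤ r.2 ∧ r.2 < 2 * g ∧ (r.1 ≠ F.c → r.2 ∉ F.S)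
  respects : F.cond.Respects g
  card_S : F.S.card ≤ D
  count : (2 * g - F.q F.a) + (2 * g - F.q F.b) + (2 * g - F.q F.c) ≤
    F.S.card + (2 * g - D + 4)

/-! ### Choosing families that read every condition from few leading digits -/

section Design

variable {g D : ℕ}

theorem Family.Valid.cases {F : Family} (h : F.Valid g D) (i : Fin 3) :
    i = F.a ∨ i = F.b ∨ i = F.c := by
  have h1 := h.hab
  have h2 := h.hac
  have h3 := h.hbc
  omega

/-- The chain takes the top `D` exponents, apart from the few at which the condition reads a digit
of a chain coordinate. -/
theorem card_Ico_sdiff {hs : Finset ℕ} (n : ℕ) (hD : D ≤ 2 * g) (hn : hs.card ≤ n) :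
    D ≤ (Finset.Ico (2 * g - D) (2 * g) \ hs).card + n := by
  have := Finset.le_card_sdiff hs (Finset.Ico (2 * g - D) (2 * g))
  rw [Nat.card_Ico] at this
  omega

theorem card_Ico_sdiff_le (hs : Finset ℕ) (hD : D ≤ 2 * g) :
    (Finset.Ico (2 * g - D) (2 * g) \ hs).card ≤ D := by
  have := Finset.card_le_card (Finset.sdiff_subset (s := Finset.Ico (2 * g - D) (2 * g)) (t := hs))
  rw [Nat.card_Ico] at this
  omega

/-- The two copies of a vertex can be compared. -/
theorem exists_valid_eq (d : Fin 3) {i : ℕ} (hD : D ≤ i) (hi : i < g) :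
    ∃ F : Family, F.Valid g D ∧ F.cond = .eq (d, i) (d + 1, 2 * g - 1 - i) := by
  -- The two places cost `2 * g - i` and `i + 1` leading digits, and the third coordinate is
  -- unrestricted. By `D ≤ i` both places are below the top `D` exponents, so all of these can go
  -- into the chain.
  refine ⟨⟨d, d + 1, d + 2, fun j => if j = d then i else if j = d + 1 then 2 * g - 1 - i else 2 * g,
    Finset.Ico (2 * g - D) (2 * g), .eq (d, i) (d + 1, 2 * g - 1 - i)⟩, ?_, rfl⟩
  have h1 : d + 1 ≠ d := by omega
  have h2 : d + 2 ≠ d := by omega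
  have h3 : d + 2 ≠ d + 1 := by omega
  constructor
  · exact h1.symm
  · exact h2.symm
  · exact h3.symm
  · intro j
    simp only
    split_ifs <;> omega
  · intro e he
    simp only [Finset.mem_Ico] at he
    simp only [if_true, h1, if_false]
    omega
  · intro r hr
    simp only [Cond.places, List.mem_cons, List.not_mem_nil, or_false] at hr
    rcases hr with rfl | rfl
    · simp only [if_true, Finset.mem_Ico]
      omega
    · simp only [if_true, h1, if_false, Finset.mem_Ico]
      omega
  · simp only [Cond.Respects, label, hi, if_true]
    rw [if_neg (by omega), show 2 * g - 1 - (2 * g - 1 - i) = i by omega]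
  · rw [Nat.card_Ico]
    omega
  · simp only [if_true, h1, h2, h3, if_false, Nat.card_Ico]
    omega

/-- The condition `c` is about the vertices `x`, `y` and `z`, each in the first place that has it or
in a place that `exists_valid_eq` compares with the first. -/
def Cond.Covers (g D : ℕ) (c : Cond) (x y z : Fin 3 × ℕ) : Prop :=
  ∃ r₁ r₂ r₃, c = .edge r₁ r₂ r₃ ∧ (∀ r ∈ [r₁, r₂, r₃], r.2 < 2 * g ∧ (r.2 < g → D ≤ r.2)) ∧
    label g r₁ = x ∧ label g r₂ = y ∧ label g r₃ = z

/-- The first place of a vertex. -/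
def home (g : ℕ) (x : Fin 3 × ℕ) : Fin 3 × ℕ := (x.1, 2 * g - 1 - x.2)

theorem label_home {x : Fin 3 × ℕ} (hx : x.2 < g) : label g (home g x) = x := by
  unfold label home
  rw [if_neg (by simp only; omega)]
  ext
  · rfl
  · simp only
    omega

/-- Three vertices in two groups are covered. -/
theorem exists_valid_two_groups (hDg : D ≤ g) (d : Fin 3) {x y z : Fin 3 × ℕ} (hx : x.2 < g)
    (hy : y.2 < g) (hz : z.2 < g) (hxy : x ≠ y) (hxz : x ≠ z) (hyz : y ≠ z)
    (hxd : x.1 = d ∨ x.1 = d + 1) (hyd : y.1 = d ∨ y.1 = d + 1) (hzd : z.1 = d ∨ z.1 = d + 1) :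
    ∃ F : Family, F.Valid g D ∧ F.cond.Covers g D x y z := by
  -- The first places are in the upper halves of the coordinates `d` and `d + 1`, hence `2 * g`
  -- leading digits suffice; at most three exponents are lost for the chain.
  refine ⟨⟨d, d + 1, d + 2, fun j => if j = d then g else if j = d + 1 then g else 2 * g,
    Finset.Ico (2 * g - D) (2 * g) \ {2 * g - 1 - x.2, 2 * g - 1 - y.2, 2 * g - 1 - z.2},
    .edge (home g x) (home g y) (home g z)⟩, ?_, _, _, _, rfl, ?_,
    label_home hx, label_home hy, label_home hz⟩
  · have h1 : d + 1 ≠ d := by omega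
    have h2 : d + 2 ≠ d := by omega
    have h3 : d + 2 ≠ d + 1 := by omega
    constructor
    · exact h1.symm
    · exact h2.symm
    · exact h3.symm
    · intro j
      simp only
      split_ifs <;> omega
    · intro e he
      simp only [Finset.mem_sdiff, Finset.mem_Ico] at he
      simp only [if_true, h1, if_false]
      omega
    · intro r hr
      have key : ∀ v : Fin 3 × ℕ, v.2 < g → (v.1 = d ∨ v.1 = d + 1) →
          (if v.1 = d then g else if v.1 = d + 1 then g else 2 * g) ≤ 2 * g - 1 - v.2 ∧
            2 * g - 1 - v.2 < 2 * g := by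
        intro v hv hvd
        rw [← ite_or, if_pos hvd]
        omega
      simp only [Cond.places, List.mem_cons, List.not_mem_nil, or_false] at hr
      rcases hr with rfl | rfl | rfl
      · exact ⟨(key x hx hxd).1, (key x hx hxd).2, fun _ => by simp [home]⟩
      · exact ⟨(key y hy hyd).1, (key y hy hyd).2, fun _ => by simp [home]⟩
      · exact ⟨(key z hz hzd).1, (key z hz hzd).2, fun _ => by simp [home]⟩
    · simp only [Cond.Respects, label_home hx, label_home hy, label_home hz]
      exact ⟨hxy, hxz, hyz⟩
    · exact card_Ico_sdiff_le _ (by omega)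
    · have := card_Ico_sdiff (g := g) (D := D)
        (hs := {2 * g - 1 - x.2, 2 * g - 1 - y.2, 2 * g - 1 - z.2}) 3 (by omega)
        Finset.card_le_three
      simp only [if_true, h1, h2, h3, if_false]
      omega
  · intro r hr
    simp only [List.mem_cons, List.not_mem_nil, or_false] at hr
    rcases hr with rfl | rfl | rfl <;> simp only [home] <;> omega

/-- Three vertices in three groups, all early in their groups, are covered. -/
theorem exists_valid_early (hDg : D ≤ g) (hD : 3 * D ≤ 2 * g + 2) {p : Fin 3 → ℕ}
    (hp : ∀ i, p i < D) :
    ∃ F : Family, F.Valid g D ∧ F.cond.Covers g D (0, p 0) (1, p 1) (2, p 2) := by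
  have hp0 := hp 0
  have hp1 := hp 1
  have hp2 := hp 2
  have l0 : label g (home g (0, p 0)) = (0, p 0) := label_home (by simp only; omega)
  have l1 : label g (home g (1, p 1)) = (1, p 1) := label_home (by simp only; omega)
  have l2 : label g (home g (2, p 2)) = (2, p 2) := label_home (by simp only; omega)
  -- The top `D` digits of each coordinate contain the three first places, and `3 * D ≤ 2 * g + 2`.
  -- The place in coordinate `2`, which is outside the chain, costs no exponent, so at most two are
  -- lost.
  refine ⟨⟨0, 1, 2, fun _ => 2 * g - D,
    Finset.Ico (2 * g - D) (2 * g) \ {2 * g - 1 - p 0, 2 * g - 1 - p 1},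
    .edge (home g (0, p 0)) (home g (1, p 1)) (home g (2, p 2))⟩, ?_, _, _, _, rfl, ?_, l0, l1, l2⟩
  · constructor
    · show (0 : Fin 3) ≠ 1
      decide
    · show (0 : Fin 3) ≠ 2
      decide
    · show (1 : Fin 3) ≠ 2
      decide
    · intro j
      exact Nat.sub_le _ _
    · intro e he
      simp only [Finset.mem_sdiff, Finset.mem_Ico] at he
      simp only
      omega
    · intro r hr
      simp only [Cond.places, List.mem_cons, List.not_mem_nil, or_false] at hr
      rcases hr with rfl | rfl | rfl
      · refine ⟨?_, ?_, fun _ => by simp [home]⟩ <;> simp only [home] <;> omega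
      · refine ⟨?_, ?_, fun _ => by simp [home]⟩ <;> simp only [home] <;> omega
      · refine ⟨?_, ?_, fun h => (h rfl).elim⟩ <;> simp only [home] <;> omega
    · simp only [Cond.Respects, l0, l1, l2]
      simp
    · exact card_Ico_sdiff_le _ (by omega)
    · have := card_Ico_sdiff (g := g) (D := D)
        (hs := {2 * g - 1 - p 0, 2 * g - 1 - p 1}) 2 (by omega) Finset.card_le_two
      simp only
      omega
  · intro r hr
    simp only [List.mem_cons, List.not_mem_nil, or_false] at hr
    rcases hr with rfl | rfl | rfl <;> simp only [home] <;> omega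

/-- Three vertices in three groups, the latest in its group at least at position `D`, are covered. -/
theorem exists_valid_late (d : Fin 3) {i j l : ℕ} (hD : D ≤ j) (hi : i ≤ j)
    (hl : l ≤ j) (hj : j < g) :
    ∃ F : Family, F.Valid g D ∧ F.cond.Covers g D (d, i) (d + 1, j) (d + 2, l) := by
  have li : label g (home g (d, i)) = (d, i) := label_home (by simp only; omega)
  have lj : label g (d, j) = (d + 1, j) := by simp [label, hj]
  have ll : label g (home g (d + 2, l)) = (d + 2, l) := label_home (by simp only; omega)
  have h1 : d + 1 ≠ d := by omega
  have h2 : d + 2 ≠ d := by omega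
  have h3 : d + 2 ≠ d + 1 := by omega
  -- The latest vertex is read from its second copy, at the exponent `j` of coordinate `d`. That
  -- coordinate then shows `(d, i)` as well and costs `2 * g - j` digits; because of `l ≤ j`,
  -- coordinate `d + 2` costs only `j + 1`. Coordinate `d + 1` is unrestricted, and `D ≤ j` puts the
  -- top `D` exponents above both thresholds.
  refine ⟨⟨d, d + 2, d + 1, fun k => if k = d then j else if k = d + 2 then 2 * g - 1 - j else 2 * g,
    Finset.Ico (2 * g - D) (2 * g) \ {2 * g - 1 - i, 2 * g - 1 - l},
    .edge (home g (d, i)) (d, j) (home g (d + 2, l))⟩, ?_, _, _, _, rfl, ?_, li, lj, ll⟩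
  · constructor
    · exact h2.symm
    · exact h1.symm
    · exact h3
    · intro k
      simp only
      split_ifs <;> omega
    · intro e he
      simp only [Finset.mem_sdiff, Finset.mem_Ico] at he
      simp only [if_true, h2, if_false]
      omega
    · intro r hr
      simp only [Cond.places, List.mem_cons, List.not_mem_nil, or_false] at hr
      rcases hr with rfl | rfl | rfl
      · refine ⟨?_, ?_, fun _ => by simp [home]⟩ <;> simp only [home, if_true] <;> omega
      · refine ⟨?_, ?_, fun _ => ?_⟩ <;>
          simp only [if_true, Finset.mem_sdiff, Finset.mem_Ico] <;> omega
      · refine ⟨?_, ?_, fun _ => by simp [home]⟩ <;> simp only [home, h2, if_true, if_false] <;> omega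
    · simp only [Cond.Respects, li, lj, ll]
      simp [h1.symm, h2.symm, h3.symm]
    · exact card_Ico_sdiff_le _ (by omega)
    · have := card_Ico_sdiff (g := g) (D := D)
        (hs := {2 * g - 1 - i, 2 * g - 1 - l}) 2 (by omega) Finset.card_le_two
      simp only [if_true, h1, h2, h3.symm, if_false]
      omega
  · intro r hr
    simp only [List.mem_cons, List.not_mem_nil, or_false] at hr
    rcases hr with rfl | rfl | rfl <;> simp only [home] <;> omega

/-- If the three groups are distinct, the largest position decides between the early and the late
case. Two groups are always cyclically consecutive, so that the remaining triples fall under the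
case of two groups. -/
theorem exists_valid_covers (hDg : D ≤ g) (hD : 3 * D ≤ 2 * g + 2) {x y z : Fin 3 × ℕ}
    (hx : x.2 < g) (hy : y.2 < g) (hz : z.2 < g) (hxy : x ≠ y) (hxz : x ≠ z) (hyz : y ≠ z) :
    ∃ F : Family, F.Valid g D ∧ ∃ x' y' z', ({x', y', z'} : Set (Fin 3 × ℕ)) = {x, y, z} ∧
      F.cond.Covers g D x' y' z' := by
  have hdec : ∀ i j l : Fin 3, (i ≠ j ∧ i ≠ l ∧ j ≠ l) ∨
      ∃ d : Fin 3, (i = d ∨ i = d + 1) ∧ (j = d ∨ j = d + 1) ∧ (l = d ∨ l = d + 1) := by decide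
  rcases hdec x.1 y.1 z.1 with ⟨h1, h2, h3⟩ | ⟨d, h1, h2, h3⟩
  · obtain ⟨p, hpx, hpy, hpz⟩ : ∃ p : Fin 3 → ℕ, p x.1 = x.2 ∧ p y.1 = y.2 ∧ p z.1 = z.2 :=
      ⟨fun i => if i = x.1 then x.2 else if i = y.1 then y.2 else z.2,
        by simp, by simp [h1.symm], by simp [h2.symm, h3.symm]⟩
    have hall : ∀ i, i = x.1 ∨ i = y.1 ∨ i = z.1 := fun i => by omega
    have hset : ∀ i j l : Fin 3, i ≠ j → i ≠ l → j ≠ l →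
        ({(i, p i), (j, p j), (l, p l)} : Set (Fin 3 × ℕ)) = {x, y, z} := by
      intro i j l hij hil hjl
      have hx' : x = (x.1, p x.1) := by rw [hpx]
      have hy' : y = (y.1, p y.1) := by rw [hpy]
      have hz' : z = (z.1, p z.1) := by rw [hpz]
      have h4 : ∀ v : Fin 3 × ℕ, v ∈ ({(i, p i), (j, p j), (l, p l)} : Set (Fin 3 × ℕ)) ↔
          v.2 = p v.1 := by
        rintro ⟨v, n⟩
        simp only [Set.mem_insert_iff, Set.mem_singleton_iff, Prod.mk.injEq]
        constructor
        · rintro (⟨rfl, rfl⟩ | ⟨rfl, rfl⟩ | ⟨rfl, rfl⟩) <;> rfl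
        · rintro rfl
          obtain rfl | rfl | rfl : v = i ∨ v = j ∨ v = l := by omega
          · simp
          · simp
          · simp
      ext v
      rw [h4]
      simp only [Set.mem_insert_iff, Set.mem_singleton_iff]
      constructor
      · intro hv
        have hv' : v = (v.1, p v.1) := by rw [← hv]
        rcases hall v.1 with h | h | h
        · left
          rw [hv', h, ← hx']
        · right; left
          rw [hv', h, ← hy']
        · right; right
          rw [hv', h, ← hz']
      · rintro (rfl | rfl | rfl)
        exacts [hpx.symm, hpy.symm, hpz.symm]
    have hpg : ∀ i, p i < g := by
      intro i
      rcases hall i with rfl | rfl | rfl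
      · rwa [hpx]
      · rwa [hpy]
      · rwa [hpz]
    obtain ⟨d', hd'⟩ := Finite.exists_max p
    -- The second copy of group `d + 1` is in coordinate `d`.
    obtain ⟨d, rfl⟩ : ∃ d : Fin 3, d' = d + 1 := ⟨d' - 1, by omega⟩
    rcases lt_or_ge (p (d + 1)) D with h | h
    · obtain ⟨F, hF, hc⟩ := exists_valid_early hDg hD fun i => (hd' i).trans_lt h
      exact ⟨F, hF, _, _, _, hset 0 1 2 (by decide) (by decide) (by decide), hc⟩
    · obtain ⟨F, hF, hc⟩ := exists_valid_late d h (hd' d) (hd' (d + 2)) (hpg _)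
      exact ⟨F, hF, _, _, _, hset d (d + 1) (d + 2) (by omega) (by omega) (by omega), hc⟩
  · obtain ⟨F, hF, hc⟩ := exists_valid_two_groups hDg d hx hy hz hxy hxz hyz h1 h2 h3
    exact ⟨F, hF, x, y, z, rfl, hc⟩

/-- Finitely many families whose conditions say that the decoded vertices form a hyperclique. -/
structure IsDesign (g D : ℕ) (Fs : List Family) : Prop where
  valid : ∀ F ∈ Fs, F.Valid g D
  eq : ∀ d i, D ≤ i → i < g → ∃ F ∈ Fs, F.cond = .eq (d, i) (d + 1, 2 * g - 1 - i)
  edge : ∀ x y z : Fin 3 × ℕ, x.2 < g → y.2 < g → z.2 < g → x ≠ y → x ≠ z → y ≠ z →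
    ∃ F ∈ Fs, ∃ x' y' z', ({x', y', z'} : Set (Fin 3 × ℕ)) = {x, y, z} ∧
      F.cond.Covers g D x' y' z'

/-- There are finitely many triples and pairs of copies. Their number depends on `g` and `D` only,
so the list is a constant for the program. -/
theorem exists_design (hDg : D ≤ g) (hD : 3 * D ≤ 2 * g + 2) : ∃ Fs, IsDesign g D Fs := by
  classical
  have fin_list : ∀ {ι : Type} [Fintype ι] {P : ι → Family → Prop},
      (∀ i, ∃ F : Family, F.Valid g D ∧ P i F) →
      ∃ Fs : List Family, (∀ F ∈ Fs, F.Valid g D) ∧ ∀ i, ∃ F ∈ Fs, P i F := by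
    intro ι _ P h
    choose f hf using h
    refine ⟨Finset.univ.toList.map f, ?_, fun i => ⟨f i, by simp, (hf i).2⟩⟩
    intro F hF
    obtain ⟨i, _, rfl⟩ := List.mem_map.1 hF
    exact (hf i).1
  obtain ⟨Fs, hv, hF⟩ := fin_list (ι := Fin 3 × {i : Fin g // D ≤ i.1})
    (P := fun p F => F.cond = .eq (p.1, p.2.1.1) (p.1 + 1, 2 * g - 1 - p.2.1.1))
    fun p => exists_valid_eq p.1 p.2.2 p.2.1.2
  obtain ⟨Fs', hv', hF'⟩ := fin_list
    (ι := {t : (Fin 3 × Fin g) × (Fin 3 × Fin g) × (Fin 3 × Fin g) //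
      t.1 ≠ t.2.1 ∧ t.1 ≠ t.2.2 ∧ t.2.1 ≠ t.2.2})
    (P := fun t F => ∃ x' y' z', ({x', y', z'} : Set (Fin 3 × ℕ)) =
      {(t.1.1.1, t.1.1.2.1), (t.1.2.1.1, t.1.2.1.2.1), (t.1.2.2.1, t.1.2.2.2.1)} ∧
      F.cond.Covers g D x' y' z') (by
    rintro ⟨⟨x, y, z⟩, h1, h2, h3⟩
    have hne : ∀ x y : Fin 3 × Fin g, x ≠ y → ((x.1, x.2.1) : Fin 3 × ℕ) ≠ (y.1, y.2.1) := by
      intro x y h h'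
      rw [Prod.mk.injEq] at h'
      exact h (Prod.ext h'.1 (Fin.ext h'.2))
    exact exists_valid_covers hDg hD x.2.2 y.2.2 z.2.2 (hne _ _ h1) (hne _ _ h2) (hne _ _ h3))
  refine ⟨Fs ++ Fs', fun F h => ?_, fun d i hDi hi => ?_, fun x y z hx hy hz hxy hxz hyz => ?_⟩
  · rcases List.mem_append.1 h with h | h
    exacts [hv F h, hv' F h]
  · obtain ⟨F, h, h'⟩ := hF (d, ⟨⟨i, hi⟩, hDi⟩)
    exact ⟨F, List.mem_append_left _ h, h'⟩
  · have hne : ∀ {x y : Fin 3 × ℕ} (hx : x.2 < g) (hy : y.2 < g), x ≠ y →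
        ((x.1, ⟨x.2, hx⟩) : Fin 3 × Fin g) ≠ (y.1, ⟨y.2, hy⟩) := by
      intro x y hx hy h h'
      exact h (Prod.ext (congrArg Prod.fst h' :) (congrArg (fun t => (t.2 : ℕ)) h' :))
    obtain ⟨F, h, h'⟩ := hF' ⟨((x.1, ⟨x.2, hx⟩), (y.1, ⟨y.2, hy⟩), (z.1, ⟨z.2, hz⟩)),
      hne hx hy hxy, hne hx hz hxz, hne hy hz hyz⟩
    exact ⟨F, List.mem_append_right _ h, h'⟩

/-! ### Conditions of a design and hypercliques -/

variable {N : ℕ} {H : Hypergraph (Fin N)} {bit : ℕ → ℕ}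

/-- If the conditions of a design hold for the vertices `u`, then there is a hyperclique. -/
theorem IsDesign.hasHyperclique {Fs : List Family} (hFs : IsDesign g D Fs)
    (hH : H.vertexSet = Set.univ) (h3 : IsThreeUniform H)
    (hbit : ∀ a b c : Fin N, bit (((a : ℕ) * N + b) * N + c) ≠ 0 ↔ {a, b, c} ∈ H.edgeSet)
    {u : Fin 3 × ℕ → ℕ} (hu : ∀ r, u r < N) (h : ∀ F ∈ Fs, F.cond.Holds N bit u) :
    HasHyperclique H (3 * g) := by
  classical
  -- Every place that a covering condition uses shows the same vertex as the first place of its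
  -- label: it is that place, or an equality condition compares the two.
  have hlab : ∀ r, r.2 < 2 * g ∧ (r.2 < g → D ≤ r.2) → u r = u (home g (label g r)) := by
    rintro ⟨d, i⟩ ⟨h1, h2⟩
    simp only at h1 h2
    by_cases hi : i < g
    · obtain ⟨F, hF, hc⟩ := hFs.eq d i (h2 hi) hi
      have := h F hF
      rw [hc] at this
      simpa [Cond.Holds, label, home, hi] using this
    · simp only [label, home, hi, if_false]
      rw [show 2 * g - 1 - (2 * g - 1 - i) = i by omega]
  let v : Fin 3 × ℕ → Fin N := fun x => ⟨u (home g x), hu _⟩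
  have hedge : ∀ x y z : Fin 3 × ℕ, x.2 < g → y.2 < g → z.2 < g → x ≠ y → x ≠ z → y ≠ z →
      ({v x, v y, v z} : Set (Fin N)) ∈ H.edgeSet := by
    intro x y z hx hy hz hxy hxz hyz
    obtain ⟨F, hF, x', y', z', hset, r₁, r₂, r₃, hc, hr, rfl, rfl, rfl⟩ :=
      hFs.edge x y z hx hy hz hxy hxz hyz
    have hh := h F hF
    rw [hc] at hh
    simp only [Cond.Holds] at hh
    rw [hlab r₁ (hr r₁ (by simp)), hlab r₂ (hr r₂ (by simp)), hlab r₃ (hr r₃ (by simp))] at hh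
    have hE := (hbit (v (label g r₁)) (v (label g r₂)) (v (label g r₃))).1 hh
    have := congrArg (fun s => v '' s) hset
    simp only [Set.image_insert_eq, Set.image_singleton] at this
    rwa [this] at hE
  let f : Fin 3 × Fin g → Fin N := fun x => v (x.1, x.2.1)
  have hne : ∀ x y : Fin 3 × Fin g, x ≠ y → ((x.1, x.2.1) : Fin 3 × ℕ) ≠ (y.1, y.2.1) := by
    intro x y h h'
    rw [Prod.mk.injEq] at h'
    exact h (Prod.ext h'.1 (Fin.ext h'.2))
  have hf : ∀ x y z, x ≠ y → x ≠ z → y ≠ z → ({f x, f y, f z} : Set (Fin N)) ∈ H.edgeSet :=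
    fun x y z hxy hxz hyz => hedge _ _ _ x.2.2 y.2.2 z.2.2 (hne _ _ hxy) (hne _ _ hxz) (hne _ _ hyz)
  -- Two equal vertices together with a third index would give a hyperedge with at most two
  -- elements. A third index exists because `g > 0` as soon as there is an index.
  have hinj : Function.Injective f := by
    intro x y hxy
    by_contra hne
    obtain ⟨z, hz⟩ : ∃ z, z ∉ ({x, y} : Finset (Fin 3 × Fin g)) := by
      by_contra hall
      push Not at hall
      have h1 : Fintype.card (Fin 3 × Fin g) ≤ 2 := by
        rw [← Finset.card_univ]
        exact (Finset.card_le_card fun z _ => hall z).trans Finset.card_le_two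
      have := x.2.2
      simp at h1
      omega
    simp only [Finset.mem_insert, Finset.mem_singleton, not_or] at hz
    have h4 := h3 _ (hf x y z hne (Ne.symm hz.1) (Ne.symm hz.2))
    rw [hxy, Set.insert_eq_of_mem (by simp)] at h4
    have := Set.ncard_insert_le (f y) {f z}
    rw [Set.ncard_singleton] at this
    omega
  refine ⟨Set.range f, by simp [hH], Set.finite_range f, ?_, ?_⟩
  · rw [Set.ncard_range_of_injective hinj]
    simp
  · intro e he hcard
    obtain ⟨a, b, c, hab, hac, hbc, rfl⟩ := Set.ncard_eq_three.1 hcard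
    obtain ⟨x, rfl⟩ := he (show a ∈ ({a, b, c} : Set _) by simp)
    obtain ⟨y, rfl⟩ := he (show b ∈ ({f x, b, c} : Set _) by simp)
    obtain ⟨z, rfl⟩ := he (show c ∈ ({f x, f y, c} : Set _) by simp)
    exact hf x y z (fun h => hab (by rw [h])) (fun h => hac (by rw [h])) (fun h => hbc (by rw [h]))

/-- A hyperclique gives vertices for which all conditions that respect the labels hold. -/
theorem HasHyperclique.exists_holds (h : HasHyperclique H (3 * g))
    (hbit : ∀ a b c : Fin N, bit (((a : ℕ) * N + b) * N + c) ≠ 0 ↔ {a, b, c} ∈ H.edgeSet)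
    (hN : 0 < N) :
    ∃ u : Fin 3 × ℕ → ℕ, (∀ r, u r < N) ∧ ∀ F : Family, F.Valid g D → F.cond.Holds N bit u := by
  classical
  obtain ⟨C, -, hfin, hcard, hC⟩ := h
  have hc : Fintype.card (Fin 3 × Fin g) = Fintype.card hfin.toFinset := by
    rw [Fintype.card_coe, ← Set.ncard_eq_toFinset_card C hfin, hcard]
    simp
  let φ := Fintype.equivOfCardEq hc
  -- The vertex `0` is a default outside the `3 * g` labels, which no place of a valid family needs.
  let v : Fin 3 × ℕ → Fin N := fun x => if hx : x.2 < g then φ (x.1, ⟨x.2, hx⟩) else ⟨0, hN⟩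
  have hv : ∀ x : Fin 3 × ℕ, x.2 < g → v x ∈ C := by
    intro x hx
    have := (φ (x.1, ⟨x.2, hx⟩)).2
    rw [Set.Finite.mem_toFinset] at this
    simpa [v, hx] using this
  have hinj : ∀ x y : Fin 3 × ℕ, x.2 < g → y.2 < g → x ≠ y → v x ≠ v y := by
    intro x y hx hy hne h
    simp only [v, hx, hy, dif_pos] at h
    have := φ.injective (Subtype.ext h)
    exact hne (Prod.ext (congrArg Prod.fst this :) (congrArg (fun t => (t.2 : ℕ)) this :))
  have hlab : ∀ r : Fin 3 × ℕ, r.2 < 2 * g → (label g r).2 < g := by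
    intro r hr
    unfold label
    split_ifs <;> simp only <;> omega
  refine ⟨fun r => v (label g r), fun r => (v _).2, fun F hF => ?_⟩
  have hpl := fun r hr => hlab r (hF.places r hr).2.1
  have hresp := hF.respects
  cases hcond : F.cond with
  | eq r₁ r₂ =>
    rw [hcond] at hresp
    exact congrArg (fun x => ((v x : Fin N) : ℕ)) hresp
  | edge r₁ r₂ r₃ =>
    rw [hcond] at hresp hpl
    have h1 := hpl r₁ (by simp [Cond.places])
    have h2 := hpl r₂ (by simp [Cond.places])
    have h3 := hpl r₃ (by simp [Cond.places])
    refine (hbit _ _ _).2 (hC _ ?_ ?_)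
    · rintro _ (rfl | rfl | rfl)
      exacts [hv _ h1, hv _ h2, hv _ h3]
    · exact Set.ncard_eq_three.2 ⟨_, _, _, hinj _ _ h1 h2 hresp.1, hinj _ _ h1 h3 hresp.2.1,
        hinj _ _ h2 h3 hresp.2.2, rfl⟩

end Design

/-! ### From lists with integer coordinates to instances -/

open RealRAM in
/-- The output for lists of shapes and objects with integer coordinates. -/
noncomputable def tokens (Zs : List (List ((Fin 3 → Bool) × (Fin 3 → ℤ))))
    (os : List (ℕ × (Fin 3 → ℤ))) : List Token :=
  Zs.flatMap (fun Z => encodeShape (Z.map fun Q => intOrthant Q.1 Q.2)) ++ [Sum.inl 0] ++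
    os.flatMap (fun o => encodeObject o.1 fun i => (o.2 i : ℝ)) ++ [Sum.inl 0]

/-- The integer points of a shape. -/
def InShape (Z : List ((Fin 3 → Bool) × (Fin 3 → ℤ))) (x : Fin 3 → ℤ) : Prop :=
  ∃ Q ∈ Z, InOrthant Q.1 Q.2 x

theorem mem_shapeSet_toFinset {d : ℕ} [DecidableEq (Orthant d)] (Z : List (Orthant d))
    (x : Fin d → ℝ) : x ∈ shapeSet Z.toFinset ↔ ∃ Q ∈ Z, x ∈ Q.toSet := by
  simp [shapeSet]

open RealRAM in
-- The hypotheses exclude that two list entries become the same orthant, shape or object, so lengths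
-- of lists are cardinalities. Rounding down replaces real points by integer ones, all corners and
-- translations being integers.
theorem exists_instance {Zs : List (List ((Fin 3 → Bool) × (Fin 3 → ℤ)))}
    {os : List (ℕ × (Fin 3 → ℤ))} (hZ : ∀ Z ∈ Zs, Z.Nodup)
    (hZs : Zs.Pairwise fun Z Z' => ¬ ∀ Q, Q ∈ Z ↔ Q ∈ Z') (hos : os.Nodup)
    (hidx : ∀ o ∈ os, o.1 < Zs.length) :
    ∃ I : TOInstance 3, Describes (tokens Zs os) I ∧ I.numTranslates = os.length ∧
      I.numOrthants = (Zs.map List.length).sum ∧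
      (I.IsYes ↔ ∃ x : Fin 3 → ℤ, ∀ o ∈ os, ∀ Z, Zs[o.1]? = some Z → InShape Z (x - o.2)) := by
  classical
  let emb : (Fin 3 → Bool) × (Fin 3 → ℤ) → Orthant 3 := fun Q => intOrthant Q.1 Q.2
  have hemb : Function.Injective emb := by
    intro Q Q' h
    obtain ⟨h1, h2⟩ := intOrthant_inj.1 h
    exact Prod.ext h1 h2
  let Zs' := Zs.map fun Z => Z.map emb
  have hlen : Zs'.length = Zs.length := List.length_map _
  have hsets : (Zs'.map List.toFinset).Nodup := by
    rw [List.Nodup, List.pairwise_map, List.pairwise_map]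
    refine hZs.imp fun {Z Z'} h heq => h fun Q => ?_
    have := congrArg (fun s => emb Q ∈ s) heq
    simpa [hemb.eq_iff] using this
  have hnodup : ∀ Z ∈ Zs', Z.Nodup := by
    intro Z hZmem
    obtain ⟨Z₀, h0, rfl⟩ := List.mem_map.1 hZmem
    exact (hZ Z₀ h0).map hemb
  obtain ⟨os', hos'⟩ : ∃ os' : List (Fin Zs'.length × (Fin 3 → ℝ)),
      os'.map (fun o => ((o.1 : ℕ), o.2)) = os.map fun o => (o.1, fun i => (o.2 i : ℝ)) := by
    refine ⟨os.pmap (fun o h => (⟨o.1, h⟩, fun i => (o.2 i : ℝ)))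
      (fun o ho => (hidx o ho).trans_eq hlen.symm), ?_⟩
    rw [List.map_pmap]
    exact List.pmap_eq_map (f := fun o : ℕ × (Fin 3 → ℤ) => (o.1, fun i => (o.2 i : ℝ))) _
  have hmapnodup : (os.map fun o => (o.1, fun i => (o.2 i : ℝ))).Nodup := by
    refine hos.map fun o o' h => ?_
    rw [Prod.mk.injEq] at h
    refine Prod.ext h.1 (funext fun i => ?_)
    exact Int.cast_injective (congrFun h.2 i)
  have hosn : os'.Nodup := List.Nodup.of_map _ (hos' ▸ hmapnodup)
  have hobj : (os'.map fun o => (o.2, (Zs'.get o.1).toFinset)).Nodup := by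
    refine hosn.map_on fun o _ o' _ h => ?_
    rw [Prod.mk.injEq] at h
    refine Prod.ext ?_ h.1
    have h2 := h.2
    have h3 : (Zs'.map List.toFinset)[(o.1 : ℕ)]'(by simp) =
        (Zs'.map List.toFinset)[(o'.1 : ℕ)]'(by simp) := by
      simpa using h2
    -- Different indices give different shapes as finite sets, so an object determines its index.
    exact Fin.ext ((hsets.getElem_inj_iff).1 h3)
  refine ⟨⟨(Zs'.map List.toFinset).toFinset,
    (os'.map fun o => (o.2, (Zs'.get o.1).toFinset)).toFinset, ?_⟩, ?_, ?_, ?_, ?_⟩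
  · intro o ho
    obtain ⟨o', -, rfl⟩ := List.mem_map.1 (List.mem_toFinset.1 ho)
    exact List.mem_toFinset.2 (List.mem_map.2 ⟨_, List.get_mem _ _, rfl⟩)
  · refine ⟨Zs', os', ?_, hnodup, hsets, hosn, ?_, ?_⟩
    · have h1 : os'.flatMap (fun o => encodeObject (o.1 : ℕ) o.2) =
          os.flatMap (fun o => encodeObject o.1 fun i => (o.2 i : ℝ)) := by
        have := congrArg (List.flatMap fun p : ℕ × (Fin 3 → ℝ) => encodeObject p.1 p.2) hos'
        rwa [List.flatMap_map, List.flatMap_map] at this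
      rw [h1, tokens]
      simp only [Zs', List.flatMap_map]
      rfl
    · congr!
    · congr!
  · rw [TOInstance.numTranslates, List.toFinset_card_of_nodup hobj, List.length_map]
    have := congrArg List.length hos'
    simpa using this
  · rw [TOInstance.numOrthants, List.sum_toFinset _ hsets, List.map_map]
    congr 1
    rw [List.map_map]
    refine List.map_congr_left fun Z hZmem => ?_
    simp only [Function.comp]
    rw [List.toFinset_card_of_nodup ((hZ Z hZmem).map hemb), List.length_map]
  · have h1 : ∀ x : Fin 3 → ℝ, (∀ o ∈ os, ∀ Z, Zs[o.1]? = some Z →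
        ∃ Q ∈ Z, (x - fun i => (o.2 i : ℝ)) ∈ (emb Q).toSet) ↔
        x ∈ ⋂ o ∈ (os'.map fun o => (o.2, (Zs'.get o.1).toFinset)).toFinset,
          (fun x => x + o.1) '' shapeSet o.2 := by
      intro x
      simp only [Set.mem_iInter, List.mem_toFinset, List.forall_mem_map, Set.image_add_right,
        Set.mem_preimage, mem_shapeSet_toFinset, ← sub_eq_add_neg]
      have h2 : (∀ p ∈ os'.map (fun o => ((o.1 : ℕ), o.2)), ∀ Z, Zs[p.1]? = some Z →
          ∃ Q ∈ Z, (x - p.2) ∈ (emb Q).toSet) ↔ (∀ o ∈ os, ∀ Z, Zs[o.1]? = some Z →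
          ∃ Q ∈ Z, (x - fun i => (o.2 i : ℝ)) ∈ (emb Q).toSet) := by
        rw [hos', List.forall_mem_map]
      rw [← h2, List.forall_mem_map]
      refine forall_congr' fun o => forall_congr' fun _ => ?_
      have h3 : (o.1 : ℕ) < Zs.length := o.1.2.trans_eq hlen
      simp only [Zs', List.get_eq_getElem, List.getElem_map, List.mem_map,
        List.getElem?_eq_getElem h3, Option.some.injEq, forall_eq', exists_exists_and_eq_and]
    constructor
    · rintro ⟨x, hx⟩
      refine ⟨fun i => ⌊x i⌋, fun o ho Z hZo => ?_⟩
      obtain ⟨Q, hQ, h⟩ := (h1 x).2 hx o ho Z hZo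
      exact ⟨Q, hQ, InOrthant.floor h⟩
    · rintro ⟨x, hx⟩
      refine ⟨fun i => (x i : ℝ), (h1 _).1 fun o ho Z hZo => ?_⟩
      obtain ⟨Q, hQ, h⟩ := hx o ho Z hZo
      exact ⟨Q, hQ, mem_intOrthant_cast.2 h⟩

/-! ### The instance of a design -/

/-- The value `x` in the coordinate `a`, `y` in the coordinate `b` and `z` in the remaining one. -/
def tri {α : Type*} (a b : Fin 3) (x y z : α) : Fin 3 → α :=
  fun i => if i = a then x else if i = b then y else z

namespace Family

variable (N g : ℕ) (F : Family)

/-- The number of boxes in a chain. -/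
def chainLen : ℕ := (3 * N) ^ F.S.card

/-- A number that exceeds every coordinate difference that occurs. -/
def far : ℤ := ((3 * N) ^ (2 * g + 2) : ℕ)

/-- The position of a box in the chain, counted so that the first one is box `1`. -/
def pos (i : ℕ) : ℤ :=
  -- The boxes `1` to `chainLen` have the spread numbers `0` to `chainLen - 1` as offsets. Box `0`,
  -- shifted by `-far`, and box `chainLen + 1`, at `far`, are sentinels out of reach.
  (spread (3 * N) (2 * g + 2) (exps F.S) (F.chainLen N + i - 1) : ℕ) - far N g

/-- The side lengths of the boxes. -/
def side (i : Fin 3) : ℤ := ((3 * N) ^ F.q i : ℕ)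

/-- The shape of a family: the complement of a chain of boxes, within bounds. -/
def shape (tag : ℕ) : List ((Fin 3 → Bool) × (Fin 3 → ℤ)) :=
  -- The tag moves a face that is out of reach anyway; its purpose is to make the shapes of
  -- different families distinct.
  (tri F.a F.b true false false, tri F.a F.b (-far N g - tag) (far N g) (-1)) ::
  (tri F.a F.b true false true, tri F.a F.b (-far N g) (far N g) (F.side N F.c)) ::
  (List.range (F.chainLen N + 1)).flatMap fun i =>
    [(fun _ => false, tri F.a F.b (F.pos N g (i + 1) - 1) (-F.pos N g i - 1) (far N g)),
     (fun _ => true, tri F.a F.b (F.pos N g i + F.side N F.a)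
        (-F.pos N g (i + 1) + F.side N F.b) (-far N g))]

/-- The exponents of the digits of the coordinate `a` that the translation determines. -/
def coS : Finset ℕ := Finset.Ico (F.q F.a) (2 * g) \ F.S

/-- The number of a translation is read in mixed radix. The first component lists the digits of
coordinate `a` outside `S`, the others list cells in coordinates `b` and `c`. The factor `2` in
`radixB` is needed because coordinate `b` is enumerated after the chain offset has been added to it,
which may double its range. -/
def radixA : ℕ := (3 * N) ^ (F.coS g).card
def radixB : ℕ := 2 * (3 * N) ^ (2 * g - F.q F.b)
def radixC : ℕ := (3 * N) ^ (2 * g - F.q F.c)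

/-- The `n`-th translation of a family. -/
def trans (n : ℕ) : Fin 3 → ℕ :=
  tri F.a F.b (spread (3 * N) (2 * g) (exps (F.coS g)) (n % F.radixA N g))
    (n / F.radixA N g % F.radixB N g * (3 * N) ^ F.q F.b)
    (n / F.radixA N g / F.radixB N g * (3 * N) ^ F.q F.c)

def numTrans : ℕ := F.radixA N g * (F.radixB N g * F.radixC N g)

/-- The point `x` is in the `m`-th box of the chain of the `n`-th translate. -/
def Hit (x : Fin 3 → ℕ) (n m : ℕ) : Prop :=
  let X := spread (3 * N) (2 * g + 2) (exps F.S) m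
  let τ := F.trans N g n
  (τ F.a + X ≤ x F.a ∧ x F.a < τ F.a + X + (3 * N) ^ F.q F.a) ∧
  (τ F.b ≤ x F.b + X ∧ x F.b + X < τ F.b + (3 * N) ^ F.q F.b) ∧
  (τ F.c ≤ x F.c ∧ x F.c < τ F.c + (3 * N) ^ F.q F.c)

end Family

section

variable {N g D : ℕ} {F : Family}

namespace Family.Valid

theorem ba (h : F.Valid g D) : F.b ≠ F.a := h.hab.symm
theorem ca (h : F.Valid g D) : F.c ≠ F.a := h.hac.symm
theorem cb (h : F.Valid g D) : F.c ≠ F.b := h.hbc.symm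

theorem tri_a {α : Type*} {a b : Fin 3} (x y z : α) : tri a b x y z a = x := by simp [tri]
theorem tri_b {α : Type*} (h : F.Valid g D) (x y z : α) : tri F.a F.b x y z F.b = y := by
  simp [tri, h.ba]
theorem tri_c {α : Type*} (h : F.Valid g D) (x y z : α) : tri F.a F.b x y z F.c = z := by
  simp [tri, h.ca, h.cb]

theorem forall_iff (h : F.Valid g D) {p : Fin 3 → Prop} : (∀ i, p i) ↔ p F.a ∧ p F.b ∧ p F.c := by
  constructor
  · exact fun hp => ⟨hp _, hp _, hp _⟩
  · rintro ⟨h1, h2, h3⟩ i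
    rcases h.cases i with rfl | rfl | rfl <;> assumption

theorem inOrthant_tri (h : F.Valid g D) {x y z : Bool} {x' y' z' : ℤ} {v : Fin 3 → ℤ} :
    InOrthant (tri F.a F.b x y z) (tri F.a F.b x' y' z') v ↔
      (if x then x' ≤ v F.a else v F.a ≤ x') ∧ (if y then y' ≤ v F.b else v F.b ≤ y') ∧
        (if z then z' ≤ v F.c else v F.c ≤ z') := by
  unfold InOrthant
  rw [h.forall_iff]
  simp only [tri_a, h.tri_b, h.tri_c]

theorem tri_const {α : Type*} (a b : Fin 3) (x : α) : (fun _ => x) = tri a b x x x := by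
  funext i
  simp [tri]

theorem trans_lt (h : F.Valid g D) (hN : 0 < N) {n : ℕ} (hn : n < F.numTrans N g) (i : Fin 3) :
    F.trans N g n i < 2 * (3 * N) ^ (2 * g) := by
  have hB : 0 < 3 * N := by omega
  have hA : 0 < F.radixA N g := pow_pos hB _
  have hBb : 0 < F.radixB N g := Nat.mul_pos two_pos (pow_pos hB _)
  have h1 : F.trans N g n F.a < (3 * N) ^ (2 * g) := by
    rw [trans, tri_a]
    refine spread_exps_lt hB (fun e he => ?_) (Nat.mod_lt _ hA)
    simp only [coS, Finset.mem_sdiff, Finset.mem_Ico] at he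
    exact he.1.2
  have h2 : F.trans N g n F.b < 2 * (3 * N) ^ (2 * g) := by
    rw [trans, h.tri_b]
    calc _ < F.radixB N g * (3 * N) ^ F.q F.b :=
          Nat.mul_lt_mul_of_pos_right (Nat.mod_lt _ hBb) (pow_pos hB _)
      _ = 2 * (3 * N) ^ (2 * g) := by
          rw [radixB, mul_assoc, ← pow_add, Nat.sub_add_cancel (h.q_le _)]
  have h3 : F.trans N g n F.c < (3 * N) ^ (2 * g) := by
    rw [trans, h.tri_c]
    calc _ < F.radixC N g * (3 * N) ^ F.q F.c := by
          refine Nat.mul_lt_mul_of_pos_right ?_ (pow_pos hB _)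
          rw [Nat.div_div_eq_div_mul]
          refine Nat.div_lt_of_lt_mul ?_
          rwa [mul_assoc]
      _ = (3 * N) ^ (2 * g) := by
          rw [radixC, ← pow_add, Nat.sub_add_cancel (h.q_le _)]
  rcases h.cases i with rfl | rfl | rfl <;> omega

/-- All exponents in `S` are at least `q`, so different offsets are at least `(3 * N) ^ q` apart.
With `q` the threshold of coordinate `a` or `b`, this is the separation that `exists_quadrant_iff`
asks for. -/
theorem pos_gap (h : F.Valid g D) (hN : 0 < N) {q : ℕ} (hq : ∀ e ∈ F.S, q ≤ e) (hq' : q ≤ 2 * g)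
    {i j : ℕ} (hij : i < j) :
    F.pos N g i + ((3 * N) ^ q : ℕ) ≤ F.pos N g j := by
  have hB : 0 < 3 * N := by omega
  have hl : 0 < F.chainLen N := pow_pos hB _
  have := spread_gap (E := 2 * g + 2) (e₀ := q) hB (exps_pairwise F.S) (fun e he => by
    rw [Finset.mem_sort] at he
    have := h.mem_S e he
    exact ⟨hq e he, by omega⟩) (by omega)
    (show F.chainLen N + i - 1 < F.chainLen N + j - 1 by omega)
  unfold pos
  zify at this
  push_cast
  linarith

theorem spread_S_lt (h : F.Valid g D) (hN : 0 < N) {m : ℕ} (hm : m < F.chainLen N) :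
    spread (3 * N) (2 * g + 2) (exps F.S) m < (3 * N) ^ (2 * g) :=
  spread_exps_lt (by omega) (fun e he => (h.mem_S e he).2.2) hm

theorem pos_succ (_h : F.Valid g D) (hN : 0 < N) (m : ℕ) :
    F.pos N g (m + 1) = spread (3 * N) (2 * g + 2) (exps F.S) m := by
  have hB : 0 < 3 * N := by omega
  have := spread_add (E := 2 * g + 2) hB (exps F.S) m 1
  rw [Finset.length_sort, mul_one] at this
  rw [pos, chainLen, far, show (3 * N) ^ F.S.card + (m + 1) - 1 = m + (3 * N) ^ F.S.card by omega,
    this]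
  push_cast
  ring

/-- A point is in the translated shape if it is in no box of the translated chain. -/
theorem inShape_iff (h : F.Valid g D) (hN : 0 < N) (tag : ℕ) {x : Fin 3 → ℕ}
    (hx : ∀ i, x i < (3 * N) ^ (2 * g)) {n : ℕ} (hn : n < F.numTrans N g) :
    InShape (F.shape N g tag) ((fun i => (x i : ℤ)) - fun i => (F.trans N g n i : ℤ)) ↔
      ¬ ∃ m < F.chainLen N, F.Hit N g x n m := by
  have hB : 0 < 3 * N := by omega
  have hl : 0 < F.chainLen N := pow_pos hB _
  set v : Fin 3 → ℤ := (fun i => (x i : ℤ)) - fun i => (F.trans N g n i : ℤ) with hv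
  -- The two extra exponents in `far` are worth a factor of at least `9`, which exceeds all the
  -- differences that occur below.
  have hP : (9 : ℤ) * ((3 * N) ^ (2 * g) : ℕ) ≤ far N g := by
    unfold far
    have h9 : 9 ≤ (3 * N) ^ 2 := by nlinarith
    rw [pow_add]
    have := Nat.mul_le_mul_left ((3 * N) ^ (2 * g)) h9
    zify at this ⊢
    linarith
  set W := far N g with hW
  set P : ℤ := (((3 * N) ^ (2 * g) : ℕ) : ℤ) with hPdef
  have hP0 : 0 < P := by
    have := pow_pos hB (2 * g)
    rw [hPdef]
    exact_mod_cast this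
  have hvr : ∀ i, -(2 * P) < v i ∧ v i < P := by
    intro i
    have h1 := hx i
    have h2 := h.trans_lt hN hn i
    have h3 : v i = x i - F.trans N g n i := rfl
    zify at h1 h2
    rw [h3]
    push_cast at hPdef
    constructor <;> linarith
  have hside : ∀ i, 0 < F.side N i ∧ F.side N i ≤ P := by
    intro i
    unfold side
    have h1 := pow_pos hB (F.q i)
    have h2 := Nat.pow_le_pow_right hB (h.q_le i)
    rw [hPdef]
    exact ⟨by exact_mod_cast h1, by exact_mod_cast h2⟩
  -- The sentinels are beyond every difference `v`, so the first and the last gap of the chain are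
  -- unbounded for the points considered.
  have hpos0 : F.pos N g 0 < P - W := by
    have := h.spread_S_lt hN (m := F.chainLen N - 1) (by omega)
    have h0 : F.pos N g 0 =
        (spread (3 * N) (2 * g + 2) (exps F.S) (F.chainLen N - 1) : ℕ) - W := rfl
    rw [h0, hPdef]
    have : ((spread (3 * N) (2 * g + 2) (exps F.S) (F.chainLen N - 1) : ℕ) : ℤ) <
      ((3 * N) ^ (2 * g) : ℕ) := by exact_mod_cast this
    linarith
  have hposn : F.pos N g (F.chainLen N + 1) = W := by
    have := spread_add (E := 2 * g + 2) hB (exps F.S) 0 1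
    rw [Finset.length_sort, mul_one, spread_zero, zero_add, zero_add, one_mul] at this
    rw [h.pos_succ hN, chainLen, this, hW, far]
  have hchain := exists_quadrant_iff (Y := F.pos N g) (la := F.side N F.a) (lb := F.side N F.b)
    (hside _).1
    (fun i j hij => h.pos_gap hN (fun e he => (h.mem_S e he).1) (h.q_le _) hij)
    (fun i j hij => h.pos_gap hN (fun e he => (h.mem_S e he).2.1) (h.q_le _) hij)
    (F.chainLen N) (a := v F.a) (b := v F.b)
    (by linarith [(hvr F.a).1, (hside F.a).2]) (by linarith [(hvr F.a).2])
    (by linarith [(hvr F.b).2])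
  have hbox : (∃ m < F.chainLen N, F.Hit N g x n m) ↔
      (∃ i, (1 ≤ i ∧ i ≤ F.chainLen N) ∧
        (F.pos N g i ≤ v F.a ∧ v F.a < F.pos N g i + F.side N F.a) ∧
        -F.pos N g i ≤ v F.b ∧ v F.b < -F.pos N g i + F.side N F.b) ∧
      0 ≤ v F.c ∧ v F.c < F.side N F.c := by
    have hv' : ∀ i, v i = x i - F.trans N g n i := fun i => rfl
    have key : ∀ m, F.Hit N g x n m ↔
        ((F.pos N g (m + 1) ≤ v F.a ∧ v F.a < F.pos N g (m + 1) + F.side N F.a) ∧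
        -F.pos N g (m + 1) ≤ v F.b ∧ v F.b < -F.pos N g (m + 1) + F.side N F.b) ∧
        0 ≤ v F.c ∧ v F.c < F.side N F.c := by
      intro m
      rw [h.pos_succ hN, hv', hv', hv']
      unfold Hit side
      zify
      constructor
      · rintro ⟨⟨h1, h2⟩, ⟨h3, h4⟩, h5, h6⟩
        refine ⟨⟨⟨?_, ?_⟩, ?_, ?_⟩, ?_, ?_⟩ <;> linarith
      · rintro ⟨⟨⟨h1, h2⟩, h3, h4⟩, h5, h6⟩
        refine ⟨⟨?_, ?_⟩, ⟨?_, ?_⟩, ?_, ?_⟩ <;> linarith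
    constructor
    · rintro ⟨m, hm, hh⟩
      have := (key m).1 hh
      exact ⟨⟨m + 1, ⟨by omega, hm⟩, this.1⟩, this.2⟩
    · rintro ⟨⟨i, ⟨hi, hi'⟩, h1⟩, h2⟩
      obtain ⟨m, rfl⟩ : ∃ m, i = m + 1 := ⟨i - 1, by omega⟩
      exact ⟨m, hi', (key m).2 ⟨h1, h2⟩⟩
  -- Outside the chain of boxes means outside the planar chain or outside the slab in coordinate
  -- `c`. The former is the union of quadrants, extended trivially to coordinate `c`; the latter is
  -- given by the first two orthants.
  rw [hbox, not_and_or, ← hchain]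
  have hL : ∀ i, InOrthant (fun _ => false)
      (tri F.a F.b (F.pos N g (i + 1) - 1) (-F.pos N g i - 1) W) v ↔
      v F.a ≤ F.pos N g (i + 1) - 1 ∧ v F.b ≤ -F.pos N g i - 1 := by
    intro i
    rw [tri_const F.a F.b false, h.inOrthant_tri]
    simp only [Bool.false_eq_true, if_false]
    have : v F.c ≤ W := by linarith [(hvr F.c).2]
    simp [this]
  have hU : ∀ i, InOrthant (fun _ => true)
      (tri F.a F.b (F.pos N g i + F.side N F.a) (-F.pos N g (i + 1) + F.side N F.b) (-W)) v ↔
      F.pos N g i + F.side N F.a ≤ v F.a ∧ -F.pos N g (i + 1) + F.side N F.b ≤ v F.b := by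
    intro i
    rw [tri_const F.a F.b true, h.inOrthant_tri]
    simp only [if_true]
    have : -W ≤ v F.c := by linarith [(hvr F.c).1]
    simp [this]
  have h1 : InOrthant (tri F.a F.b true false false) (tri F.a F.b (-W - tag) W (-1)) v ↔
      v F.c < 0 := by
    rw [h.inOrthant_tri]
    have ha : -W - tag ≤ v F.a := by
      have : (0 : ℤ) ≤ tag := Int.natCast_nonneg _
      linarith [(hvr F.a).1]
    have hb : v F.b ≤ W := by linarith [(hvr F.b).2]
    simp only [Bool.false_eq_true, if_false, if_true, ha, hb, true_and]
    omega
  have h2 : InOrthant (tri F.a F.b true false true) (tri F.a F.b (-W) W (F.side N F.c)) v ↔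
      F.side N F.c ≤ v F.c := by
    rw [h.inOrthant_tri]
    have ha : -W ≤ v F.a := by linarith [(hvr F.a).1]
    have hb : v F.b ≤ W := by linarith [(hvr F.b).2]
    simp only [Bool.false_eq_true, if_false, if_true, ha, hb, true_and]
  have hshape : InShape (F.shape N g tag) v ↔ (v F.c < 0 ∨ F.side N F.c ≤ v F.c) ∨
      ∃ i ≤ F.chainLen N, (v F.a ≤ F.pos N g (i + 1) - 1 ∧ v F.b ≤ -F.pos N g i - 1) ∨
        (F.pos N g i + F.side N F.a ≤ v F.a ∧ -F.pos N g (i + 1) + F.side N F.b ≤ v F.b) := by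
    simp only [InShape, shape, List.mem_cons, List.mem_flatMap, List.mem_range,
      List.not_mem_nil, or_false, Nat.lt_succ_iff]
    constructor
    · rintro ⟨Q, rfl | rfl | ⟨i, hi, rfl | rfl⟩, hQ⟩
      · exact Or.inl (Or.inl (h1.1 hQ))
      · exact Or.inl (Or.inr (h2.1 hQ))
      · exact Or.inr ⟨i, hi, Or.inl ((hL i).1 hQ)⟩
      · exact Or.inr ⟨i, hi, Or.inr ((hU i).1 hQ)⟩
    · rintro ((hc | hc) | ⟨i, hi, hc | hc⟩)
      · exact ⟨_, Or.inl rfl, h1.2 hc⟩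
      · exact ⟨_, Or.inr (Or.inl rfl), h2.2 hc⟩
      · exact ⟨_, Or.inr (Or.inr ⟨i, hi, Or.inl rfl⟩), (hL i).2 hc⟩
      · exact ⟨_, Or.inr (Or.inr ⟨i, hi, Or.inr rfl⟩), (hU i).2 hc⟩
  rw [hshape, or_comm, not_and_or, not_le, not_lt]

end Family.Valid

end

/-! ### Correctness -/

/-- A number that is nonzero if the condition holds for the vertices that the digits `e` stand for,
none of these digits being a multiple of `3`. -/
def Cond.val (N : ℕ) (bit : ℕ → ℕ) (e : Fin 3 × ℕ → ℕ) : Cond → ℕ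
  | .edge r₁ r₂ r₃ => e r₁ % 3 * (e r₂ % 3) * (e r₃ % 3) *
      bit ((e r₁ / 3 * N + e r₂ / 3) * N + e r₃ / 3)
  -- One of the two truncated differences is zero and their sum is the distance, so the last factor
  -- is `1` for equal vertices and `0` otherwise.
  | .eq r₁ r₂ => e r₁ % 3 * (e r₂ % 3) * (1 - ((e r₁ / 3 - e r₂ / 3) + (e r₂ / 3 - e r₁ / 3)))

theorem Cond.val_ne_zero_iff {N : ℕ} {bit : ℕ → ℕ} {e : Fin 3 × ℕ → ℕ} {c : Cond} :
    c.val N bit e ≠ 0 ↔ (∀ r ∈ c.places, e r % 3 ≠ 0) ∧ c.Holds N bit fun r => e r / 3 := by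
  cases c with
  | edge r₁ r₂ r₃ => simp [Cond.val, Cond.places, Cond.Holds, and_assoc]
  | eq r₁ r₂ =>
    simp only [Cond.val, Cond.places, Cond.Holds, ne_eq, mul_eq_zero, not_or, and_assoc,
      List.forall_mem_cons, List.not_mem_nil, false_implies, implies_true, true_and]
    refine and_congr_right fun _ => and_congr_right fun _ => ?_
    omega

theorem Cond.holds_congr {N : ℕ} {bit : ℕ → ℕ} {u u' : Fin 3 × ℕ → ℕ} {c : Cond}
    (h : ∀ r ∈ c.places, u r = u' r) : c.Holds N bit u ↔ c.Holds N bit u' := by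
  cases c with
  | edge r₁ r₂ r₃ =>
    simp only [Cond.Holds]
    rw [h r₁ (by simp [Cond.places]), h r₂ (by simp [Cond.places]), h r₃ (by simp [Cond.places])]
  | eq r₁ r₂ =>
    simp only [Cond.Holds]
    rw [h r₁ (by simp [Cond.places]), h r₂ (by simp [Cond.places])]

section

variable {N g D : ℕ} {F : Family}

/-- The digit of a point at a place. -/
def digit (N : ℕ) (x : Fin 3 → ℕ) (r : Fin 3 × ℕ) : ℕ := dig (3 * N) r.2 (x r.1)

namespace Family.Valid

/-- In coordinates `a` and `c` the point has the digits of the lower corner of its box. In `a`, this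
corner is the translation plus the chain offset, which have disjoint supports `coS` and `S`, so
outside `S` the digit is that of the translation. In `b`, the cell of the translation contains the
point plus the offset; the offset has digit `0` at the place, so there is at most a carry from
below. -/
theorem dig_of_hit (h : F.Valid g D) (hN : 0 < N) {x : Fin 3 → ℕ} {n m : ℕ}
    (hm : m < F.chainLen N) (hit : F.Hit N g x n m) {r : Fin 3 × ℕ} (hr : r ∈ F.cond.places) :
    ∃ c ≤ 1, digit N (F.trans N g n) r = (digit N x r + c) % (3 * N) := by
  have hB : 0 < 3 * N := by omega
  obtain ⟨i, e⟩ := r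
  obtain ⟨hq, he, hS⟩ := h.places _ hr
  simp only [digit] at *
  obtain ⟨d, hd, hX⟩ := spread_exps (E := 2 * g + 2) hB hm
  have hSlt : ∀ e ∈ F.S, e < 2 * g := fun e he => (h.mem_S e he).2.2
  have hdigX : e ∉ F.S → dig (3 * N) e (spread (3 * N) (2 * g + 2) (exps F.S) m) = 0 := by
    intro hne
    rw [hX, dig_sum hSlt d hd, if_neg hne]
  have div_eq : ∀ {q z t : ℕ}, (3 * N) ^ q ∣ t → t ≤ z → z < t + (3 * N) ^ q → q ≤ e →
      dig (3 * N) e z = dig (3 * N) e t := by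
    rintro q z _ ⟨k, rfl⟩ h1 h2 hqe
    have hp : 0 < (3 * N) ^ q := pow_pos hB q
    unfold dig
    rw [div_pow_eq_of_le hqe]
    rw [Nat.mul_div_cancel_left _ hp]
    refine Nat.div_eq_of_lt_le ?_ ?_
    · linarith
    · rw [Nat.succ_mul]
      linarith
  obtain ⟨⟨h1, h2⟩, ⟨h3, h4⟩, h5, h6⟩ := hit
  rcases h.cases i with rfl | rfl | rfl
  · refine ⟨0, Nat.zero_le _, ?_⟩
    have hA : 0 < F.radixA N g := pow_pos hB _
    obtain ⟨d', hd', hT⟩ := spread_exps (E := 2 * g) hB (Nat.mod_lt n hA)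
    have htr : F.trans N g n F.a = ∑ e ∈ F.coS g, d' e * (3 * N) ^ e := by
      rw [trans, tri_a]
      exact hT
    rw [add_zero, Nat.mod_eq_of_lt (dig_lt hB _ _)]
    have hne := hS h.hac
    have hco : ∀ e ∈ F.coS g, F.q F.a ≤ e ∧ e < 2 * g := by
      intro e he
      simp only [coS, Finset.mem_sdiff, Finset.mem_Ico] at he
      exact he.1
    have hdisj : Disjoint (F.coS g) F.S := Finset.sdiff_disjoint
    have hsum : F.trans N g n F.a + spread (3 * N) (2 * g + 2) (exps F.S) m =
        ∑ e ∈ F.coS g ∪ F.S, (if e ∈ F.S then d e else d' e) * (3 * N) ^ e := by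
      rw [htr, hX, Finset.sum_union hdisj]
      congr 1
      · refine Finset.sum_congr rfl fun e he => ?_
        rw [if_neg (Finset.disjoint_left.1 hdisj he)]
      · refine Finset.sum_congr rfl fun e he => ?_
        rw [if_pos he]
    have hdvd : (3 * N) ^ F.q F.a ∣
        F.trans N g n F.a + spread (3 * N) (2 * g + 2) (exps F.S) m := by
      rw [hsum]
      refine Finset.dvd_sum fun e he => Dvd.dvd.mul_left (pow_dvd_pow _ ?_) _
      rcases Finset.mem_union.1 he with he | he
      exacts [(hco e he).1, (h.mem_S e he).1]
    rw [div_eq hdvd h1 h2 hq, hsum, htr, dig_sum (fun e he => (hco e he).2) d' hd',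
      dig_sum (L := 2 * g) (fun e he => ?_) _ fun e => ?_]
    · simp [hne]
    · rcases Finset.mem_union.1 he with he | he
      exacts [(hco e he).2, hSlt e he]
    · show (if e ∈ F.S then d e else d' e) < 3 * N
      split_ifs
      exacts [hd e, hd' e]
  · obtain ⟨c, hc, hcd⟩ := exists_carry hB (hdigX (hS h.hbc)) (x F.b)
    refine ⟨c, hc, ?_⟩
    rw [← hcd, div_eq ?_ h3 h4 hq]
    rw [trans, h.tri_b]
    exact dvd_mul_left _ _
  · refine ⟨0, Nat.zero_le _, ?_⟩
    rw [add_zero, Nat.mod_eq_of_lt (dig_lt hB _ _), div_eq ?_ h5 h6 hq]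
    rw [trans, h.tri_c]
    exact dvd_mul_left _ _

/-- The boxes of all translates, allowed or not, cover the cube. The chain takes the digits of `x
F.a` in `S` and the translation takes the others from `q` on; the offset is then known, and the
cells of `x F.b` plus the offset and of `x F.c` are determined. -/
theorem exists_hit (h : F.Valid g D) (hN : 0 < N) {x : Fin 3 → ℕ}
    (hx : ∀ i, x i < (3 * N) ^ (2 * g)) :
    ∃ n < F.numTrans N g, ∃ m < F.chainLen N, F.Hit N g x n m := by
  have hB : 0 < 3 * N := by omega
  have hd : ∀ e, dig (3 * N) e (x F.a) < 3 * N := fun e => dig_lt hB e _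
  obtain ⟨m, hm, hX⟩ := exists_spread_exps (E := 2 * g + 2) hB F.S hd
  obtain ⟨na, hna, hT⟩ := exists_spread_exps (E := 2 * g) hB (F.coS g) hd
  change na < F.radixA N g at hna
  have hXlt := h.spread_S_lt hN hm
  set X := spread (3 * N) (2 * g + 2) (exps F.S) m with hXdef
  have hsum : spread (3 * N) (2 * g) (exps (F.coS g)) na + X =
      x F.a / (3 * N) ^ F.q F.a * (3 * N) ^ F.q F.a := by
    rw [hT, hX, coS, ← sum_dig_Ico (h.q_le _) (hx _)]
    refine Finset.sum_sdiff fun e he => ?_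
    have := h.mem_S e he
    exact Finset.mem_Ico.2 ⟨this.1, this.2.2⟩
  have block : ∀ q y : ℕ, y / (3 * N) ^ q * (3 * N) ^ q ≤ y ∧
      y < y / (3 * N) ^ q * (3 * N) ^ q + (3 * N) ^ q := by
    intro q y
    have h1 := Nat.div_add_mod' y ((3 * N) ^ q)
    have h2 := Nat.mod_lt y (pow_pos hB q)
    constructor <;> linarith [Nat.zero_le (y % (3 * N) ^ q)]
  have quot : ∀ {q y c : ℕ}, q ≤ 2 * g → y < c * (3 * N) ^ (2 * g) →
      y / (3 * N) ^ q < c * (3 * N) ^ (2 * g - q) := by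
    intro q y c hq hy
    refine Nat.div_lt_of_lt_mul (hy.trans_eq ?_)
    rw [mul_left_comm, ← pow_add, Nat.add_sub_of_le hq]
  have hnb : (x F.b + X) / (3 * N) ^ F.q F.b < F.radixB N g :=
    quot (h.q_le _) (by linarith [hx F.b])
  have hnc : x F.c / (3 * N) ^ F.q F.c < F.radixC N g := by
    have := quot (c := 1) (h.q_le F.c) (by simpa using hx F.c)
    rwa [one_mul] at this
  set nb := (x F.b + X) / (3 * N) ^ F.q F.b with hnbdef
  set nc := x F.c / (3 * N) ^ F.q F.c with hncdef
  have hA : 0 < F.radixA N g := pow_pos hB _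
  have hRb : 0 < F.radixB N g := Nat.mul_pos two_pos (pow_pos hB _)
  have e1 : (na + F.radixA N g * (nb + F.radixB N g * nc)) % F.radixA N g = na := by
    rw [Nat.add_mul_mod_self_left, Nat.mod_eq_of_lt hna]
  have e2 : (na + F.radixA N g * (nb + F.radixB N g * nc)) / F.radixA N g =
      nb + F.radixB N g * nc := by
    rw [Nat.add_mul_div_left _ _ hA, Nat.div_eq_of_lt hna, zero_add]
  have e3 : (nb + F.radixB N g * nc) % F.radixB N g = nb := by
    rw [Nat.add_mul_mod_self_left, Nat.mod_eq_of_lt hnb]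
  have e4 : (nb + F.radixB N g * nc) / F.radixB N g = nc := by
    rw [Nat.add_mul_div_left _ _ hRb, Nat.div_eq_of_lt hnb, zero_add]
  refine ⟨na + F.radixA N g * (nb + F.radixB N g * nc), ?_, m, hm, ?_⟩
  · have h1 : F.radixB N g * (nc + 1) ≤ F.radixB N g * F.radixC N g := Nat.mul_le_mul_left _ hnc
    have h2 : F.radixA N g * (nb + F.radixB N g * nc + 1) ≤
        F.radixA N g * (F.radixB N g * F.radixC N g) :=
      Nat.mul_le_mul_left _ (by rw [mul_add, mul_one] at h1; omega)
    rw [mul_add, mul_one] at h2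
    unfold numTrans
    omega
  · unfold Hit
    simp only [← hXdef]
    rw [trans, e1, e2, e3, e4, tri_a, h.tri_b, h.tri_c, hsum]
    exact ⟨block _ _, block _ _, block _ _⟩

/-- All forbidden translates avoid the point: then its vertices satisfy the condition. -/
theorem holds_of_forall (h : F.Valid g D) (hN : 0 < N) {bit : ℕ → ℕ} {x : Fin 3 → ℕ}
    (hx : ∀ i, x i < (3 * N) ^ (2 * g))
    (hall : ∀ n < F.numTrans N g, F.cond.val N bit (digit N (F.trans N g n)) = 0 →
      ¬ ∃ m < F.chainLen N, F.Hit N g x n m) :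
    F.cond.Holds N bit fun r => digit N x r / 3 := by
  obtain ⟨n, hn, m, hm, hit⟩ := h.exists_hit hN hx
  have hv : F.cond.val N bit (digit N (F.trans N g n)) ≠ 0 := fun h0 =>
    hall n hn h0 ⟨m, hm, hit⟩
  obtain ⟨h1, h2⟩ := Cond.val_ne_zero_iff.1 hv
  refine (Cond.holds_congr fun r hr => ?_).1 h2
  obtain ⟨c, hc, hcd⟩ := h.dig_of_hit hN hm hit hr
  have h3 := h1 r hr
  have h4 : digit N x r < 3 * N := dig_lt (by omega) _ _
  rw [hcd] at h3 ⊢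
  -- Without overflow, a carry that ends in a digit not divisible by `3` stays inside the block of
  -- three digits of one vertex. An overflow would end in the digit `0`, which is divisible by `3`.
  rcases Nat.lt_or_ge (digit N x r + c) (3 * N) with h5 | h5
  · rw [Nat.mod_eq_of_lt h5] at h3 ⊢
    omega
  · rw [show digit N x r + c = 3 * N by omega, Nat.mod_self] at h3
    simp at h3

/-- A point in the middle of the cells of vertices that satisfy the condition is in no box. -/
theorem not_hit_of_holds (h : F.Valid g D) {bit : ℕ → ℕ} {x : Fin 3 → ℕ}
    {u : Fin 3 × ℕ → ℕ} (hu : ∀ r, u r < N)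
    (hx : ∀ r ∈ F.cond.places, digit N x r = 3 * u r + 1) (hc : F.cond.Holds N bit u) {n : ℕ}
    (hn : F.cond.val N bit (digit N (F.trans N g n)) = 0) :
    ¬ ∃ m < F.chainLen N, F.Hit N g x n m := by
  rintro ⟨m, hm, hit⟩
  have key : ∀ r ∈ F.cond.places, digit N (F.trans N g n) r % 3 ≠ 0 ∧
      u r = digit N (F.trans N g n) r / 3 := by
    intro r hr
    have := hu r
    obtain ⟨c, hc, hcd⟩ := h.dig_of_hit (by omega) hm hit hr
    -- A carry takes the middle digit `3 * u + 1` at most to `3 * u + 2`, which still stands for `u`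
    -- and is not divisible by `3`.
    have h5 : 3 * u r + 1 + c < 3 * N := by omega
    rw [hcd, hx r hr, Nat.mod_eq_of_lt h5]
    constructor
    · omega
    · omega
  refine Cond.val_ne_zero_iff.2 ⟨fun r hr => (key r hr).1, ?_⟩ hn
  exact (Cond.holds_congr fun r hr => (key r hr).2).1 hc

end Family.Valid

end

/-! ### The shapes and objects, without repetitions -/

/-- The translates of a family that the table `bit` asks for, the shape having index `idx`. -/
def Family.objects (N g : ℕ) (bit : ℕ → ℕ) (F : Family) (idx : ℕ) : List (ℕ × (Fin 3 → ℤ)) :=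
  ((List.range (F.numTrans N g)).filter fun n =>
    F.cond.val N bit (digit N (F.trans N g n)) = 0).map
    fun n => (idx, fun i => (F.trans N g n i : ℤ))

/-- A shape that is the orthant of the nonnegative points, with `r` orthants. -/
def upShape (r : ℕ) : List ((Fin 3 → Bool) × (Fin 3 → ℤ)) :=
  -- The orthants are nested, so only the one with corner `0` matters for the union; the others are
  -- padding.
  (List.range r).map fun i : ℕ => (fun _ => true, fun _ => (i : ℤ))

/-- The orthant of the points whose coordinates are below `(3 N) ^ (2 g)`. -/
def downShape (N g : ℕ) : List ((Fin 3 → Bool) × (Fin 3 → ℤ)) :=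
  [(fun _ => false, fun _ => (((3 * N) ^ (2 * g) : ℕ) : ℤ) - 1)]

/-- The shapes of the instance. -/
def allShapes (N g r : ℕ) (Fs : List Family) : List (List ((Fin 3 → Bool) × (Fin 3 → ℤ))) :=
  upShape r :: downShape N g :: (Fs.zipIdx 2).map fun p => p.1.shape N g p.2

/-- The objects of the instance. -/
def allObjects (N g s : ℕ) (bit : ℕ → ℕ) (Fs : List Family) : List (ℕ × (Fin 3 → ℤ)) :=
  -- Moving the nonnegative orthant by `-j` in all coordinates only weakens it: `j = 0` gives the
  -- lower bounds of the cube and the rest is padding.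
  (List.range s).map (fun j : ℕ => (0, fun _ => -(j : ℤ))) ++
    (1, fun _ => 0) :: (Fs.zipIdx 2).flatMap fun p => p.1.objects N g bit p.2

section

variable {N g D r s : ℕ} {bit : ℕ → ℕ} {Fs : List Family}

theorem allShapes_getElem? {p : Family × ℕ} (hp : p ∈ Fs.zipIdx 2) :
    (allShapes N g r Fs)[p.2]? = some (p.1.shape N g p.2) := by
  obtain ⟨h1, h2⟩ := List.mem_zipIdx_iff_le_and_getElem?_sub.1 hp
  obtain ⟨k, hk⟩ := Nat.exists_eq_add_of_le' h1
  rw [allShapes, hk, List.getElem?_cons_succ, List.getElem?_cons_succ, List.getElem?_map,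
    List.getElem?_zipIdx]
  rw [hk, Nat.add_sub_cancel] at h2
  rw [h2]
  simp [add_comm]

theorem length_allShapes : (allShapes N g r Fs).length = Fs.length + 2 := by
  simp [allShapes]

theorem pairwise_zipIdx : (Fs.zipIdx 2).Pairwise fun p p' => p.2 ≠ p'.2 := by
  have h : ((Fs.zipIdx 2).map Prod.snd).Nodup := by
    rw [List.zipIdx_map_snd]
    exact List.nodup_range'
  rwa [List.Nodup, List.pairwise_map] at h

theorem mem_objects {F : Family} {idx : ℕ} {o : ℕ × (Fin 3 → ℤ)} :
    o ∈ F.objects N g bit idx ↔ ∃ n < F.numTrans N g,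
      F.cond.val N bit (digit N (F.trans N g n)) = 0 ∧
      o = (idx, fun i => (F.trans N g n i : ℤ)) := by
  simp [Family.objects, and_assoc, eq_comm]

theorem index_lt : ∀ o ∈ allObjects N g s bit Fs, o.1 < (allShapes N g r Fs).length := by
  intro o ho
  rw [length_allShapes]
  simp only [allObjects, List.mem_append, List.mem_map, List.mem_cons, List.mem_flatMap,
    mem_objects] at ho
  rcases ho with ⟨j, -, rfl⟩ | rfl | ⟨p, hp, n, -, -, rfl⟩
  · simp
  · simp
  · exact List.snd_lt_of_mem_zipIdx hp

/-- Spreading is injective, so the three mixed-radix components of `n` can be recovered from the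
three coordinates. -/
theorem Family.Valid.trans_injOn {F : Family} (h : F.Valid g D) (hN : 0 < N) {n n' : ℕ}
    (he : F.trans N g n = F.trans N g n') : n = n' := by
  have hB : 0 < 3 * N := by omega
  have ea := congrFun he F.a
  have eb := congrFun he F.b
  have ec := congrFun he F.c
  simp only [Family.trans, tri_a, h.tri_b, h.tri_c] at ea eb ec
  have h1 := (spread_strictMono hB (exps_pairwise (F.coS g)) (fun e he => by
    rw [Finset.mem_sort] at he
    simp only [Family.coS, Finset.mem_sdiff, Finset.mem_Ico] at he
    exact he.1.2)).injective ea
  have h2 := Nat.eq_of_mul_eq_mul_right (pow_pos hB _) eb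
  have h3 := Nat.eq_of_mul_eq_mul_right (pow_pos hB _) ec
  rw [← Nat.div_add_mod n (F.radixA N g), ← Nat.div_add_mod n' (F.radixA N g), h1,
    ← Nat.div_add_mod (n / F.radixA N g) (F.radixB N g),
    ← Nat.div_add_mod (n' / F.radixA N g) (F.radixB N g), h2, h3]

theorem nodup_objects {F : Family} (h : F.Valid g D) (hN : 0 < N) (idx : ℕ) :
    (F.objects N g bit idx).Nodup := by
  refine List.Nodup.map ?_ (List.nodup_range.filter _)
  intro n n' he
  refine h.trans_injOn hN (funext fun i => ?_)
  have := congrFun (congrArg Prod.snd he) i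
  exact Int.ofNat_injective this

theorem nodup_allObjects (hFs : ∀ F ∈ Fs, F.Valid g D) (hN : 0 < N) :
    (allObjects N g s bit Fs).Nodup := by
  have hge : ∀ o ∈ (Fs.zipIdx 2).flatMap (fun p => p.1.objects N g bit p.2), 2 ≤ o.1 := by
    intro o ho
    simp only [List.mem_flatMap, mem_objects] at ho
    obtain ⟨p, hp, n, -, -, rfl⟩ := ho
    exact List.le_snd_of_mem_zipIdx hp
  rw [allObjects, List.nodup_append, List.nodup_cons, List.nodup_flatMap]
  refine ⟨?_, ⟨fun h => ?_, ⟨fun p hp => ?_, ?_⟩⟩, ?_⟩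
  · refine List.Nodup.map ?_ List.nodup_range
    intro j j' h
    have := congrFun (congrArg Prod.snd h) 0
    simpa using this
  · have := hge _ h
    simp at this
  · exact nodup_objects (hFs _ (List.fst_mem_of_mem_zipIdx hp)) hN _
  · refine pairwise_zipIdx.imp fun {p p'} hne => ?_
    intro o ho ho'
    obtain ⟨n, -, -, rfl⟩ := mem_objects.1 ho
    obtain ⟨n', -, -, h⟩ := mem_objects.1 ho'
    exact hne (congrArg Prod.fst h)
  · intro o ho o' ho' hoo
    subst hoo
    obtain ⟨j, -, rfl⟩ := List.mem_map.1 ho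
    rcases List.mem_cons.1 ho' with h | h
    · simp at h
    · have := hge _ h
      simp at this

theorem Family.Valid.nodup_shape {F : Family} (h : F.Valid g D) (hN : 0 < N) (tag : ℕ) :
    (F.shape N g tag).Nodup := by
  have hpos : StrictMono (F.pos N g) := by
    intro i j hij
    have := h.pos_gap hN (q := 0) (fun _ _ => Nat.zero_le _) (Nat.zero_le _) hij
    rw [pow_zero] at this
    push_cast at this
    linarith
  -- Chain orthants have the same direction in all coordinates, unlike the first two orthants.
  have hne : ∀ (Q : (Fin 3 → Bool) × (Fin 3 → ℤ)) x y z, Q ∈ (F.shape N g tag).drop 2 →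
      Q.1 = tri F.a F.b x y z → x = y ∧ y = z := by
    intro Q x y z hQ hu
    have hc : ∃ v : Bool, Q.1 = fun _ => v := by
      simp only [Family.shape, List.drop_succ_cons, List.drop_zero, List.mem_flatMap,
        List.mem_cons, List.not_mem_nil, or_false] at hQ
      obtain ⟨i, -, rfl | rfl⟩ := hQ
      exacts [⟨_, rfl⟩, ⟨_, rfl⟩]
    obtain ⟨v, hv⟩ := hc
    rw [hu] at hv
    have h1 := congrFun hv F.a
    have h2 := congrFun hv F.b
    have h3 := congrFun hv F.c
    rw [tri_a] at h1
    rw [h.tri_b] at h2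
    rw [h.tri_c] at h3
    rw [h1, h2, h3]
    exact ⟨rfl, rfl⟩
  rw [Family.shape, List.nodup_cons, List.nodup_cons, List.mem_cons, not_or]
  refine ⟨⟨fun he => ?_, fun hm => ?_⟩, fun hm => ?_, ?_⟩
  · have := congrFun (congrArg Prod.fst he) F.c
    simp [h.tri_c] at this
  · have := hne _ true false false hm rfl
    simp at this
  · have := hne _ true false true hm rfl
    simp at this
  · rw [List.nodup_flatMap]
    refine ⟨fun i _ => ?_, ?_⟩
    · simp only [List.nodup_cons, List.mem_singleton, List.not_mem_nil, not_false_eq_true,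
        List.nodup_nil, and_true]
      intro he
      have := congrFun (congrArg Prod.fst he) 0
      simp at this
    · refine List.nodup_range.imp fun {i j} hij => ?_
      intro Q hQ hQ'
      simp only [List.mem_cons, List.not_mem_nil, or_false] at hQ hQ'
      rcases hQ with rfl | rfl <;> rcases hQ' with hQ' | hQ'
      · have := congrFun (congrArg Prod.snd hQ') F.a
        simp only [tri_a, sub_left_inj, hpos.injective.eq_iff] at this
        omega
      · have := congrFun (congrArg Prod.fst hQ') 0
        simp at this
      · have := congrFun (congrArg Prod.fst hQ') 0
        simp at this
      · have := congrFun (congrArg Prod.snd hQ') F.a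
        simp only [tri_a, add_left_inj, hpos.injective.eq_iff] at this
        omega

theorem nodup_of_mem_allShapes (hFs : ∀ F ∈ Fs, F.Valid g D) (hN : 0 < N) :
    ∀ Z ∈ allShapes N g r Fs, Z.Nodup := by
  intro Z hZ
  simp only [allShapes, List.mem_cons, List.mem_map] at hZ
  rcases hZ with rfl | rfl | ⟨p, hp, rfl⟩
  · refine List.Nodup.map ?_ List.nodup_range
    intro j j' h
    have := congrFun (congrArg Prod.snd h) 0
    simpa using this
  · exact List.nodup_singleton _
  · exact (hFs _ (List.fst_mem_of_mem_zipIdx hp)).nodup_shape hN _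

/-- The first orthant of a family's shape has one upward and two downward directions, which
separates it from the two auxiliary shapes; between families, its corner reveals the tag. -/
theorem pairwise_allShapes (hFs : ∀ F ∈ Fs, F.Valid g D) (hr : 0 < r) :
    (allShapes N g r Fs).Pairwise fun Z Z' => ¬ ∀ Q, Q ∈ Z ↔ Q ∈ Z' := by
  have first : ∀ (F : Family) tag, (tri F.a F.b true false false,
      tri F.a F.b (-Family.far N g - tag) (Family.far N g) (-1)) ∈ F.shape N g tag :=
    fun F tag => List.mem_cons_self
  rw [allShapes, List.pairwise_cons, List.pairwise_cons, List.pairwise_map]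
  refine ⟨fun Z hZ h => ?_, fun Z hZ h => ?_, ?_⟩
  · rcases List.mem_cons.1 hZ with rfl | hZ
    · have := (h (fun _ => true, fun _ => 0)).1 (List.mem_map.2 ⟨0, List.mem_range.2 hr, rfl⟩)
      have := congrFun (congrArg Prod.fst (List.mem_singleton.1 this)) 0
      simp at this
    · obtain ⟨p, hp, rfl⟩ := List.mem_map.1 hZ
      have hv := hFs _ (List.fst_mem_of_mem_zipIdx hp)
      obtain ⟨i, -, hi⟩ := List.mem_map.1 ((h _).2 (first p.1 p.2))
      have := congrFun (congrArg Prod.fst hi) p.1.b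
      simp [hv.tri_b] at this
  · obtain ⟨p, hp, rfl⟩ := List.mem_map.1 hZ
    have := congrFun (congrArg Prod.fst (List.mem_singleton.1 ((h _).2 (first p.1 p.2)))) p.1.a
    simp [Family.Valid.tri_a] at this
  · refine (List.Pairwise.and_mem.1 pairwise_zipIdx).imp ?_
    rintro p p' ⟨hp, hp', hne⟩ h
    have hv := hFs _ (List.fst_mem_of_mem_zipIdx hp)
    have hv' := hFs _ (List.fst_mem_of_mem_zipIdx hp')
    have hmem := (h _).1 (first p.1 p.2)
    simp only [Family.shape, List.mem_cons, List.mem_flatMap, List.not_mem_nil, or_false,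
      Prod.mk.injEq] at hmem
    rcases hmem with ⟨h1, h2⟩ | ⟨h1, -⟩ | ⟨i, -, ⟨h1, -⟩ | ⟨h1, -⟩⟩
    · have ha : p'.1.a = p.1.a := by
        have h3 := congrFun h1 p'.1.a
        rw [Family.Valid.tri_a] at h3
        by_contra hne
        simp only [tri, if_neg hne] at h3
        split_ifs at h3
      have h3 := congrFun h2 p.1.a
      rw [Family.Valid.tri_a, ← ha, Family.Valid.tri_a] at h3
      apply hne
      omega
    · have h3 := congrFun h1 p'.1.a
      have h4 := congrFun h1 p'.1.c
      rw [Family.Valid.tri_a] at h3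
      rw [hv'.tri_c] at h4
      have h5 : ∀ i, tri p.1.a p.1.b true false false i = true → i = p.1.a := by
        intro i hi
        by_contra hne
        simp only [tri, if_neg hne] at hi
        split_ifs at hi
      exact hv'.hac ((h5 _ h3).trans (h5 _ h4).symm)
    · have h3 := congrFun h1 p.1.a
      simp [Family.Valid.tri_a] at h3
    · have h3 := congrFun h1 p.1.b
      simp [hv.tri_b] at h3

theorem dig_div_three_lt (hN : 0 < N) (x : Fin 3 → ℕ) (r : Fin 3 × ℕ) : digit N x r / 3 < N := by
  have : digit N x r < 3 * N := dig_lt (by omega) _ _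
  omega

/-- The instance of a design is a yes-instance if and only if there is a hyperclique. -/
theorem IsDesign.isYes_iff (hFs : IsDesign g D Fs) (hN : 0 < N) (hr : 0 < r) (hs : 0 < s)
    {H : Hypergraph (Fin N)} (hH : H.vertexSet = Set.univ) (h3 : IsThreeUniform H)
    (hbit : ∀ a b c : Fin N, bit (((a : ℕ) * N + b) * N + c) ≠ 0 ↔ {a, b, c} ∈ H.edgeSet) :
    (∃ x : Fin 3 → ℤ, ∀ o ∈ allObjects N g s bit Fs, ∀ Z, (allShapes N g r Fs)[o.1]? = some Z →
      InShape Z (x - o.2)) ↔ HasHyperclique H (3 * g) := by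
  have hB : 0 < 3 * N := by omega
  constructor
  · rintro ⟨x, hx⟩
    -- The unshifted padding object is the one that forces nonnegativity.
    have hup : ∀ i, 0 ≤ x i := by
      obtain ⟨Q, hQ, h⟩ := hx (0, fun _ => -((0 : ℕ) : ℤ))
        (List.mem_append_left _ (List.mem_map.2 ⟨0, List.mem_range.2 hs, rfl⟩)) _ rfl
      obtain ⟨k, -, rfl⟩ := List.mem_map.1 hQ
      intro i
      have := h i
      simp only [if_true, Pi.sub_apply] at this
      push_cast at this
      omega
    have hdown : ∀ i, x i < ((3 * N) ^ (2 * g) : ℕ) := by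
      obtain ⟨Q, hQ, h⟩ := hx (1, fun _ => 0)
        (List.mem_append_right _ List.mem_cons_self) _ rfl
      rw [downShape, List.mem_singleton] at hQ
      subst hQ
      intro i
      have := h i
      simp only [Bool.false_eq_true, if_false, Pi.sub_apply] at this
      omega
    lift x to Fin 3 → ℕ using hup
    have hlt : ∀ i, x i < (3 * N) ^ (2 * g) := fun i => Int.ofNat_lt.1 (hdown i)
    refine hFs.hasHyperclique hH h3 hbit (dig_div_three_lt hN x) fun F hF => ?_
    refine (hFs.valid F hF).holds_of_forall hN hlt fun n hn hv => ?_
    obtain ⟨k, hk⟩ := List.getElem?_of_mem hF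
    have hp : (F, k + 2) ∈ Fs.zipIdx 2 := by
      rw [List.mem_zipIdx_iff_le_and_getElem?_sub]
      exact ⟨by simp, by simpa using hk⟩
    rw [← (hFs.valid F hF).inShape_iff hN (k + 2) hlt hn]
    exact hx (k + 2, fun i => (F.trans N g n i : ℤ)) (List.mem_append_right _
      (List.mem_cons_of_mem _ (List.mem_flatMap.2 ⟨_, hp, mem_objects.2 ⟨n, hn, hv, rfl⟩⟩))) _
      (allShapes_getElem? hp)
  · intro h
    obtain ⟨u, hu, hcond⟩ := HasHyperclique.exists_holds (D := D) h hbit hN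
    have hd : ∀ i e, 3 * u (i, e) + 1 < 3 * N := fun i e => by
      have := hu (i, e)
      omega
    -- All digits are in the middle of their blocks of three, which leaves room for a carry.
    let x : Fin 3 → ℕ := fun i => ∑ e ∈ Finset.range (2 * g), (3 * u (i, e) + 1) * (3 * N) ^ e
    have hlt : ∀ i, x i < (3 * N) ^ (2 * g) := fun i => sum_digits_lt _ (hd i) _
    have hdig : ∀ q : Fin 3 × ℕ, q.2 < 2 * g → digit N x q = 3 * u q + 1 := by
      intro q hq
      have := dig_sum_range _ (hd q.1) (2 * g) q.2
      rwa [if_pos hq] at this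
    refine ⟨fun i => (x i : ℤ), fun o ho Z hZ => ?_⟩
    simp only [allObjects, List.mem_append, List.mem_map, List.mem_cons, List.mem_flatMap,
      mem_objects] at ho
    rcases ho with ⟨j, -, rfl⟩ | rfl | ⟨p, hp, n, hn, hv, rfl⟩
    · obtain rfl : upShape r = Z := by simpa [allShapes] using hZ
      refine ⟨_, List.mem_map.2 ⟨0, List.mem_range.2 hr, rfl⟩, fun i => ?_⟩
      simp only [if_true, Pi.sub_apply]
      push_cast
      omega
    · obtain rfl : downShape N g = Z := by simpa [allShapes] using hZ
      refine ⟨_, List.mem_singleton.2 rfl, fun i => ?_⟩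
      have := hlt i
      simp only [Bool.false_eq_true, if_false, Pi.sub_apply]
      omega
    · rw [allShapes_getElem? hp, Option.some.injEq] at hZ
      subst hZ
      have hF := hFs.valid _ (List.fst_mem_of_mem_zipIdx hp)
      exact (hF.inShape_iff hN _ hlt hn).2 (hF.not_hit_of_holds hu
        (fun q hq => hdig q (hF.places q hq).2.1) (hcond _ hF) hv)

end

/-! ### Expressions of the program -/

namespace RealRAM

/-- The number base `3 N`. -/
def baseE : WExp := .mul (.const 3) (.reg 0)

def powE : ℕ → WExp
  | 0 => .const 1
  | e + 1 => .mul (powE e) baseE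

def spreadE (E : ℕ) : List ℕ → WExp → WExp
  | [], x => .mul x (powE E)
  | e :: es, x => .add (.mul (.mod x baseE) (powE e)) (spreadE E es (.div x baseE))

section

variable {w N K : ℕ} {σ : State}

theorem eval_baseE (h0 : σ.wreg 0 = N) (hN : 0 < N) (hw : (3 * N) ^ (K + 1) < 2 ^ w) :
    baseE.eval w σ = 3 * N := by
  have h1 : 3 * N < 2 ^ w := by
    refine lt_of_le_of_lt ?_ hw
    calc 3 * N = (3 * N) ^ 1 := (pow_one _).symm
      _ ≤ _ := Nat.pow_le_pow_right (by omega) (by omega)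
  exact WExp.eval_mul_of_lt (WExp.eval_const_of_lt (by omega)) h0 h1

theorem eval_powE (h0 : σ.wreg 0 = N) (hN : 0 < N) (hw : (3 * N) ^ (K + 1) < 2 ^ w) {e : ℕ}
    (he : e ≤ K + 1) : (powE e).eval w σ = (3 * N) ^ e := by
  have hle : ∀ {e}, e ≤ K + 1 → (3 * N) ^ e < 2 ^ w := fun he =>
    lt_of_le_of_lt (Nat.pow_le_pow_right (by omega) he) hw
  induction e with
  | zero => exact WExp.eval_const_of_lt (hle he)
  | succ e ih =>
    rw [pow_succ]
    exact WExp.eval_mul_of_lt (ih (by omega)) (eval_baseE h0 hN hw) (by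
      rw [← pow_succ]
      exact hle he)

/-- All summands are nonnegative, so the bound on the final value excludes an overflow in every
intermediate sum and product. -/
theorem eval_spreadE (h0 : σ.wreg 0 = N) (hN : 0 < N) (hw : (3 * N) ^ (K + 1) < 2 ^ w) {E : ℕ}
    (hE : E ≤ K + 1) {es : List ℕ} (hes : ∀ e ∈ es, e ≤ K + 1) {x : WExp} {n : ℕ}
    (hx : x.eval w σ = n) (hn : spread (3 * N) E es n < 2 ^ w) :
    (spreadE E es x).eval w σ = spread (3 * N) E es n := by
  induction es generalizing x n with
  | nil => exact WExp.eval_mul_of_lt hx (eval_powE h0 hN hw hE) hn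
  | cons e es ih =>
    simp only [spread] at hn
    have hb := eval_baseE h0 hN hw
    refine WExp.eval_add_of_lt (WExp.eval_mul_of_lt ?_
      (eval_powE h0 hN hw (hes e List.mem_cons_self)) (by omega))
      (ih (fun e' he' => hes e' (List.mem_cons_of_mem _ he')) ?_ (by omega)) hn
    · simp only [WExp.eval, hx, hb]
    · simp only [WExp.eval, hx, hb]

end

/-- The tokens of an orthant. -/
def orthantE (u : Fin 3 → Bool) (c : Fin 3 → RExp) : List (WExp ⊕ RExp) :=
  .inl (.const 1) :: (List.finRange 3).flatMap fun i =>
    [.inl (.const (if u i then 1 else 0)), .inr (c i)]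

theorem eval_orthantE {w : ℕ} {σ : State} (hw : 1 < 2 ^ w) (u : Fin 3 → Bool) {c : Fin 3 → RExp}
    {z : Fin 3 → ℤ} (hc : ∀ i, (c i).eval w σ = z i) :
    (orthantE u c).map (evalToken w σ) = [Sum.inl 1] ++ encodeOrthant (intOrthant u z) := by
  have h1 : ∀ i, (if u i = true then 1 else 0) % 2 ^ w = if u i = true then 1 else 0 := by
    intro i
    split_ifs
    exacts [Nat.mod_eq_of_lt hw, Nat.zero_mod _]
  simp only [orthantE, encodeOrthant, List.map_cons, List.map_flatMap, evalToken, hc, WExp.eval,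
    List.map_nil, List.cons_append, List.nil_append, Nat.mod_eq_of_lt hw, h1, intOrthant]
  rfl

theorem eval_tri {w : ℕ} {σ : State} (a b : Fin 3) {x y z : RExp} {x' y' z' : ℤ}
    (hx : x.eval w σ = x') (hy : y.eval w σ = y') (hz : z.eval w σ = z') (i : Fin 3) :
    (tri a b x y z i).eval w σ = tri a b x' y' z' i := by
  unfold tri
  split_ifs <;> assumption

/-- The tokens of an object. -/
def objectE (idx : ℕ) (τ : Fin 3 → RExp) : List (WExp ⊕ RExp) :=
  [.inl (.const 1), .inl (.const idx)] ++ List.ofFn fun i => .inr (τ i)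

theorem eval_objectE {w : ℕ} {σ : State} (hw : 1 < 2 ^ w) {idx : ℕ} (hidx : idx < 2 ^ w)
    {τ : Fin 3 → RExp} {z : Fin 3 → ℝ} (hτ : ∀ i, (τ i).eval w σ = z i) :
    (objectE idx τ).map (evalToken w σ) = encodeObject idx z := by
  simp only [objectE, encodeObject, List.map_append, List.map_cons, List.map_nil, evalToken,
    WExp.eval, Nat.mod_eq_of_lt hw, Nat.mod_eq_of_lt hidx, List.map_ofFn]
  congr 2
  funext i
  simp only [Function.comp, evalToken, hτ]

/-! ### Programs whose running time is proportional to a budget -/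

/-- A number of vertices, a state with the data of the hypergraph, a word size that suffices for
numbers of `g + m + 10` digits, and a time budget `G`. -/
structure Ctx (g m M : ℕ) where
  (w N G r s : ℕ)
  st : State
  N_pos : 0 < N
  wreg_zero : st.wreg 0 = N
  wreg_three : st.wreg 3 = s
  wreg_four : st.wreg 4 = r
  word : (3 * N) ^ (2 * g + m + 9 + 1) < 2 ^ w
  const_lt : M < 2 ^ w
  pow_le : (3 * N) ^ m ≤ G
  r_le : r ≤ G
  s_le : s ≤ G
  r_lt : r < 2 ^ w
  s_lt : s < 2 ^ w
  bit_le : ∀ a, st.wmem a ≤ 1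

variable {g m M : ℕ}

namespace Ctx

variable (c : Ctx g m M)

theorem G_pos : 0 < c.G := lt_of_lt_of_le (pow_pos (by have := c.N_pos; omega) m) c.pow_le

theorem lt_word {x e : ℕ} (he : e ≤ 2 * g + m + 10) (hx : x ≤ (3 * c.N) ^ e) : x < 2 ^ c.w :=
  lt_of_le_of_lt (hx.trans (Nat.pow_le_pow_right (by have := c.N_pos; omega) he)) c.word

theorem three_lt : 3 < 2 ^ c.w :=
  c.lt_word (e := 1) (by omega) (by rw [pow_one]; have := c.N_pos; omega)

theorem one_lt : 1 < 2 ^ c.w := lt_trans (by norm_num) c.three_lt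

variable (i : ℕ) (o : List Token)

theorem upd_zero : (c.st.upd i o).wreg 0 = c.N := by
  simp [State.upd, c.wreg_zero]

theorem upd_one : (c.st.upd i o).wreg 1 = i := by
  simp [State.upd]

theorem eval_pow {e : ℕ} (he : e ≤ 2 * g + m + 10) :
    (powE e).eval c.w (c.st.upd i o) = (3 * c.N) ^ e :=
  eval_powE (c.upd_zero i o) c.N_pos c.word he

theorem eval_base : baseE.eval c.w (c.st.upd i o) = 3 * c.N :=
  eval_baseE (c.upd_zero i o) c.N_pos c.word

theorem eval_const {n : ℕ} (hn : n < 2 ^ c.w) : (WExp.const n).eval c.w (c.st.upd i o) = n :=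
  WExp.eval_const_of_lt hn

theorem eval_spread {E : ℕ} (hE : E ≤ 2 * g + m + 10) {es : List ℕ}
    (hes : ∀ e ∈ es, e ≤ 2 * g + m + 10) {x : WExp} {n : ℕ}
    (hx : x.eval c.w (c.st.upd i o) = n) (hn : spread (3 * c.N) E es n < 2 ^ c.w) :
    (spreadE E es x).eval c.w (c.st.upd i o) = spread (3 * c.N) E es n :=
  eval_spreadE (c.upd_zero i o) c.N_pos c.word hE hes hx hn

end Ctx

/-- In every context, the program writes the given output, in time proportional to the budget. -/
def Linear (P : Prog) (f : Ctx g m M → List Token) : Prop :=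
  ∃ C, ∀ c : Ctx g m M, ∀ i o, ∃ i', ∃ t ≤ C * c.G,
    Exec c.w P (c.st.upd i o) (c.st.upd i' (o ++ f c)) t

theorem Linear.seq {P Q : Prog} {f f' : Ctx g m M → List Token} (hP : Linear P f)
    (hQ : Linear Q f') : Linear (.seq P Q) fun c => f c ++ f' c := by
  obtain ⟨C, hC⟩ := hP
  obtain ⟨C', hC'⟩ := hQ
  refine ⟨C + C', fun c i o => ?_⟩
  obtain ⟨i', t, ht, h⟩ := hC c i o
  obtain ⟨i'', t', ht', h'⟩ := hC' c i' (o ++ f c)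
  refine ⟨i'', t + t', by rw [add_mul]; omega, ?_⟩
  rw [← List.append_assoc]
  exact h.seq h'

theorem linear_emit {l : List (WExp ⊕ RExp)} {f : Ctx g m M → List Token}
    (h : ∀ c i, l.map (evalToken c.w (c.st.upd i [])) = f c) : Linear (emit l) f := by
  refine ⟨emitCost l, fun c i o => ⟨i, emitCost l, Nat.le_mul_of_pos_right _ c.G_pos, ?_⟩⟩
  rw [← h c i]
  exact exec_emit c.w c.st i l o

theorem linear_forLoop {bound : WExp} {body : Prog} {n : Ctx g m M → ℕ}
    {f : Ctx g m M → ℕ → List Token} {K C : ℕ} (hn : ∀ c, n c ≤ K * c.G)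
    (hnw : ∀ c, n c < 2 ^ c.w) (hbound : ∀ c i o, bound.eval c.w (c.st.upd i o) = n c)
    (hbody : ∀ c, ∀ i < n c, ∀ o, ∃ t ≤ C,
      Exec c.w body (c.st.upd i o) (c.st.upd i (o ++ f c i)) t) :
    Linear (forLoop bound body) fun c => (List.range (n c)).flatMap (f c) := by
  refine ⟨K * (C + bound.cost + 6) + (bound.cost + 4), fun c i o => ?_⟩
  obtain ⟨t, ht, h⟩ := exec_forLoop (hnw c) (hbound c) (hbody c) i o
  refine ⟨n c, t, ht.trans ?_, h⟩
  have h1 := Nat.mul_le_mul_right (C + bound.cost + 6) (hn c)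
  have h2 : bound.cost + 4 ≤ (bound.cost + 4) * c.G := Nat.le_mul_of_pos_right _ c.G_pos
  calc _ ≤ K * c.G * (C + bound.cost + 6) + (bound.cost + 4) * c.G := by omega
    _ = _ := by ring

theorem linear_forLoop_emit {bound : WExp} {l : List (WExp ⊕ RExp)} {n : Ctx g m M → ℕ}
    {f : Ctx g m M → ℕ → List Token} {K : ℕ} (hn : ∀ c, n c ≤ K * c.G)
    (hnw : ∀ c, n c < 2 ^ c.w) (hbound : ∀ c i o, bound.eval c.w (c.st.upd i o) = n c)
    (hl : ∀ c, ∀ i < n c, l.map (evalToken c.w (c.st.upd i [])) = f c i) :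
    Linear (forLoop bound (emit l)) fun c => (List.range (n c)).flatMap (f c) :=
  linear_forLoop hn hnw hbound (C := emitCost l) fun c i hi o =>
    ⟨_, le_rfl, hl c i hi ▸ exec_emit c.w c.st i l o⟩

/-- Run a program for each element of a list. -/
def forEach {α : Type*} (P : α → Prog) : List α → Prog
  | [] => .skip
  | a :: l => .seq (P a) (forEach P l)

theorem linear_forEach {α : Type*} {P : α → Prog} {f : α → Ctx g m M → List Token} {l : List α}
    (h : ∀ a ∈ l, Linear (P a) (f a)) :
    Linear (forEach P l) fun c => l.flatMap fun a => f a c := by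
  induction l with
  | nil =>
    refine ⟨1, fun c i o => ⟨i, 1, by have := c.G_pos; omega, ?_⟩⟩
    simpa [forEach] using Exec.skip (w := c.w) (c.st.upd i o)
  | cons a l ih =>
    simp only [List.flatMap_cons]
    exact (h a List.mem_cons_self).seq (ih fun b hb => h b (List.mem_cons_of_mem _ hb))

theorem Linear.congr {P : Prog} {f f' : Ctx g m M → List Token} (h : Linear P f)
    (hf : ∀ c, f c = f' c) : Linear P f' := by
  obtain rfl : f = f' := funext hf
  exact h

end RealRAM

namespace RealRAM

/-! ### The program -/

/-- A natural number as a real. -/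
def natE (n : ℕ) : RExp := .ofWord (.const n)

namespace FamilyE

variable (g : ℕ) (F : Family)

def farE : RExp := .ofWord (powE (2 * g + 2))

def lenE : WExp := powE F.S.card

def posE : RExp :=
  .sub (.ofWord (spreadE (2 * g + 2) (exps F.S) (.sub (.add (lenE F) (.reg 1)) (.const 1)))) (farE g)

def posSuccE : RExp :=
  .sub (.ofWord (spreadE (2 * g + 2) (exps F.S) (.add (lenE F) (.reg 1)))) (farE g)

def negE (x : RExp) : RExp := .sub (natE 0) x

def sideE (i : Fin 3) : RExp := .ofWord (powE (F.q i))

def headE (tag : ℕ) : List (WExp ⊕ RExp) :=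
  .inl (.const 1) ::
    (orthantE (tri F.a F.b true false false)
      (tri F.a F.b (.sub (negE (farE g)) (natE tag)) (farE g) (negE (natE 1))) ++
    orthantE (tri F.a F.b true false true)
      (tri F.a F.b (negE (farE g)) (farE g) (sideE F F.c)))

def chainE : List (WExp ⊕ RExp) :=
  orthantE (fun _ => false) (tri F.a F.b (.sub (posSuccE g F) (natE 1))
      (.sub (negE (posE g F)) (natE 1)) (farE g)) ++
  orthantE (fun _ => true) (tri F.a F.b (.add (posE g F) (sideE F F.a))
      (.add (negE (posSuccE g F)) (sideE F F.b)) (negE (farE g)))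

/-- Write the shape of a family. -/
def shapeProg (tag : ℕ) : Prog :=
  .seq (emit (headE g F tag))
    (.seq (forLoop (.add (lenE F) (.const 1)) (emit (chainE g F))) (emit [.inl (.const 0)]))

def radixAE : WExp := powE (F.coS g).card
def radixBE : WExp := .mul (.const 2) (powE (2 * g - F.q F.b))
def radixCE : WExp := powE (2 * g - F.q F.c)

def numE : WExp := .mul (radixAE g F) (.mul (radixBE g F) (radixCE g F))

def transE : Fin 3 → WExp :=
  tri F.a F.b (spreadE (2 * g) (exps (F.coS g)) (.mod (.reg 1) (radixAE g F)))
    (.mul (.mod (.div (.reg 1) (radixAE g F)) (radixBE g F)) (powE (F.q F.b)))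
    (.mul (.div (.div (.reg 1) (radixAE g F)) (radixBE g F)) (powE (F.q F.c)))

def digitE (r : Fin 3 × ℕ) : WExp := .mod (.div (transE g F r.1) (powE r.2)) baseE

def valE : WExp :=
  let t (r : Fin 3 × ℕ) : WExp := .mod (digitE g F r) (.const 3)
  let v (r : Fin 3 × ℕ) : WExp := .div (digitE g F r) (.const 3)
  match F.cond with
  | .edge r₁ r₂ r₃ => .mul (.mul (.mul (t r₁) (t r₂)) (t r₃))
      (.load (.add (.mul (.add (.mul (v r₁) (.reg 0)) (v r₂)) (.reg 0)) (v r₃)))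
  | .eq r₁ r₂ => .mul (.mul (t r₁) (t r₂))
      (.sub (.const 1) (.add (.sub (v r₁) (v r₂)) (.sub (v r₂) (v r₁))))

/-- Write the objects of a family. -/
def objectsProg (idx : ℕ) : Prog :=
  forLoop (numE g F) (.ite (.wordEq (valE g F) (.const 0))
    (emit (objectE idx fun i => .ofWord (transE g F i))) .skip)

end FamilyE

open FamilyE

/-- Write the whole instance. -/
def instanceProg (g : ℕ) (Fs : List Family) : Prog :=
  .seq (emit [.inl (.const 1)])
  (.seq (forLoop (.reg 4) (emit (orthantE (fun _ => true) fun _ => .ofWord (.reg 1))))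
  (.seq (emit (.inl (.const 0) :: .inl (.const 1) :: (orthantE (fun _ => false)
      (fun _ => .sub (.ofWord (powE (2 * g))) (natE 1)) ++ [.inl (.const 0)])))
  (.seq (forEach (fun p => shapeProg g p.1 p.2) (Fs.zipIdx 2))
  (.seq (emit [.inl (.const 0)])
  (.seq (forLoop (.reg 3) (emit (objectE 0 fun _ => negE (.ofWord (.reg 1)))))
  (.seq (emit (objectE 1 fun _ => natE 0))
  (.seq (forEach (fun p => objectsProg g p.1 p.2) (Fs.zipIdx 2))
  (emit [.inl (.const 0)]))))))))

/-! ### Output and running time of the program -/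

section

variable {g m M D : ℕ} {F : Family}

theorem Ctx.eval_natE (c : Ctx g m M) (i : ℕ) (o : List Token) {n : ℕ} (hn : n < 2 ^ c.w) :
    (natE n).eval c.w (c.st.upd i o) = n :=
  congrArg Nat.cast (c.eval_const i o hn)

theorem Ctx.eval_farE (c : Ctx g m M) (i : ℕ) (o : List Token) :
    (farE g).eval c.w (c.st.upd i o) = Family.far c.N g := by
  unfold farE Family.far
  rw [RExp.eval, c.eval_pow i o (by omega)]
  simp

theorem Ctx.eval_negE (c : Ctx g m M) (i : ℕ) (o : List Token) {x : RExp} {z : ℤ}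
    (hx : x.eval c.w (c.st.upd i o) = z) :
    (negE x).eval c.w (c.st.upd i o) = ((-z : ℤ) : ℝ) := by
  rw [negE, RExp.eval, c.eval_natE i o (lt_trans one_pos c.one_lt), hx]
  simp

theorem Ctx.eval_sideE (c : Ctx g m M) (hF : F.Valid g D) (j : Fin 3) (i : ℕ) (o : List Token) :
    (sideE F j).eval c.w (c.st.upd i o) = F.side c.N j := by
  unfold sideE Family.side
  have := hF.q_le j
  rw [RExp.eval, c.eval_pow i o (by omega)]
  simp

theorem Ctx.eval_sub (c : Ctx g m M) (i : ℕ) (o : List Token) {x y : RExp} {z z' : ℤ}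
    (hx : x.eval c.w (c.st.upd i o) = z) (hy : y.eval c.w (c.st.upd i o) = z') :
    (RExp.sub x y).eval c.w (c.st.upd i o) = ((z - z' : ℤ) : ℝ) := by
  rw [RExp.eval, hx, hy]
  simp

theorem Ctx.eval_add (c : Ctx g m M) (i : ℕ) (o : List Token) {x y : RExp} {z z' : ℤ}
    (hx : x.eval c.w (c.st.upd i o) = z) (hy : y.eval c.w (c.st.upd i o) = z') :
    (RExp.add x y).eval c.w (c.st.upd i o) = ((z + z' : ℤ) : ℝ) := by
  rw [RExp.eval, hx, hy]
  simp

theorem Ctx.eval_one (c : Ctx g m M) (i : ℕ) (o : List Token) :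
    (natE 1).eval c.w (c.st.upd i o) = ((1 : ℤ) : ℝ) := by
  rw [c.eval_natE i o c.one_lt]
  simp

theorem Ctx.chainLen_le (c : Ctx g m M) (hF : F.Valid g D) (hD : D ≤ m) :
    F.chainLen c.N ≤ (3 * c.N) ^ m :=
  Nat.pow_le_pow_right (by have := c.N_pos; omega) (hF.card_S.trans hD)

theorem Ctx.eval_lenE (c : Ctx g m M) (hF : F.Valid g D) (hD : D ≤ m) (i : ℕ) (o : List Token) :
    (lenE F).eval c.w (c.st.upd i o) = F.chainLen c.N :=
  c.eval_pow i o (by have := hF.card_S; omega)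

theorem Ctx.three_mul_pow_le (c : Ctx g m M) (e : ℕ) : 3 * (3 * c.N) ^ e ≤ (3 * c.N) ^ (e + 1) := by
  rw [pow_succ']
  exact Nat.mul_le_mul_right _ (by have := c.N_pos; omega)

/-- Arguments up to `2 * chainLen` occur because of the last sentinel. Their spread values are at
most `2 * (3 * N) ^ (2 * g + 2)`, which is less than one more power of the base. -/
theorem Ctx.eval_spread_chain (c : Ctx g m M) (hF : F.Valid g D) {j : ℕ}
    (hj : j ≤ 2 * F.chainLen c.N) {i : ℕ} {o : List Token} {x : WExp}
    (hx : x.eval c.w (c.st.upd i o) = j) :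
    (spreadE (2 * g + 2) (exps F.S) x).eval c.w (c.st.upd i o) =
      spread (3 * c.N) (2 * g + 2) (exps F.S) j := by
  have hB : 0 < 3 * c.N := by have := c.N_pos; omega
  have hS : ∀ e ∈ exps F.S, e < 2 * g := fun e he =>
    (hF.mem_S e ((Finset.mem_sort _).1 he)).2.2
  refine c.eval_spread i o (by omega) (fun e he => ?_) hx (c.lt_word (e := 2 * g + 3) (by omega) ?_)
  · have := hS e he
    omega
  · have h1 := (spread_strictMono (E := 2 * g + 2) hB (exps_pairwise F.S) fun e he => by
      have := hS e he
      omega).monotone hj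
    have h2 := spread_add (E := 2 * g + 2) hB (exps F.S) 0 2
    rw [Finset.length_sort, spread_zero, zero_add, zero_add, mul_comm _ 2] at h2
    have h3 : 3 * (3 * c.N) ^ (2 * g + 2) ≤ (3 * c.N) ^ (2 * g + 3) := c.three_mul_pow_le (2 * g + 2)
    rw [Family.chainLen] at h1
    omega

theorem Ctx.eval_posSuccE (c : Ctx g m M) (hF : F.Valid g D) (hD : D ≤ m) {i : ℕ}
    (hi : i ≤ F.chainLen c.N) (o : List Token) :
    (posSuccE g F).eval c.w (c.st.upd i o) = F.pos c.N g (i + 1) := by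
  have hle := c.chainLen_le hF hD
  have h3 := c.three_mul_pow_le m
  have hx : (WExp.add (lenE F) (.reg 1)).eval c.w (c.st.upd i o) = F.chainLen c.N + i :=
    WExp.eval_add_of_lt (c.eval_lenE hF hD i o) (c.upd_one i o)
      (c.lt_word (e := m + 1) (by omega) (by omega))
  rw [posSuccE, RExp.eval, c.eval_farE, RExp.eval, c.eval_spread_chain hF (by omega) hx,
    Family.pos, ← add_assoc, Nat.add_sub_cancel]
  push_cast
  rfl

theorem Ctx.eval_posE (c : Ctx g m M) (hF : F.Valid g D) (hD : D ≤ m) {i : ℕ}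
    (hi : i ≤ F.chainLen c.N) (o : List Token) :
    (posE g F).eval c.w (c.st.upd i o) = F.pos c.N g i := by
  have hle := c.chainLen_le hF hD
  have h3 := c.three_mul_pow_le m
  have hx : (WExp.add (lenE F) (.reg 1)).eval c.w (c.st.upd i o) = F.chainLen c.N + i :=
    WExp.eval_add_of_lt (c.eval_lenE hF hD i o) (c.upd_one i o)
      (c.lt_word (e := m + 1) (by omega) (by omega))
  have hx' : (WExp.sub (.add (lenE F) (.reg 1)) (.const 1)).eval c.w (c.st.upd i o) =
      F.chainLen c.N + i - 1 := by
    rw [WExp.eval, hx, c.eval_const i o c.one_lt]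
  rw [posE, RExp.eval, c.eval_farE, RExp.eval, c.eval_spread_chain hF (by omega) hx', Family.pos]
  push_cast
  rfl

theorem linear_shapeProg (hF : F.Valid g D) (hD : D ≤ m) {tag : ℕ} (ht : tag ≤ M) :
    Linear (g := g) (m := m) (M := M) (shapeProg g F tag)
      fun c => encodeShape ((F.shape c.N g tag).map fun Q => intOrthant Q.1 Q.2) := by
  have h1 : Linear (g := g) (m := m) (M := M) (emit (headE g F tag)) fun c =>
      Sum.inl 1 :: (([Sum.inl 1] ++ encodeOrthant (intOrthant (tri F.a F.b true false false)
        (tri F.a F.b (-Family.far c.N g - tag) (Family.far c.N g) (-1)))) ++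
      ([Sum.inl 1] ++ encodeOrthant (intOrthant (tri F.a F.b true false true)
        (tri F.a F.b (-Family.far c.N g) (Family.far c.N g) (F.side c.N F.c))))) := by
    refine linear_emit fun c i => ?_
    rw [headE, List.map_cons, List.map_append,
      eval_orthantE c.one_lt _ (eval_tri _ _ (c.eval_sub i _ (c.eval_negE i _ (c.eval_farE i _))
        (z' := tag) ((c.eval_natE i _ (ht.trans_lt c.const_lt)).trans (by simp))) (c.eval_farE i _)
        (c.eval_negE i _ (c.eval_one i _))),
      eval_orthantE c.one_lt _ (eval_tri _ _ (c.eval_negE i _ (c.eval_farE i _)) (c.eval_farE i _)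
        (c.eval_sideE hF _ i _)), evalToken, c.eval_const i _ c.one_lt]
  have h2 : Linear (g := g) (m := m) (M := M) (forLoop (.add (lenE F) (.const 1))
      (emit (chainE g F))) fun c => (List.range (F.chainLen c.N + 1)).flatMap fun i =>
        ([Sum.inl 1] ++ encodeOrthant (intOrthant (fun _ => false)
          (tri F.a F.b (F.pos c.N g (i + 1) - 1) (-F.pos c.N g i - 1) (Family.far c.N g)))) ++
        ([Sum.inl 1] ++ encodeOrthant (intOrthant (fun _ => true)
          (tri F.a F.b (F.pos c.N g i + F.side c.N F.a)
            (-F.pos c.N g (i + 1) + F.side c.N F.b) (-Family.far c.N g)))) := by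
    have hlt : ∀ c : Ctx g m M, F.chainLen c.N + 1 < 2 ^ c.w := by
      intro c
      have hle := c.chainLen_le hF hD
      have h3 := c.three_mul_pow_le m
      have : 0 < (3 * c.N) ^ m := pow_pos (by have := c.N_pos; omega) _
      exact c.lt_word (e := m + 1) (by omega) (by omega)
    refine linear_forLoop_emit (K := 2) (fun c => ?_) hlt (fun c i o => ?_) fun c i hi => ?_
    · have hle := c.chainLen_le hF hD
      have := c.pow_le
      have := c.G_pos
      omega
    · exact WExp.eval_add_of_lt (c.eval_lenE hF hD i o) (c.eval_const i o c.one_lt) (hlt c)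
    · have hi' : i ≤ F.chainLen c.N := by omega
      have hp := c.eval_posE hF hD hi' []
      have hs := c.eval_posSuccE hF hD hi' []
      rw [chainE, List.map_append,
        eval_orthantE c.one_lt _ (eval_tri _ _ (c.eval_sub i _ hs (c.eval_one i _))
          (c.eval_sub i _ (c.eval_negE i _ hp) (c.eval_one i _)) (c.eval_farE i _)),
        eval_orthantE c.one_lt _ (eval_tri _ _ (c.eval_add i _ hp (c.eval_sideE hF _ i _))
          (c.eval_add i _ (c.eval_negE i _ hs) (c.eval_sideE hF _ i _))
          (c.eval_negE i _ (c.eval_farE i _)))]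
  have h3 : Linear (g := g) (m := m) (M := M) (emit [.inl (.const 0)]) fun _ => [Sum.inl 0] :=
    linear_emit fun c i => by simp [evalToken, WExp.eval]
  refine (h1.seq (h2.seq h3)).congr fun c => ?_
  simp only [encodeShape, Family.shape, List.map_cons, List.flatMap_cons, List.map_flatMap,
    List.flatMap_assoc, List.map_nil, List.flatMap_nil, List.append_nil, List.cons_append,
    List.nil_append, List.append_assoc]

theorem coS_card (hF : F.Valid g D) : (F.coS g).card + F.S.card = 2 * g - F.q F.a := by
  rw [Family.coS, ← Nat.card_Ico]
  refine Finset.card_sdiff_add_card_eq_card fun e he => Finset.mem_Ico.2 ?_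
  have := hF.mem_S e he
  exact ⟨this.1, this.2.2⟩

/-- The translation ranges over all restricted digits except those in `S` of coordinate `a`; this is
the number that `Family.Valid.count` controls. -/
theorem numTrans_le (hF : F.Valid g D) {N : ℕ} (hN : 0 < N) :
    F.numTrans N g ≤ 2 * (3 * N) ^ (2 * g - D + 4) := by
  have h1 := coS_card hF
  have h2 := hF.count
  unfold Family.numTrans Family.radixA Family.radixB Family.radixC
  calc _ = 2 * (3 * N) ^ ((F.coS g).card + (2 * g - F.q F.b) + (2 * g - F.q F.c)) := by
        rw [pow_add, pow_add]
        ring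
    _ ≤ _ := Nat.mul_le_mul_left _ (Nat.pow_le_pow_right (by omega) (by omega))

theorem Ctx.eval_radixAE (c : Ctx g m M) (hF : F.Valid g D) (i : ℕ) (o : List Token) :
    (radixAE g F).eval c.w (c.st.upd i o) = F.radixA c.N g :=
  c.eval_pow i o (by have := coS_card hF; omega)

theorem Ctx.eval_radixBE (c : Ctx g m M) (i : ℕ) (o : List Token) :
    (radixBE g F).eval c.w (c.st.upd i o) = F.radixB c.N g := by
  refine WExp.eval_mul_of_lt (c.eval_const i o ?_) (c.eval_pow i o (by omega)) ?_
  · exact lt_trans (by norm_num) c.three_lt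
  · have := c.three_mul_pow_le (2 * g - F.q F.b)
    exact c.lt_word (e := 2 * g - F.q F.b + 1) (by omega) (by omega)

theorem Ctx.numTrans_lt (c : Ctx g m M) (hF : F.Valid g D) (hm : 2 * g - D + 4 ≤ m) : F.numTrans c.N g < 2 ^ c.w := by
  have h1 := numTrans_le hF c.N_pos
  have h2 := c.three_mul_pow_le (2 * g - D + 4)
  exact c.lt_word (e := 2 * g - D + 4 + 1) (by omega) (by omega)

theorem Ctx.eval_numE (c : Ctx g m M) (hF : F.Valid g D) (hm : 2 * g - D + 4 ≤ m) (i : ℕ) (o : List Token) :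
    (numE g F).eval c.w (c.st.upd i o) = F.numTrans c.N g := by
  have h := c.numTrans_lt hF hm
  have hA : 0 < F.radixA c.N g := pow_pos (by have := c.N_pos; omega) _
  refine WExp.eval_mul_of_lt (c.eval_radixAE hF i o) (WExp.eval_mul_of_lt (c.eval_radixBE i o)
    (c.eval_pow i o (by omega)) (lt_of_le_of_lt ?_ h)) h
  exact Nat.le_mul_of_pos_left _ hA

theorem Ctx.eval_transE (c : Ctx g m M) (hF : F.Valid g D) {i : ℕ} (hi : i < F.numTrans c.N g) (o : List Token)
    (j : Fin 3) : (transE g F j).eval c.w (c.st.upd i o) = F.trans c.N g i j := by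
  have hlt : ∀ j, F.trans c.N g i j < 2 ^ c.w := by
    intro j
    have h1 := hF.trans_lt c.N_pos hi j
    have h2 := c.three_mul_pow_le (2 * g)
    exact c.lt_word (e := 2 * g + 1) (by omega) (by omega)
  have ha := hlt F.a
  have hb := hlt F.b
  have hc := hlt F.c
  have hA := c.eval_radixAE hF i o
  have hB := c.eval_radixBE (F := F) i o
  have h1 := c.upd_one i o
  have hq := hF.q_le
  rw [Family.trans] at ha hb hc
  rw [Family.Valid.tri_a] at ha
  rw [hF.tri_b] at hb
  rw [hF.tri_c] at hc
  unfold transE Family.trans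
  rcases hF.cases j with rfl | rfl | rfl
  · rw [Family.Valid.tri_a, Family.Valid.tri_a]
    refine c.eval_spread i o (by omega) (fun e he => ?_) (by simp only [WExp.eval, h1, hA]) ha
    rw [Finset.mem_sort, Family.coS, Finset.mem_sdiff, Finset.mem_Ico] at he
    omega
  · rw [hF.tri_b, hF.tri_b]
    refine WExp.eval_mul_of_lt (by simp only [WExp.eval, h1, hA, hB]) (c.eval_pow i o ?_) hb
    have := hq F.b
    omega
  · rw [hF.tri_c, hF.tri_c]
    refine WExp.eval_mul_of_lt (by simp only [WExp.eval, h1, hA, hB]) (c.eval_pow i o ?_) hc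
    have := hq F.c
    omega

theorem Ctx.eval_digitE (c : Ctx g m M) (hF : F.Valid g D) {i : ℕ} (hi : i < F.numTrans c.N g) (o : List Token)
    {r : Fin 3 × ℕ} (hr : r ∈ F.cond.places) :
    (digitE g F r).eval c.w (c.st.upd i o) = digit c.N (F.trans c.N g i) r := by
  have := (hF.places r hr).2.1
  simp only [digitE, WExp.eval, c.eval_transE hF hi, c.eval_pow i o (show r.2 ≤ _ by omega),
    c.eval_base, digit, dig]

theorem Ctx.eval_valE (c : Ctx g m M) (hF : F.Valid g D) {i : ℕ} (hi : i < F.numTrans c.N g) (o : List Token) :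
    (valE g F).eval c.w (c.st.upd i o) =
      F.cond.val c.N c.st.wmem (digit c.N (F.trans c.N g i)) := by
  have h3 := c.eval_const i o c.three_lt
  have h1 := c.eval_const i o c.one_lt
  have h0 := c.upd_zero i o
  have hB : ∀ n k, n ≤ k → (3 * c.N) ^ n ≤ (3 * c.N) ^ k := fun n k h =>
    Nat.pow_le_pow_right (by have := c.N_pos; omega) h
  have ht : ∀ r ∈ F.cond.places, (WExp.mod (digitE g F r) (.const 3)).eval c.w (c.st.upd i o) =
      digit c.N (F.trans c.N g i) r % 3 := fun r hr => by
    rw [WExp.eval, c.eval_digitE hF hi o hr, h3]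
  have hv : ∀ r ∈ F.cond.places, (WExp.div (digitE g F r) (.const 3)).eval c.w (c.st.upd i o) =
      digit c.N (F.trans c.N g i) r / 3 := fun r hr => by
    rw [WExp.eval, c.eval_digitE hF hi o hr, h3]
  have hvlt := dig_div_three_lt c.N_pos (F.trans c.N g i)
  -- Residues modulo `3` are at most `2` and table entries at most `1`, so the products stay below
  -- this bound.
  have h8 : 16 < 2 ^ c.w := c.lt_word (e := 3) (by omega) (by
    have : 3 ^ 3 ≤ (3 * c.N) ^ 3 := Nat.pow_le_pow_left (by have := c.N_pos; omega) 3
    omega)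
  have hmod : ∀ k, k % 3 ≤ 2 := fun k => by omega
  have hmul2 : ∀ k l, k % 3 * (l % 3) ≤ 4 := fun k l => Nat.mul_le_mul (hmod k) (hmod l)
  cases hcond : F.cond with
  | edge r₁ r₂ r₃ =>
    rw [hcond] at ht hv
    have t1 := ht r₁ (by simp [Cond.places])
    have t2 := ht r₂ (by simp [Cond.places])
    have t3 := ht r₃ (by simp [Cond.places])
    have v1 := hv r₁ (by simp [Cond.places])
    have v2 := hv r₂ (by simp [Cond.places])
    have v3 := hv r₃ (by simp [Cond.places])
    simp only [valE, hcond, Cond.val]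
    have l1 := hvlt r₁
    have l2 := hvlt r₂
    have l3 := hvlt r₃
    set d₁ := digit c.N (F.trans c.N g i) r₁
    set d₂ := digit c.N (F.trans c.N g i) r₂
    set d₃ := digit c.N (F.trans c.N g i) r₃
    have hN2 : (d₁ / 3 + 1) * c.N ≤ c.N * c.N := Nat.mul_le_mul_right _ l1
    have hN3 : (d₁ / 3 * c.N + d₂ / 3 + 1) * c.N ≤ c.N * c.N * c.N :=
      Nat.mul_le_mul_right _ (by rw [add_mul] at hN2; omega)
    have hpow : c.N * c.N * c.N ≤ (3 * c.N) ^ 3 := by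
      rw [← sq, ← pow_succ]
      exact Nat.pow_le_pow_left (by omega) 3
    have hpow' : c.N * c.N ≤ (3 * c.N) ^ 2 := by
      rw [← sq]
      exact Nat.pow_le_pow_left (by omega) 2
    rw [add_mul, one_mul] at hN2 hN3
    have hprod : d₁ % 3 * (d₂ % 3) * (d₃ % 3) ≤ 8 := Nat.mul_le_mul (hmul2 _ _) (hmod _)
    refine WExp.eval_mul_of_lt (WExp.eval_mul_of_lt (WExp.eval_mul_of_lt t1 t2 ?_) t3 ?_) ?_ ?_
    · have := hmul2 d₁ d₂
      omega
    · omega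
    · rw [WExp.eval]
      refine congrArg c.st.wmem (WExp.eval_add_of_lt (WExp.eval_mul_of_lt
        (WExp.eval_add_of_lt (WExp.eval_mul_of_lt v1 h0 ?_) v2 ?_) h0 ?_) v3 ?_)
      · exact c.lt_word (e := 2) (by omega) (by omega)
      · exact c.lt_word (e := 2) (by omega) (by omega)
      · exact c.lt_word (e := 3) (by omega) (by rw [add_mul] at hN3 ⊢; omega)
      · exact c.lt_word (e := 3) (by omega) (by omega)
    · have := Nat.mul_le_mul hprod (c.bit_le ((d₁ / 3 * c.N + d₂ / 3) * c.N + d₃ / 3))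
      omega
  | eq r₁ r₂ =>
    rw [hcond] at ht hv
    have t1 := ht r₁ (by simp [Cond.places])
    have t2 := ht r₂ (by simp [Cond.places])
    have v1 := hv r₁ (by simp [Cond.places])
    have v2 := hv r₂ (by simp [Cond.places])
    have l1 := hvlt r₁
    have l2 := hvlt r₂
    have hNlt : 3 * c.N < 2 ^ c.w := c.lt_word (e := 1) (by omega) (by rw [pow_one])
    have hm2 := hmul2 (digit c.N (F.trans c.N g i) r₁) (digit c.N (F.trans c.N g i) r₂)
    simp only [valE, hcond, Cond.val]
    have hsub : ∀ {a b : WExp} {x y : ℕ}, a.eval c.w (c.st.upd i o) = x →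
        b.eval c.w (c.st.upd i o) = y → (WExp.sub a b).eval c.w (c.st.upd i o) = x - y := by
      rintro a b _ _ rfl rfl
      rfl
    refine WExp.eval_mul_of_lt (WExp.eval_mul_of_lt t1 t2 (by omega))
      (hsub h1 (WExp.eval_add_of_lt (hsub v1 v2) (hsub v2 v1) (by omega))) ?_
    refine lt_of_le_of_lt (Nat.mul_le_mul hm2 (Nat.sub_le _ _)) (by omega)

theorem flatMap_filter_map {α β γ : Type*} (l : List α) (p : α → Prop) [DecidablePred p]
    (f : α → β) (h : β → List γ) :
    ((l.filter p).map f).flatMap h = l.flatMap fun a => if p a then h (f a) else [] := by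
  induction l with
  | nil => rfl
  | cons a l ih =>
    by_cases ha : p a
    · simp [ha, ih]
    · simp [ha, ih]

theorem linear_objectsProg (hF : F.Valid g D) (hm : 2 * g - D + 4 ≤ m) {idx : ℕ} (hidx : idx ≤ M) :
    Linear (g := g) (m := m) (M := M) (objectsProg g F idx) fun c =>
      (F.objects c.N g c.st.wmem idx).flatMap
        fun o => encodeObject o.1 fun i => (o.2 i : ℝ) := by
  have h : Linear (g := g) (m := m) (M := M) (objectsProg g F idx) fun c =>
      (List.range (F.numTrans c.N g)).flatMap fun n =>
        if F.cond.val c.N c.st.wmem (digit c.N (F.trans c.N g n)) = 0 then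
          encodeObject idx fun i => (F.trans c.N g n i : ℝ) else [] := by
    refine linear_forLoop (K := 2) (fun c => ?_) (fun c => c.numTrans_lt hF hm)
      (C := (Test.wordEq (valE g F) (.const 0)).cost +
        emitCost (objectE idx fun i => .ofWord (transE g F i)) + 1)
      (fun c i o => c.eval_numE hF hm i o) fun c i hi o => ?_
    · have h1 := numTrans_le hF c.N_pos
      have h2 : (3 * c.N) ^ (2 * g - D + 4) ≤ (3 * c.N) ^ m :=
        Nat.pow_le_pow_right (by have := c.N_pos; omega) hm
      have h3 := c.pow_le
      omega
    · have hv := c.eval_valE hF hi o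
      have h0 := c.eval_const i o (n := 0) (lt_trans one_pos c.one_lt)
      split_ifs with hval
      · refine ⟨_, ?_, Exec.iteTrue
          (t := emitCost (objectE idx fun i => .ofWord (transE g F i))) ?_ ?_⟩
        rotate_left
        · simp only [Test.Holds, hv, h0, hval]
        · have := exec_emit c.w c.st i (objectE idx fun i => .ofWord (transE g F i)) o
          rwa [eval_objectE c.one_lt (hidx.trans_lt c.const_lt)
            (z := fun j => (F.trans c.N g i j : ℝ)) fun j => by
              rw [RExp.eval, c.eval_transE hF hi]] at this
        · omega
      · refine ⟨_, ?_, Exec.iteFalse (t := 1) ?_ ?_⟩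
        rotate_left
        · simp only [Test.Holds, hv, h0, hval, not_false_eq_true]
        · rw [List.append_nil]
          exact Exec.skip _
        · omega
  refine h.congr fun c => ?_
  rw [Family.objects, flatMap_filter_map]
  simp only [Int.cast_natCast]

theorem linear_instanceProg {Fs : List Family} (hFs : ∀ F ∈ Fs, F.Valid g D) (hD : D ≤ m)
    (hm : 2 * g - D + 4 ≤ m) (hM : Fs.length + 2 ≤ M) :
    Linear (g := g) (m := m) (M := M) (instanceProg g Fs) fun c =>
      tokens (allShapes c.N g c.r Fs) (allObjects c.N g c.s c.st.wmem Fs) := by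
  have zero : ∀ (c : Ctx g m M) i, (natE 0).eval c.w (c.st.upd i []) = ((0 : ℤ) : ℝ) := by
    intro c i
    rw [c.eval_natE i _ (lt_trans one_pos c.one_lt)]
    simp
  have e0 : Linear (g := g) (m := m) (M := M) (emit [.inl (.const 0)]) fun _ => [Sum.inl 0] :=
    linear_emit fun c i => by simp [evalToken, WExp.eval]
  have e1 : Linear (g := g) (m := m) (M := M) (emit [.inl (.const 1)]) fun _ => [Sum.inl 1] :=
    linear_emit fun c i => by simp [evalToken, c.eval_const i [] c.one_lt]
  have up : Linear (g := g) (m := m) (M := M)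
      (forLoop (.reg 4) (emit (orthantE (fun _ => true) fun _ => .ofWord (.reg 1)))) fun c =>
      (List.range c.r).flatMap fun k : ℕ => [Sum.inl 1] ++
        encodeOrthant (intOrthant (fun _ => true) fun _ => (k : ℤ)) :=
    by
      refine linear_forLoop_emit (K := 1) (fun c => ?_) (fun c => c.r_lt) (fun c i o => ?_)
        fun c i _ => eval_orthantE c.one_lt _ fun _ => ?_
      · rw [one_mul]
        exact c.r_le
      · simp [WExp.eval, State.upd, c.wreg_four]
      · rw [RExp.eval, WExp.eval, c.upd_one]
        simp
  have down : Linear (g := g) (m := m) (M := M)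
      (emit (.inl (.const 0) :: .inl (.const 1) :: (orthantE (fun _ => false)
        (fun _ => .sub (.ofWord (powE (2 * g))) (natE 1)) ++ [.inl (.const 0)]))) fun c =>
      Sum.inl 0 :: Sum.inl 1 :: (([Sum.inl 1] ++ encodeOrthant (intOrthant (fun _ => false)
        fun _ => (((3 * c.N) ^ (2 * g) : ℕ) : ℤ) - 1)) ++ [Sum.inl 0]) :=
    linear_emit fun c i => by
      have h0 := c.eval_const i [] (lt_trans one_pos c.one_lt)
      have hp : (RExp.ofWord (powE (2 * g))).eval c.w (c.st.upd i []) =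
          (((3 * c.N) ^ (2 * g) : ℕ) : ℤ) := by
        rw [RExp.eval, c.eval_pow i [] (by omega)]
        simp
      rw [List.map_cons, List.map_cons, List.map_append, eval_orthantE c.one_lt _ fun _ =>
        c.eval_sub i _ hp (c.eval_one i _)]
      simp only [evalToken, h0, c.eval_const i [] c.one_lt, List.map_cons, List.map_nil]
  have hval : ∀ p ∈ Fs.zipIdx 2, p.1.Valid g D ∧ p.2 ≤ M := fun p hp =>
    ⟨hFs _ (List.fst_mem_of_mem_zipIdx hp), (List.snd_lt_of_mem_zipIdx hp).le.trans hM⟩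
  have shapes := linear_forEach (g := g) (m := m) (M := M) (P := fun p => shapeProg g p.1 p.2)
    fun p hp => linear_shapeProg (hval p hp).1 hD (hval p hp).2
  have objects := linear_forEach (g := g) (m := m) (M := M) (P := fun p => objectsProg g p.1 p.2)
    fun p hp => linear_objectsProg (hval p hp).1 hm (hval p hp).2
  have pad : Linear (g := g) (m := m) (M := M)
      (forLoop (.reg 3) (emit (objectE 0 fun _ => negE (.ofWord (.reg 1))))) fun c =>
      (List.range c.s).flatMap fun j : ℕ => encodeObject (d := 3) 0 fun _ => ((-(j : ℤ) : ℤ) : ℝ) :=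
    by
      refine linear_forLoop_emit (K := 1) (fun c => ?_) (fun c => c.s_lt) (fun c i o => ?_)
        fun c i _ => eval_objectE c.one_lt (lt_trans one_pos c.one_lt) fun _ =>
          c.eval_negE i _ ?_
      · rw [one_mul]
        exact c.s_le
      · simp [WExp.eval, State.upd, c.wreg_three]
      · rw [RExp.eval, WExp.eval, c.upd_one]
        simp
  have obj1 : Linear (g := g) (m := m) (M := M) (emit (objectE 1 fun _ => natE 0)) fun _ =>
      encodeObject (d := 3) 1 fun _ => ((0 : ℤ) : ℝ) :=
    linear_emit fun c i => eval_objectE c.one_lt c.one_lt fun _ => zero c i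
  refine (e1.seq (up.seq (down.seq (shapes.seq (e0.seq (pad.seq (obj1.seq
    (objects.seq e0)))))))).congr fun c => ?_
  simp only [tokens, allShapes, allObjects, upShape, downShape, encodeShape, List.flatMap_cons,
    List.flatMap_append, List.flatMap_map, List.flatMap_nil, List.flatMap_assoc, List.append_nil,
    List.cons_append, List.nil_append, List.append_assoc]

end

end RealRAM

namespace RealRAM

/-! ### Computing the numbers of padding orthants and objects -/

/-- Powers of the number of vertices. -/
def orderE : ℕ → WExp
  | 0 => .const 1
  | e + 1 => .mul (orderE e) (.reg 0)

theorem eval_orderE {w N e : ℕ} {σ : State} (h0 : σ.wreg 0 = N) (hN : 0 < N) (hw : N ^ e < 2 ^ w) :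
    (orderE e).eval w σ = N ^ e := by
  induction e with
  | zero => exact WExp.eval_const_of_lt hw
  | succ e ih =>
    have h1 : N ^ e ≤ N ^ (e + 1) := Nat.pow_le_pow_right hN (Nat.le_succ e)
    rw [pow_succ] at hw ⊢
    exact WExp.eval_mul_of_lt (ih (by rw [pow_succ] at h1; omega)) h0 hw

/-- One round of doubling: the word register `5` is doubled, the real register `1` is advanced by `θ`
and reduced modulo `1`, and the word register `R` is doubled at each overflow. -/
def doublingStep (R : ℕ) (θ : RExp) : Prog :=
  .seq (.setWord 5 (.mul (.reg 5) (.const 2)))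
    (.seq (.setReal 1 (.add (.reg 1) θ))
      (.ite (.realLe (natE 1) (.reg 1))
        (.seq (.setReal 1 (.sub (.reg 1) (natE 1))) (.setWord R (.mul (.reg R) (.const 2)))) .skip))

/-- Set the word register `R` to `N ^ (θ + e)`, up to a factor `2`. -/
def padProg (R : ℕ) (θ : RExp) (e : ℕ) : Prog :=
  .seq (.setWord 5 (.const 1)) (.seq (.setWord R (.const 1)) (.seq (.setReal 1 (natE 0))
    (.seq (.loop (.wordLt (.reg 5) (.reg 0)) (doublingStep R θ))
      (.setWord R (.mul (.reg R) (orderE e))))))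

/-- Only the registers that `padProg` uses have changed. -/
structure Frame (R : ℕ) (σ σ' : State) : Prop where
  wreg : ∀ i, i ≠ 5 → i ≠ R → σ'.wreg i = σ.wreg i
  rreg : σ'.rreg 0 = σ.rreg 0
  wmem : σ'.wmem = σ.wmem
  out : σ'.out = σ.out

theorem Frame.trans {R : ℕ} {σ σ' σ'' : State} (h : Frame R σ σ') (h' : Frame R σ' σ'') :
    Frame R σ σ'' :=
  ⟨fun i h5 hR => (h'.wreg i h5 hR).trans (h.wreg i h5 hR), h'.rreg.trans h.rreg,
    h'.wmem.trans h.wmem, h'.out.trans h.out⟩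

variable {w N R : ℕ} {lam θ : ℝ} {θE : RExp}

/-- The invariant of the doubling loop after `j` rounds. -/
structure Doubling (N R : ℕ) (lam θ : ℝ) (j p : ℕ) (σ : State) : Prop where
  zero : σ.wreg 0 = N
  five : σ.wreg 5 = 2 ^ j
  res : σ.wreg R = 2 ^ p
  lam : σ.rreg 0 = lam
  acc : σ.rreg 1 = θ * j - p
  nonneg : 0 ≤ θ * j - p
  lt : θ * j - p < 1

theorem exec_doublingStep (hR0 : R ≠ 0) (hR5 : R ≠ 5) (hθE : ∀ σ, σ.rreg 0 = lam → θE.eval w σ = θ)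
    (hθ0 : 0 ≤ θ) (hθ1 : θ < 1) (hw : 3 * N < 2 ^ w) {j p : ℕ} {σ : State}
    (h : Doubling N R lam θ j p σ) (hj : 2 ^ j < N) :
    ∃ p' σ', ∃ t ≤ θE.cost + 30, Exec w (doublingStep R θE) σ σ' t ∧
      Doubling N R lam θ (j + 1) p' σ' ∧ Frame R σ σ' := by
  have hj0 : 0 < 2 ^ j := pow_pos two_pos j
  have h2w : 2 < 2 ^ w := by omega
  have h1w : 1 < 2 ^ w := by omega
  have e1 := Exec.setWord (w := w) 5 (.mul (.reg 5) (.const 2)) σ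
  set σ₁ : State := { σ with wreg := Function.update σ.wreg 5 (2 ^ (j + 1)) } with hσ₁
  have hv1 : (WExp.mul (.reg 5) (.const 2)).eval w σ = 2 ^ (j + 1) := by
    rw [pow_succ]
    exact WExp.eval_mul_of_lt h.five (WExp.eval_const_of_lt h2w) (by omega)
  rw [hv1, ← hσ₁] at e1
  have e2 := Exec.setReal (w := w) 1 (.add (.reg 1) θE) σ₁
  set σ₂ : State := { σ₁ with rreg := Function.update σ₁.rreg 1 (θ * j - p + θ) } with hσ₂
  have hv2 : (RExp.add (.reg 1) θE).eval w σ₁ = θ * j - p + θ := by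
    rw [RExp.eval, hθE σ₁ h.lam, RExp.eval]
    exact congrArg (· + θ) h.acc
  rw [hv2, ← hσ₂] at e2
  have hnat : ∀ (σ : State), (natE 1).eval w σ = 1 := by
    intro σ
    rw [natE, RExp.eval, WExp.eval_const_of_lt h1w, Nat.cast_one]
  have hr1 : σ₂.rreg 1 = θ * j - p + θ := by simp [hσ₂]
  have hr0 : σ₂.rreg 0 = lam := by simp [hσ₂, hσ₁, h.lam]
  have hres : σ₂.wreg R = 2 ^ p := by simp [hσ₂, hσ₁, hR5, h.res]
  by_cases hge : 1 ≤ θ * j - p + θ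
  · have e3 := Exec.setReal (w := w) 1 (.sub (.reg 1) (natE 1)) σ₂
    set σ₃ : State := { σ₂ with rreg := Function.update σ₂.rreg 1 (θ * j - p + θ - 1) } with hσ₃
    have hv3 : (RExp.sub (.reg 1) (natE 1)).eval w σ₂ = θ * j - p + θ - 1 := by
      rw [RExp.eval, hnat, RExp.eval, hr1]
    rw [hv3, ← hσ₃] at e3
    -- The exponent advances by at most one per round, so register `R` is not larger than register
    -- `5` and its doubling fits into a word too.
    have hpj : p ≤ j := by
      have h1 : θ * j ≤ 1 * j := mul_le_mul_of_nonneg_right hθ1.le (Nat.cast_nonneg j)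
      have h2 := h.nonneg
      have h3 : (p : ℝ) ≤ j := by linarith
      exact_mod_cast h3
    have hpow : 2 ^ p ≤ 2 ^ j := Nat.pow_le_pow_right two_pos hpj
    have e4 := Exec.setWord (w := w) R (.mul (.reg R) (.const 2)) σ₃
    set σ₄ : State := { σ₃ with wreg := Function.update σ₃.wreg R (2 ^ (p + 1)) } with hσ₄
    have hv4 : (WExp.mul (.reg R) (.const 2)).eval w σ₃ = 2 ^ (p + 1) := by
      rw [pow_succ]
      exact WExp.eval_mul_of_lt hres (WExp.eval_const_of_lt h2w) (by omega)
    rw [hv4, ← hσ₄] at e4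
    refine ⟨p + 1, σ₄, _, ?_, e1.seq (e2.seq (Exec.iteTrue ?_ (e3.seq e4))), ?_, ?_⟩
    · simp only [WExp.cost, RExp.cost, Test.cost, natE]
      omega
    · simp only [Test.Holds, hnat, RExp.eval, hr1]
      exact hge
    · have hlt := h.lt
      constructor
      · simp [hσ₄, hσ₃, hσ₂, hσ₁, hR0.symm, h.zero]
      · simp [hσ₄, hσ₃, hσ₂, hσ₁, hR5.symm]
      · simp [hσ₄]
      · simp [hσ₄, hσ₃, hr0]
      · simp only [hσ₄, hσ₃, Function.update_self]
        push_cast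
        ring
      · push_cast
        linarith
      · push_cast
        linarith
    · constructor
      · intro i h5 hR
        simp [hσ₄, hσ₃, hσ₂, hσ₁, h5, hR]
      · simp [hσ₄, hσ₃, hσ₂, hσ₁]
      · rfl
      · rfl
  · refine ⟨p, σ₂, _, ?_, e1.seq (e2.seq (Exec.iteFalse ?_ (Exec.skip σ₂))), ?_, ?_⟩
    · simp only [WExp.cost, RExp.cost, Test.cost, natE]
      omega
    · simp only [Test.Holds, hnat, RExp.eval, hr1]
      exact hge
    · have hnn := h.nonneg
      constructor
      · simp [hσ₂, hσ₁, h.zero]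
      · simp [hσ₂, hσ₁]
      · exact hres
      · exact hr0
      · rw [hr1]
        push_cast
        ring
      · push_cast
        linarith
      · push_cast
        linarith
    · constructor
      · intro i h5 hR
        simp [hσ₂, hσ₁, h5]
      · simp [hσ₂, hσ₁]
      · rfl
      · rfl

/-- Register `5` is doubled only while it is below `N`, so it stays below `2 * N`. The parameter `n`
bounds the number of rounds left. -/
theorem exec_doubling (hR0 : R ≠ 0) (hR5 : R ≠ 5) (hθE : ∀ σ, σ.rreg 0 = lam → θE.eval w σ = θ)
    (hθ0 : 0 ≤ θ) (hθ1 : θ < 1) (hw : 3 * N < 2 ^ w) (n : ℕ) {j p : ℕ} {σ : State}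
    (h : Doubling N R lam θ j p σ) (hj : 2 ^ j < 2 * N) (hn : N ≤ 2 ^ (j + n)) :
    ∃ l p' σ', ∃ t ≤ n * (θE.cost + 33) + 3,
      Exec w (.loop (.wordLt (.reg 5) (.reg 0)) (doublingStep R θE)) σ σ' t ∧
      Doubling N R lam θ l p' σ' ∧ Frame R σ σ' ∧ N ≤ 2 ^ l ∧ 2 ^ l < 2 * N := by
  have htest : (Test.wordLt (.reg 5) (.reg 0)).Holds w σ ↔ 2 ^ j < N := by
    simp [Test.Holds, WExp.eval, h.five, h.zero]
  induction n generalizing j p σ with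
  | zero =>
    refine ⟨j, p, σ, _, ?_, Exec.loopFalse (by rw [htest]; simpa using hn), h,
      ⟨fun _ _ _ => rfl, rfl, rfl, rfl⟩, by simpa using hn, hj⟩
    simp [Test.cost, WExp.cost]
  | succ n ih =>
    by_cases hlt : 2 ^ j < N
    · obtain ⟨p₁, σ₁, t₁, ht₁, ex₁, h₁, f₁⟩ :=
        exec_doublingStep hR0 hR5 hθE hθ0 hθ1 hw h hlt
      obtain ⟨l, p', σ', t, ht, ex, h', f, hl, hl'⟩ := ih h₁ (by rw [pow_succ]; omega)
        (by rwa [add_right_comm, add_assoc])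
        (by simp [Test.Holds, WExp.eval, h₁.five, h₁.zero])
      refine ⟨l, p', σ', _, ?_, Exec.loopTrue (htest.2 hlt) ex₁ ex, h', f₁.trans f, hl, hl'⟩
      simp only [Test.cost, WExp.cost, Nat.succ_mul]
      omega
    · refine ⟨j, p, σ, _, ?_, Exec.loopFalse (by rwa [htest]), h,
        ⟨fun _ _ _ => rfl, rfl, rfl, rfl⟩, by omega, hj⟩
      simp [Test.cost, WExp.cost]

/-- Here `p` is the integral part of `θ * l`, which costs a factor of at most `2` downwards.
Replacing `N` by `2 ^ l` costs at most `2 ^ θ ≤ 2` upwards. -/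
theorem two_pow_near {l p : ℕ} (hN : 0 < N) (hθ0 : 0 ≤ θ) (hθ1 : θ < 1)
    (h0 : 0 ≤ θ * l - p) (h1 : θ * l - p < 1) (hl : N ≤ 2 ^ l) (hl' : 2 ^ l < 2 * N) :
    1 / 2 * (N : ℝ) ^ θ ≤ 2 ^ p ∧ (2 : ℝ) ^ p ≤ 2 * (N : ℝ) ^ θ := by
  have hN' : (0 : ℝ) < N := by exact_mod_cast hN
  have hpow : (2 : ℝ) ^ (θ * l) = ((2 : ℝ) ^ l) ^ θ := by
    rw [mul_comm, Real.rpow_mul (by norm_num), Real.rpow_natCast]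
  have hl2 : (N : ℝ) ≤ 2 ^ l := by exact_mod_cast hl
  have hl2' : (2 : ℝ) ^ l ≤ 2 * N := by exact_mod_cast hl'.le
  have ha : (N : ℝ) ^ θ ≤ ((2 : ℝ) ^ l) ^ θ := Real.rpow_le_rpow hN'.le hl2 hθ0
  have hb : ((2 : ℝ) ^ l) ^ θ ≤ 2 * (N : ℝ) ^ θ := by
    calc ((2 : ℝ) ^ l) ^ θ ≤ (2 * (N : ℝ)) ^ θ := Real.rpow_le_rpow (by positivity) hl2' hθ0
      _ = 2 ^ θ * (N : ℝ) ^ θ := Real.mul_rpow (by norm_num) hN'.le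
      _ ≤ 2 * (N : ℝ) ^ θ := by
        refine mul_le_mul_of_nonneg_right ?_ (by positivity)
        calc (2 : ℝ) ^ θ ≤ 2 ^ (1 : ℝ) := Real.rpow_le_rpow_of_exponent_le (by norm_num) hθ1.le
          _ = 2 := Real.rpow_one 2
  constructor
  · have h2 : (2 : ℝ) ^ (θ * l) ≤ 2 ^ ((p + 1 : ℕ) : ℝ) := by
      refine Real.rpow_le_rpow_of_exponent_le (by norm_num) ?_
      push_cast
      linarith
    rw [Real.rpow_natCast, pow_succ, hpow] at h2
    linarith
  · have h2 : (2 : ℝ) ^ (p : ℝ) ≤ 2 ^ (θ * l) :=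
      Real.rpow_le_rpow_of_exponent_le (by norm_num) (by linarith)
    rw [Real.rpow_natCast, hpow] at h2
    linarith

theorem exec_padProg (hN : 0 < N) (hR0 : R ≠ 0) (hR5 : R ≠ 5)
    (hθE : ∀ σ, σ.rreg 0 = lam → θE.eval w σ = θ) (hθ0 : 0 ≤ θ) (hθ1 : θ < 1) {e : ℕ}
    (hw : (3 * N) ^ (e + 1) < 2 ^ w) {σ : State} (h0 : σ.wreg 0 = N) (hlam : σ.rreg 0 = lam) :
    ∃ σ', ∃ t ≤ N * (θE.cost + 33) + (15 + (orderE e).cost), Exec w (padProg R θE e) σ σ' t ∧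
      Frame R σ σ' ∧ σ'.wreg R < 2 ^ w ∧ 1 / 2 * (N : ℝ) ^ (θ + e) ≤ σ'.wreg R ∧
      (σ'.wreg R : ℝ) ≤ 2 * (N : ℝ) ^ (θ + e) := by
  have hN1 : 1 ≤ 3 * N := by omega
  have h3N : 3 * N < 2 ^ w := by
    refine lt_of_le_of_lt ?_ hw
    calc 3 * N = (3 * N) ^ 1 := (pow_one _).symm
      _ ≤ _ := Nat.pow_le_pow_right hN1 (by omega)
  have h1w : 1 < 2 ^ w := by omega
  have hc1 : ∀ σ, (WExp.const 1).eval w σ = 1 := fun σ => WExp.eval_const_of_lt h1w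
  have e1 := Exec.setWord (w := w) 5 (.const 1) σ
  set σ₁ : State := { σ with wreg := Function.update σ.wreg 5 1 } with hσ₁
  rw [hc1, ← hσ₁] at e1
  have e2 := Exec.setWord (w := w) R (.const 1) σ₁
  set σ₂ : State := { σ₁ with wreg := Function.update σ₁.wreg R 1 } with hσ₂
  rw [hc1, ← hσ₂] at e2
  have e3 := Exec.setReal (w := w) 1 (natE 0) σ₂
  set σ₃ : State := { σ₂ with rreg := Function.update σ₂.rreg 1 0 } with hσ₃
  have hv3 : (natE 0).eval w σ₂ = 0 := by
    rw [natE, RExp.eval, WExp.eval_const_of_lt (by omega), Nat.cast_zero]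
  rw [hv3, ← hσ₃] at e3
  have hd : Doubling N R lam θ 0 0 σ₃ := by
    constructor
    · simp [hσ₃, hσ₂, hσ₁, hR0.symm, h0]
    · simp [hσ₃, hσ₂, hσ₁, hR5.symm]
    · simp [hσ₃, hσ₂]
    · simp [hσ₃, hσ₂, hσ₁, hlam]
    · simp [hσ₃]
    · simp
    · simp
  have f₃ : Frame R σ σ₃ := by
    constructor
    · intro i h5 hR
      simp [hσ₃, hσ₂, hσ₁, h5, hR]
    · simp [hσ₃, hσ₂, hσ₁]
    · rfl
    · rfl
  -- The crude bound of `N` rounds, from `N ≤ 2 ^ N`, is within the time allowed.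
  obtain ⟨l, p, σ₄, t, ht, e4, h4, f₄, hl, hl'⟩ := exec_doubling hR0 hR5 hθE hθ0 hθ1 h3N N hd
    (by rw [pow_zero]; omega) (by rw [zero_add]; exact Nat.lt_two_pow_self.le)
  obtain ⟨hlo, hhi⟩ := two_pow_near hN hθ0 hθ1 h4.nonneg h4.lt hl hl'
  have hpl : 2 ^ p ≤ 2 ^ l := by
    refine Nat.pow_le_pow_right two_pos ?_
    have h1 : θ * l ≤ 1 * l := mul_le_mul_of_nonneg_right hθ1.le (Nat.cast_nonneg l)
    have h2 := h4.nonneg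
    have h3 : (p : ℝ) ≤ l := by linarith
    exact_mod_cast h3
  have hNe : N ^ e ≤ (3 * N) ^ e := Nat.pow_le_pow_left (by omega) e
  have hres : 2 ^ p * N ^ e < 2 ^ w := by
    refine lt_of_le_of_lt ?_ hw
    rw [pow_succ']
    exact Nat.mul_le_mul (by omega) hNe
  have hNew : N ^ e < 2 ^ w :=
    lt_of_le_of_lt (Nat.le_mul_of_pos_left _ (pow_pos two_pos p)) hres
  have e5 := Exec.setWord (w := w) R (.mul (.reg R) (orderE e)) σ₄
  have hreg : (WExp.reg R).eval w σ₄ = 2 ^ p := h4.res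
  have hv5 := WExp.eval_mul_of_lt hreg (eval_orderE h4.zero hN hNew) hres
  rw [hv5] at e5
  have hN' : (0 : ℝ) < N := by exact_mod_cast hN
  have hsplit : (N : ℝ) ^ (θ + e) = (N : ℝ) ^ θ * (N : ℝ) ^ e := by
    rw [Real.rpow_add hN', Real.rpow_natCast]
  have hNe0 : (0 : ℝ) ≤ (N : ℝ) ^ e := by positivity
  refine ⟨_, _, ?_, e1.seq (e2.seq (e3.seq (e4.seq e5))), ?_, ?_, ?_, ?_⟩
  · simp only [WExp.cost, RExp.cost, natE]
    omega
  · refine f₃.trans (f₄.trans ⟨fun i _ hR => ?_, rfl, rfl, rfl⟩)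
    simp [hR]
  · simpa using hres
  · rw [hsplit]
    simp only [Function.update_self]
    push_cast
    rw [← mul_assoc]
    exact mul_le_mul_of_nonneg_right hlo hNe0
  · rw [hsplit]
    simp only [Function.update_self]
    push_cast
    rw [← mul_assoc]
    exact mul_le_mul_of_nonneg_right hhi hNe0

end RealRAM

/-! ### The size of the instance -/

section

variable {N g D r s : ℕ} {bit : ℕ → ℕ} {Fs : List Family}

theorem le_length_allObjects : s ≤ (allObjects N g s bit Fs).length := by
  rw [allObjects, List.length_append, List.length_map, List.length_range]
  exact Nat.le_add_right _ _

theorem length_allObjects_le (hFs : ∀ F ∈ Fs, F.Valid g D) (hN : 0 < N) :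
    (allObjects N g s bit Fs).length ≤
      s + (1 + Fs.length * (2 * (3 * N) ^ (2 * g - D + 4))) := by
  rw [allObjects, List.length_append, List.length_map, List.length_range, List.length_cons,
    List.length_flatMap, add_comm 1]
  refine Nat.add_le_add_left (Nat.add_le_add_right ?_ 1) s
  refine (List.sum_le_card_nsmul _ (2 * (3 * N) ^ (2 * g - D + 4)) ?_).trans_eq ?_
  · intro n hn
    obtain ⟨p, hp, rfl⟩ := List.mem_map.1 hn
    rw [Family.objects, List.length_map]
    refine (List.length_filter_le _ _).trans ?_
    rw [List.length_range]
    exact RealRAM.numTrans_le (hFs _ (List.fst_mem_of_mem_zipIdx hp)) hN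
  · simp

theorem le_sum_length_allShapes : r ≤ ((allShapes N g r Fs).map List.length).sum := by
  simp [allShapes, upShape]

theorem sum_length_allShapes_le (hFs : ∀ F ∈ Fs, F.Valid g D) (hN : 0 < N) :
    ((allShapes N g r Fs).map List.length).sum ≤
      r + (1 + Fs.length * (4 + 2 * (3 * N) ^ D)) := by
  simp only [allShapes, upShape, downShape, List.map_cons, List.sum_cons, List.length_map,
    List.length_range, List.map_map, List.length_cons, List.length_nil, zero_add]
  refine Nat.add_le_add_left (Nat.add_le_add_left ?_ 1) r
  refine (List.sum_le_card_nsmul _ (4 + 2 * (3 * N) ^ D) ?_).trans_eq ?_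
  · intro n hn
    obtain ⟨p, hp, rfl⟩ := List.mem_map.1 hn
    have h1 : (3 * N) ^ p.1.S.card ≤ (3 * N) ^ D := Nat.pow_le_pow_right (by omega)
      (hFs _ (List.fst_mem_of_mem_zipIdx hp)).card_S
    simp only [Function.comp, Family.shape, List.length_cons, List.length_flatMap, List.length_nil,
      List.map_const', List.sum_replicate, List.length_range, smul_eq_mul, Family.chainLen]
    omega
  · simp

end

namespace RealRAM

/-! ### The input -/

section

variable {lam : ℝ} {N : ℕ} {H : Hypergraph (Fin N)}

theorem inputState_wmem_le (a : ℕ) : (inputState lam H).wmem a ≤ 1 := by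
  simp only [inputState]
  split_ifs <;> simp

/-- Addresses are three-digit numbers in base `N`, so different triples do not share a bit. -/
theorem inputState_wmem_ne_zero (a b c : Fin N) :
    (inputState lam H).wmem (((a : ℕ) * N + b) * N + c) ≠ 0 ↔ {a, b, c} ∈ H.edgeSet := by
  simp only [inputState]
  split_ifs with h
  · simp only [ne_eq, one_ne_zero, not_false_eq_true, true_iff]
    obtain ⟨a', b', c', he, hmem⟩ := h
    have key : ∀ {x x' : ℕ} {y y' : Fin N}, x * N + y = x' * N + y' → x = x' ∧ y = y' := by
      intro x x' y y' h
      have h1 := congrArg (· % N) h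
      have h2 := congrArg (· / N) h
      have hN : 0 < N := y.pos
      simp only [Nat.mul_add_mod', Nat.mod_eq_of_lt y.2, Nat.mod_eq_of_lt y'.2] at h1
      simp only [Nat.mul_comm _ N, Nat.mul_add_div hN, Nat.div_eq_of_lt y.2,
        Nat.div_eq_of_lt y'.2, add_zero] at h2
      exact ⟨h2, Fin.ext h1⟩
    obtain ⟨h1, rfl⟩ := key he
    obtain ⟨h2, rfl⟩ := key h1
    obtain rfl := Fin.ext h2
    exact hmem
  · simp only [ne_eq, not_true_eq_false, false_iff]
    exact fun hmem => h ⟨a, b, c, rfl, hmem⟩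

end

/-! ### The padding -/

/-- The fractional part of `2 g x`, where `n` is its integral part. -/
def fracE (g n : ℕ) (x : RExp) : RExp := .sub (.mul (natE (2 * g)) x) (natE n)

/-- Set the word registers `3` and `4` to the numbers of padding objects and orthants. -/
noncomputable def sizesProg (g : ℕ) (lam : ℝ) : Prog :=
  .seq (padProg 3 (fracE g ⌊2 * g * lam⌋₊ (.reg 0)) (⌊2 * g * lam⌋₊ + 4))
    (padProg 4 (fracE g ⌊2 * g * (1 - lam)⌋₊ (.sub (natE 1) (.reg 0))) (⌊2 * g * (1 - lam)⌋₊ + 4))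

theorem floor_le {g : ℕ} {x : ℝ} (hx1 : x ≤ 1) : ⌊2 * g * x⌋₊ ≤ 2 * g := by
  refine Nat.floor_le_of_le ?_
  push_cast
  nlinarith [Nat.cast_nonneg (α := ℝ) g]

theorem exec_padProg_frac {w N R g : ℕ} {lam x : ℝ} {xE : RExp} (hN : 0 < N) (hR0 : R ≠ 0)
    (hR5 : R ≠ 5) (hx0 : 0 ≤ x) (hx1 : x ≤ 1) (hxE : ∀ σ, σ.rreg 0 = lam → xE.eval w σ = x)
    (hg : 2 * g < 2 ^ w) (hw : (3 * N) ^ (2 * g + 5) < 2 ^ w) {σ : State} (h0 : σ.wreg 0 = N)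
    (hlam : σ.rreg 0 = lam) :
    ∃ σ', ∃ t ≤ N * ((fracE g ⌊2 * g * x⌋₊ xE).cost + 33) +
        (15 + (orderE (⌊2 * g * x⌋₊ + 4)).cost),
      Exec w (padProg R (fracE g ⌊2 * g * x⌋₊ xE) (⌊2 * g * x⌋₊ + 4)) σ σ' t ∧
      Frame R σ σ' ∧ σ'.wreg R < 2 ^ w ∧ 1 / 2 * (N : ℝ) ^ (2 * g * x + 4) ≤ σ'.wreg R ∧
      (σ'.wreg R : ℝ) ≤ 2 * (N : ℝ) ^ (2 * g * x + 4) := by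
  have hfl := floor_le (g := g) hx1
  have h2 : 0 ≤ 2 * g * x := by positivity
  have hsum : 2 * g * x - ⌊2 * g * x⌋₊ + ((⌊2 * g * x⌋₊ + 4 : ℕ) : ℝ) = 2 * g * x + 4 := by
    push_cast
    ring
  have h := exec_padProg (w := w) (θE := fracE g ⌊2 * g * x⌋₊ xE)
    (θ := 2 * g * x - ⌊2 * g * x⌋₊) (e := ⌊2 * g * x⌋₊ + 4) hN hR0 hR5 (fun σ hσ => ?_)
    (by linarith [Nat.floor_le h2]) (by linarith [Nat.lt_floor_add_one (2 * g * x)])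
    (lt_of_le_of_lt (Nat.pow_le_pow_right (by omega) (by omega)) hw) h0 hlam
  · rwa [hsum] at h
  · simp only [fracE, RExp.eval, natE, hxE σ hσ, WExp.eval_const_of_lt hg,
      WExp.eval_const_of_lt (hfl.trans_lt hg)]
    push_cast
    rfl

/-- The exponents are split into integral and fractional part: doubling approximates the fractional
power, and the integral power is a product. Linear time suffices, since the target bound is at least
`N`. -/
theorem exists_exec_sizesProg (g : ℕ) {lam : ℝ} (h0 : 0 ≤ lam) (h1 : lam ≤ 1) :
    ∃ C, ∀ w N : ℕ, 0 < N → 2 * g < 2 ^ w → (3 * N) ^ (2 * g + 5) < 2 ^ w → ∀ σ : State,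
      σ.wreg 0 = N → σ.rreg 0 = lam →
      ∃ σ', ∃ t ≤ C * N, Exec w (sizesProg g lam) σ σ' t ∧ σ'.wreg 0 = N ∧ σ'.wmem = σ.wmem ∧
        σ'.out = σ.out ∧ σ'.wreg 3 < 2 ^ w ∧ σ'.wreg 4 < 2 ^ w ∧
        1 / 2 * (N : ℝ) ^ (2 * g * lam + 4) ≤ σ'.wreg 3 ∧
        (σ'.wreg 3 : ℝ) ≤ 2 * (N : ℝ) ^ (2 * g * lam + 4) ∧
        1 / 2 * (N : ℝ) ^ (2 * g * (1 - lam) + 4) ≤ σ'.wreg 4 ∧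
        (σ'.wreg 4 : ℝ) ≤ 2 * (N : ℝ) ^ (2 * g * (1 - lam) + 4) := by
  refine ⟨(fracE g ⌊2 * g * lam⌋₊ (.reg 0)).cost + 33 + (15 + (orderE (⌊2 * g * lam⌋₊ + 4)).cost) +
    ((fracE g ⌊2 * g * (1 - lam)⌋₊ (.sub (natE 1) (.reg 0))).cost + 33 +
      (15 + (orderE (⌊2 * g * (1 - lam)⌋₊ + 4)).cost)), fun w N hN hg hw σ hσ hlam => ?_⟩
  have h1w : 1 < 2 ^ w :=
    lt_of_le_of_lt (Nat.one_le_pow _ _ (by omega)) hw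
  obtain ⟨σ₁, t₁, ht₁, ex₁, f₁, hlt₁, hlo₁, hhi₁⟩ := exec_padProg_frac (R := 3) (xE := .reg 0)
    hN (by norm_num) (by norm_num) h0 h1 (fun σ hσ => hσ) hg hw hσ hlam
  obtain ⟨σ₂, t₂, ht₂, ex₂, f₂, hlt₂, hlo₂, hhi₂⟩ := exec_padProg_frac (R := 4) (lam := lam)
    (x := 1 - lam) (xE := .sub (natE 1) (.reg 0)) hN (by norm_num) (by norm_num) (by linarith)
    (by linarith) (fun σ hσ => by simp [RExp.eval, natE, WExp.eval_const_of_lt h1w, hσ]) hg hw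
    ((f₁.wreg 0 (by norm_num) (by norm_num)).trans hσ) (f₁.rreg.trans hlam)
  have h3 := f₂.wreg 3 (by norm_num) (by norm_num)
  refine ⟨σ₂, t₁ + t₂, ?_, ex₁.seq ex₂, ?_, f₂.wmem.trans f₁.wmem, f₂.out.trans f₁.out,
    by rwa [h3], hlt₂, by rwa [h3], by rwa [h3], hlo₂, hhi₂⟩
  · have hmul : ∀ k, k ≤ N * k := fun k => Nat.le_mul_of_pos_left k hN
    refine (Nat.add_le_add (ht₁.trans (Nat.add_le_add_left (hmul _) _))
      (ht₂.trans (Nat.add_le_add_left (hmul _) _))).trans_eq ?_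
    rw [← mul_add, ← mul_add, ← mul_add, mul_comm]
  · rw [f₂.wreg 0 (by norm_num) (by norm_num), f₁.wreg 0 (by norm_num) (by norm_num), hσ]

/-- With `L = Nat.log 2 N + 1 ≥ 1`, one has `3 * N ≤ 2 ^ (2 + L) ≤ 2 ^ (3 * L)`; the summand `M + 1`
in the factor takes care of the constant. -/
theorem lt_two_pow_of_log {K M N w : ℕ} (hw : (3 * K + M + 1) * (Nat.log 2 N + 1) ≤ w) :
    (3 * N) ^ K < 2 ^ w ∧ M < 2 ^ w := by
  set L := Nat.log 2 N + 1 with hL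
  have hN : N < 2 ^ L := Nat.lt_pow_succ_log_self (by norm_num) N
  have h3 : 3 * N ≤ 2 ^ (3 * L) := by
    have h4 : 2 ^ (2 + L) ≤ 2 ^ (3 * L) := Nat.pow_le_pow_right two_pos (by omega)
    rw [pow_add] at h4
    omega
  constructor
  · calc (3 * N) ^ K ≤ (2 ^ (3 * L)) ^ K := Nat.pow_le_pow_left h3 K
      _ = 2 ^ (3 * K * L) := by rw [← pow_mul]; ring_nf
      _ < 2 ^ w := Nat.pow_lt_pow_right (by norm_num) (by rw [add_assoc, add_mul] at hw; nlinarith)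
  · refine lt_of_lt_of_le (Nat.lt_two_pow_self (n := M)) (Nat.pow_le_pow_right two_pos ?_)
    nlinarith

end RealRAM

/-! ### Assembling the reduction -/

open RealRAM

theorem mainTheorem4 (lam : ℝ) (hlam : lam ∈ Set.Icc (2 / 3 : ℝ) 1) (k : ℕ) (hk : 3 ∣ k) :
    ∃ (P : RealRAM.Prog) (c : ℕ) (c₁ c₂ : ℝ), 0 < c₁ ∧ 0 < c₂ ∧
      ∀ (N : ℕ), 0 < N → ∀ H : Hypergraph (Fin N),
        H.vertexSet = Set.univ → IsThreeUniform H →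
        ∀ w : ℕ, c * (Nat.log 2 N + 1) ≤ w →
        ∃ (s : RealRAM.State) (t : ℕ) (I : TOInstance 3),
          RealRAM.Exec w P (RealRAM.inputState lam H) s t ∧
          (t : ℝ) ≤ c₂ * (N : ℝ) ^ (2 * lam * k / 3 + 4) ∧
          RealRAM.Describes s.out I ∧
          (I.IsYes ↔ HasHyperclique H k) ∧
          c₁ * (N : ℝ) ^ (2 * lam * k / 3 + 4) ≤ (I.numTranslates : ℝ) ∧
          (I.numTranslates : ℝ) ≤ c₂ * (N : ℝ) ^ (2 * lam * k / 3 + 4) ∧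
          c₁ * (N : ℝ) ^ (2 * (1 - lam) * k / 3 + 4) ≤ (I.numOrthants : ℝ) ∧
          (I.numOrthants : ℝ) ≤ c₂ * (N : ℝ) ^ (2 * (1 - lam) * k / 3 + 4) := by
  obtain ⟨hlam1, hlam2⟩ := hlam
  obtain ⟨g, rfl⟩ := hk
  have hexp : ∀ x : ℝ, 2 * x * ((3 * g : ℕ) : ℝ) / 3 + 4 = 2 * g * x + 4 := by
    intro x
    push_cast
    ring
  rw [hexp, hexp]
  have hg0 : (0 : ℝ) ≤ g := Nat.cast_nonneg g
  -- Rounding up keeps the translations within `2 * g - D ≤ 2 * g * lam` digits, and costs the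
  -- shapes less than one digit, which the exponent `4` absorbs.
  set D := ⌈2 * g * (1 - lam)⌉₊ with hDdef
  have hDnn : 0 ≤ 2 * g * (1 - lam) := mul_nonneg (by positivity) (by linarith)
  have hD1 : (D : ℝ) < 2 * g * (1 - lam) + 1 := Nat.ceil_lt_add_one hDnn
  have hD2 : 2 * g * (1 - lam) ≤ D := Nat.le_ceil _
  have hDg : D ≤ g := Nat.ceil_le.2 (by nlinarith)
  -- From `lam ≥ 2 / 3` one gets `D < 2 * g / 3 + 1`, and `3 * D` is an integer.
  have hD3 : 3 * D ≤ 2 * g + 2 := by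
    have h : ((3 * D : ℕ) : ℝ) < ((2 * g + 3 : ℕ) : ℝ) := by
      push_cast
      nlinarith
    have := Nat.cast_lt.1 h
    omega
  obtain ⟨Fs, hFs⟩ := exists_design hDg hD3
  -- The digits of a translation. Because of `D ≤ g` also `D ≤ m`, so writing the shapes fits into
  -- the same time budget.
  obtain ⟨m, hm⟩ : ∃ m, m = 2 * g - D + 4 := ⟨_, rfl⟩
  have hmR : (m : ℝ) = 2 * g - D + 4 := by
    rw [hm, Nat.cast_add, Nat.cast_sub (by omega)]
    push_cast
    ring
  -- The bound on the constants covers the shape indices and the number `2 * g`, which occurs in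
  -- `sizesProg`.
  obtain ⟨C, hC⟩ := linear_instanceProg (m := m) (M := Fs.length + 2 + 2 * g) hFs.valid
    (by omega) hm.ge (by omega)
  obtain ⟨C', hC'⟩ := exists_exec_sizesProg g (lam := lam) (by linarith) hlam2
  -- The lower constant `1 / 2` is the accuracy of the padding. The upper one is the sum of the
  -- constants for the time, the translates and the orthants.
  refine ⟨.seq (sizesProg g lam) (instanceProg g Fs),
    3 * (2 * g + m + 9 + 1) + (Fs.length + 2 + 2 * g) + 1, 1 / 2,
    (C' + C * (3 ^ m + 4)) + (3 + 2 * Fs.length * 3 ^ m) + (3 + Fs.length * (4 + 2 * 3 ^ D)),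
    by norm_num, by positivity, ?_⟩
  intro N hN H hH h3 w hw
  obtain ⟨hword, hconst⟩ := lt_two_pow_of_log hw
  have hpow : (3 * N) ^ (2 * g + 5) < 2 ^ w :=
    lt_of_le_of_lt (Nat.pow_le_pow_right (by omega) (by omega)) hword
  obtain ⟨σ, t, ht, ex, hσ0, hσm, hσo, hs, hr, hsl, hsu, hrl, hru⟩ :=
    hC' w N hN (by omega) hpow (inputState lam H) rfl rfl
  set s := σ.wreg 3 with hsdef
  set r := σ.wreg 4 with hrdef
  set X : ℝ := (N : ℝ) ^ (2 * g * lam + 4) with hX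
  set Y : ℝ := (N : ℝ) ^ (2 * g * (1 - lam) + 4) with hY
  have hN1 : (1 : ℝ) ≤ N := by exact_mod_cast hN
  have hY1 : 1 ≤ Y := Real.one_le_rpow hN1 (by linarith)
  have hYX : Y ≤ X := Real.rpow_le_rpow_of_exponent_le hN1 (by nlinarith)
  have hNX : (N : ℝ) ≤ X := by
    calc (N : ℝ) = (N : ℝ) ^ (1 : ℝ) := (Real.rpow_one _).symm
      _ ≤ X := Real.rpow_le_rpow_of_exponent_le hN1 (by nlinarith)
  have hmX : (((3 * N) ^ m : ℕ) : ℝ) ≤ 3 ^ m * X := by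
    push_cast
    rw [mul_pow, ← Real.rpow_natCast (N : ℝ) m]
    exact mul_le_mul_of_nonneg_left
      (Real.rpow_le_rpow_of_exponent_le hN1 (by rw [hmR]; linarith)) (by positivity)
  have hDY : (((3 * N) ^ D : ℕ) : ℝ) ≤ 3 ^ D * Y := by
    push_cast
    rw [mul_pow, ← Real.rpow_natCast (N : ℝ) D]
    exact mul_le_mul_of_nonneg_left
      (Real.rpow_le_rpow_of_exponent_le hN1 (by linarith)) (by positivity)
  have hs0 : 0 < s := by
    have : (0 : ℝ) < s := by linarith
    exact_mod_cast this
  have hr0 : 0 < r := by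
    have : (0 : ℝ) < r := by linarith
    exact_mod_cast this
  -- The budget counts the translations and the padding; it is at most `(3 ^ m + 4) * X`.
  let c : Ctx g m (Fs.length + 2 + 2 * g) :=
    { w := w, N := N, G := (3 * N) ^ m + s + r, r := r, s := s, st := σ
      N_pos := hN
      wreg_zero := hσ0
      wreg_three := rfl
      wreg_four := rfl
      word := hword
      const_lt := hconst
      pow_le := by omega
      r_le := by omega
      s_le := by omega
      r_lt := hr
      s_lt := hs
      bit_le := fun a => by rw [hσm]; exact inputState_wmem_le a }
  obtain ⟨i', t', ht', ex'⟩ := hC c (σ.wreg 1) []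
  have hupd : c.st.upd (σ.wreg 1) [] = σ := by
    have : σ.out = [] := hσo
    simp only [State.upd, c, Function.update_eq_self, ← this]
  rw [hupd, List.nil_append] at ex'
  obtain ⟨I, hdesc, htr, hor, hyes⟩ := exists_instance
    (nodup_of_mem_allShapes (r := r) hFs.valid hN) (pairwise_allShapes hFs.valid hr0)
    (nodup_allObjects (s := s) (bit := σ.wmem) hFs.valid hN) index_lt
  have htX : (t : ℝ) ≤ C' * X := by
    calc (t : ℝ) ≤ ((C' * N : ℕ) : ℝ) := Nat.cast_le.2 ht
      _ = C' * N := by push_cast; rfl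
      _ ≤ C' * X := mul_le_mul_of_nonneg_left hNX (Nat.cast_nonneg _)
  have htX' : (t' : ℝ) ≤ C * (3 ^ m + 4) * X := by
    calc (t' : ℝ) ≤ ((C * ((3 * N) ^ m + s + r) : ℕ) : ℝ) := Nat.cast_le.2 ht'
      _ = C * ((((3 * N) ^ m : ℕ) : ℝ) + s + r) := by push_cast; rfl
      _ ≤ C * ((3 ^ m + 4) * X) :=
        mul_le_mul_of_nonneg_left (by linarith) (Nat.cast_nonneg _)
      _ = C * (3 ^ m + 4) * X := by ring
  have htrX : (I.numTranslates : ℝ) ≤ (3 + 2 * Fs.length * 3 ^ m) * X := by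
    rw [htr]
    have h1 := length_allObjects_le (g := g) (s := s) (bit := σ.wmem) hFs.valid hN
    rw [← hm] at h1
    calc _ ≤ ((s + (1 + Fs.length * (2 * (3 * N) ^ m)) : ℕ) : ℝ) := Nat.cast_le.2 h1
      _ = s + (1 + 2 * Fs.length * (((3 * N) ^ m : ℕ) : ℝ)) := by push_cast; ring
      _ ≤ 2 * X + (X + 2 * Fs.length * (3 ^ m * X)) :=
        add_le_add hsu (add_le_add (hY1.trans hYX)
          (mul_le_mul_of_nonneg_left hmX (by positivity)))
      _ = _ := by ring
  have horY : (I.numOrthants : ℝ) ≤ (3 + Fs.length * (4 + 2 * 3 ^ D)) * Y := by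
    rw [hor]
    have h1 := sum_length_allShapes_le (g := g) (r := r) hFs.valid hN
    calc _ ≤ ((r + (1 + Fs.length * (4 + 2 * (3 * N) ^ D)) : ℕ) : ℝ) := Nat.cast_le.2 h1
      _ = r + (1 + Fs.length * (4 + 2 * (((3 * N) ^ D : ℕ) : ℝ))) := by push_cast; ring
      _ ≤ 2 * Y + (Y + Fs.length * (4 * Y + 2 * (3 ^ D * Y))) :=
        add_le_add hru (add_le_add hY1
          (mul_le_mul_of_nonneg_left (by linarith) (by positivity)))
      _ = _ := by ring
  have hC0 : (0 : ℝ) ≤ C' + C * (3 ^ m + 4) := by positivity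
  have hT0 : (0 : ℝ) ≤ 3 + 2 * Fs.length * 3 ^ m := by positivity
  have hO0 : (0 : ℝ) ≤ 3 + Fs.length * (4 + 2 * 3 ^ D) := by positivity
  have hX0 : 0 ≤ X := by linarith
  have hY0 : 0 ≤ Y := by linarith
  refine ⟨_, t + t', I, ex.seq ex', ?_, hdesc, ?_, ?_, ?_, ?_, ?_⟩
  · rw [Nat.cast_add]
    refine le_trans (b := (C' + C * (3 ^ m + 4)) * X) (by linarith)
      (mul_le_mul_of_nonneg_right (by linarith) hX0)
  · refine hyes.trans (hFs.isYes_iff hN hr0 hs0 hH h3 fun a b c => ?_)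
    rw [hσm]
    exact inputState_wmem_ne_zero a b c
  · rw [htr]
    exact hsl.trans (Nat.cast_le.2 le_length_allObjects)
  · exact htrX.trans (mul_le_mul_of_nonneg_right (by linarith) hX0)
  · rw [hor]
    exact hrl.trans (Nat.cast_le.2 le_sum_length_allShapes)
  · exact horY.trans (mul_le_mul_of_nonneg_right (by linarith) hY0)
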